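/- Let $\mathbf{Gpd}$ be the category of small groupoids and functors. For a functor $F:A\to B$ between groupoids let $MF$ be the groupoid whose objects are pairs $(a,\,x:b\cong Fa)$ with $a\in A$ and $x$ an isomorphism in $B$, and whose arrows $(a,x:b\cong Fa)\to(a',x':b'\cong Fa')$ are pairs of arrows $\beta:b\to b'$, $\alpha:a\to a'$ with $x'\beta=F(\alpha)\,x$. The factorisation $F=(RF)(LF)$ with $LF:A\to MF$, $a\mapsto(a,\mathrm{id}_{Fa})$, and $RF:MF\to B$, $(a,x:b\cong Fa)\mapsto b$, together with the comultiplication $\Delta_F:MF\to M(LF)$, $\Delta_F(a,x)=(a,(x,\mathrm{id}_a):(a,x)\cong (LF)a)$, and the multiplication $\mu_F:M(RF)\to MF$, $\mu_F((a,x),x')=(a,xx')$, is an algebraic weak factorisation system on $\mathbf{Gpd}$. Let $R\text{-}\mathbf{Alg}$ be the category of algebras for its monad $R$ on the arrow category $\mathbf{Gpd}^{\mathbf 2}$, and let $S:R\text{-}\mathbf{Alg}\to\mathbf{Gpd}$ send an algebra on $F:A\to B$ to $B$. Call a functor $p:\mathbf E\to\mathbf B$ an elementary fibration if it is a fibration;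 $\mathbf B$ and all fibres $\mathbf E_X$ have finite products, and reindexing preserves the finite products of the fibres; for all objects $Y,X$ of $\mathbf B$, reindexing along the parametrised diagonal $\delta_{Y,X}=\langle \mathrm{pr}_1,\mathrm{pr}_2,\mathrm{pr}_2\rangle:Y\times X\to Y\times X\times X$ has a left adjoint $\Sigma_{Y,X}$; and these left adjoints satisfy * Frobenius Reciprocity: for all $A$ over $Y\times X$ and $C$ over $Y\times X\times X$ the canonical arrow $\Sigma_{Y,X}(\delta_{Y,X}^*C\wedge A)\to C\wedge\Sigma_{Y,X}A$ is an isomorphism; * the Beck–Chevalley Condition: for all $f:Y\to Z$ and all $A$ over $Z\times X$ the canonical arrow $\Sigma_{Y,X}(f\times X)^*A\to(f\times X\times X)^*\Sigma_{Z,X}A$ is an isomorphism. Then: 1. $S:R\text{-}\mathbf{Alg}\to\mathbf{Gpd}$ is an elementary fibration. 2. The algebras are the split cloven isofibrations: $R\text{-}\mathbf{Alg}$ is equivalent, strictly over $\mathbf{Gpd}^{\mathbf 2}$ (hence over $\mathbf{Gpd}$), to the category whose objects are functors $F:A\to B$ between groupoids equipped with a choice, for each $a\in A$ and isomorphism $x:b\cong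 Fa$, of an arrow into $a$ over $x$, such that the chosen lifts of identities are identities and the chosen lifts of composites are the composites of the chosen lifts, and whose arrows are the commutative squares preserving the chosen lifts strictly. -/

import Mathlib

open CategoryTheory Limits

universe u

namespace ElemFib

section Reindexing

universe v₁ v₂ u₁ u₂

variable {B : Type u₁} {E : Type u₂} [Category.{v₁} B] [Category.{v₂} E]
  (p : E ⥤ B) [p.IsFibered]

/-- The reindexed object `f^* A` of `A` along `f`, for a chosen cleavage of the fibration `p`. -/
noncomputable def reindexObj {X Y : B} (f : X ⟶ Y) (A : p.Fiber Y) : p.Fiber X :=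
  ⟨Functor.IsPreFibered.pullbackObj A.2 f, Functor.IsPreFibered.pullbackObj_proj A.2 f⟩

/-- The chosen cartesian lift `f^* A ⟶ A` of `f` into `A`. -/
noncomputable def cartLift {X Y : B} (f : X ⟶ Y) (A : p.Fiber Y) : (reindexObj p f A).1 ⟶ A.1 :=
  Functor.IsPreFibered.pullbackMap A.2 f

instance cartLift_isCartesian {X Y : B} (f : X ⟶ Y) (A : p.Fiber Y) :
    p.IsCartesian f (cartLift p f A) :=
  Functor.IsPreFibered.pullbackMap.IsCartesian A.2 f

/-- The vertical arrow `C ⟶ f^* A` induced by an arrow `C ⟶ A` over `f`. -/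
noncomputable def vertLift {X Y : B} (f : X ⟶ Y) {C : p.Fiber X} {A : p.Fiber Y}
    (φ : C.1 ⟶ A.1) (hφ : p.IsHomLift f φ) : C ⟶ reindexObj p f A :=
  ⟨Functor.IsCartesian.map p f (cartLift p f A) φ, inferInstance⟩

theorem vertLift_fac {X Y : B} (f : X ⟶ Y) {C : p.Fiber X} {A : p.Fiber Y}
    (φ : C.1 ⟶ A.1) (hφ : p.IsHomLift f φ) : (vertLift p f φ hφ).1 ≫ cartLift p f A = φ :=
  Functor.IsCartesian.fac p f (cartLift p f A) φ

theorem vert_ext {X Y : B} (f : X ⟶ Y) {C : p.Fiber X} {A : p.Fiber Y}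
    {φ ψ : C ⟶ reindexObj p f A} (h : φ.1 ≫ cartLift p f A = ψ.1 ≫ cartLift p f A) : φ = ψ := by
  have := φ.2
  have := ψ.2
  exact Subtype.ext (Functor.IsCartesian.ext p f (cartLift p f A) φ.1 ψ.1 h)

theorem isHomLift_cartLift_comp {X Y : B} (f : X ⟶ Y) {A A' : p.Fiber Y} (φ : A ⟶ A') :
    p.IsHomLift f (cartLift p f A ≫ φ.1) := by
  have := φ.2
  exact IsHomLift.comp_lift_id_right p f (cartLift p f A) φ.1

/-- The reindexing functor `f^* : E_Y ⥤ E_X` between the fibres, for the chosen cleavage. -/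
noncomputable def reindex {X Y : B} (f : X ⟶ Y) : p.Fiber Y ⥤ p.Fiber X where
  obj A := reindexObj p f A
  map {A A'} φ := vertLift p f (cartLift p f A ≫ φ.1) (isHomLift_cartLift_comp p f φ)
  map_id A := by
    apply vert_ext
    rw [vertLift_fac]
    change _ ≫ 𝟙 _ = 𝟙 _ ≫ _
    simp
  map_comp {A A' A''} φ ψ := by
    apply vert_ext
    rw [vertLift_fac]
    change cartLift p f A ≫ φ.1 ≫ ψ.1 = ((vertLift p f _ _).1 ≫ (vertLift p f _ _).1) ≫ _
    rw [Category.assoc, vertLift_fac, ← Category.assoc, ← Category.assoc, vertLift_fac]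

/-- The arrow `f^* g^* A ⟶ g'^* A` over `f'` attached to a commutative square `f ≫ g = f' ≫ g'`:
the factorisation of `f^* g^* A ⟶ g^* A ⟶ A` through the cartesian lift `g'^* A ⟶ A`. -/
noncomputable def reindexCommAux {X Y Y' Z : B} {f : X ⟶ Y} {g : Y ⟶ Z} {f' : X ⟶ Y'}
    {g' : Y' ⟶ Z} (h : f ≫ g = f' ≫ g') (A : p.Fiber Z) :
    (reindexObj p f (reindexObj p g A)).1 ⟶ (reindexObj p g' A).1 :=
  Functor.IsStronglyCartesian.map p g' (cartLift p g' A) h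
    (cartLift p f (reindexObj p g A) ≫ cartLift p g A)

instance reindexCommAux_isHomLift {X Y Y' Z : B} {f : X ⟶ Y} {g : Y ⟶ Z} {f' : X ⟶ Y'}
    {g' : Y' ⟶ Z} (h : f ≫ g = f' ≫ g') (A : p.Fiber Z) :
    p.IsHomLift f' (reindexCommAux p h A) :=
  Functor.IsStronglyCartesian.map_isHomLift p g' (cartLift p g' A) h
    (cartLift p f (reindexObj p g A) ≫ cartLift p g A)

/-- The canonical comparison `f^* g^* A ⟶ f'^* g'^* A` attached to a commutative square
`f ≫ g = f' ≫ g'` in the base: the unique vertical arrow compatible with the cartesian lifts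
into `A`. -/
noncomputable def reindexComm {X Y Y' Z : B} {f : X ⟶ Y} {g : Y ⟶ Z} {f' : X ⟶ Y'} {g' : Y' ⟶ Z}
    (h : f ≫ g = f' ≫ g') (A : p.Fiber Z) :
    (reindex p f).obj ((reindex p g).obj A) ⟶ (reindex p f').obj ((reindex p g').obj A) :=
  vertLift p f' (C := reindexObj p f (reindexObj p g A)) (A := reindexObj p g' A)
    (reindexCommAux p h A) (reindexCommAux_isHomLift p h A)

end Reindexing

section Elementary

universe v₁ v₂ u₁ u₂

variable {B : Type u₁} {E : Type u₂} [Category.{v₁} B] [Category.{v₂} E]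

/-- A fibration with finite products: a fibration whose base and fibres have finite products, the
latter being preserved by reindexing. -/
class IsFibrationWithProducts (p : E ⥤ B) : Prop where
  isFibered : p.IsFibered
  base : HasFiniteProducts B
  fiber : ∀ X : B, HasFiniteProducts (p.Fiber X)
  reindex_preserves : ∀ {X Y : B} (f : X ⟶ Y), PreservesFiniteProducts (reindex p f)

attribute [instance] IsFibrationWithProducts.isFibered IsFibrationWithProducts.fiber

section ParamDiag

variable [HasFiniteProducts B]

/-- The parametrised diagonal `⟨pr₁, pr₂, pr₂⟩ : Y × X ⟶ Y × X × X`. -/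
noncomputable def paramDiag (Y X : B) : Y ⨯ X ⟶ (Y ⨯ X) ⨯ X :=
  prod.lift (𝟙 (Y ⨯ X)) prod.snd

/-- The square with sides `f × X`, `f × X × X` and the parametrised diagonals commutes. -/
theorem paramDiag_square {Y Z : B} (f : Y ⟶ Z) (X : B) :
    prod.map f (𝟙 X) ≫ paramDiag Z X = paramDiag Y X ≫ prod.map (prod.map f (𝟙 X)) (𝟙 X) := by
  ext <;> simp [paramDiag]

end ParamDiag

variable (p : E ⥤ B)

/-- The canonical arrow `Σ (d^* B ∧ A) ⟶ B ∧ Σ A` of Frobenius Reciprocity, for a left adjoint `Σ`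
to reindexing along `d`. -/
noncomputable def frobeniusMap [IsFibrationWithProducts p] {X Y : B} {d : X ⟶ Y}
    {S : p.Fiber X ⥤ p.Fiber Y} (adj : S ⊣ reindex p d) (A : p.Fiber X) (C : p.Fiber Y) :
    S.obj ((reindex p d).obj C ⨯ A) ⟶ C ⨯ S.obj A :=
  prod.lift (S.map prod.fst ≫ adj.counit.app C) (S.map prod.snd)

/-- The canonical arrow `Σ f^* A ⟶ g^* Σ' A` of the Beck-Chevalley Condition, for a commutative
square `f ≫ d' = d ≫ g` and left adjoints `Σ` and `Σ'` to reindexing along `d` and `d'`. It is the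
transpose of `f^* A ⟶ f^* d'^* Σ' A ≅ d^* g^* Σ' A`, the first arrow being `f^*` of the unit. -/
noncomputable def beckChevalleyMap [p.IsFibered] {X X' Y Y' : B} {d : X ⟶ Y} {d' : X' ⟶ Y'}
    {f : X ⟶ X'} {g : Y ⟶ Y'} (sq : f ≫ d' = d ≫ g)
    {S : p.Fiber X ⥤ p.Fiber Y} (adj : S ⊣ reindex p d)
    {S' : p.Fiber X' ⥤ p.Fiber Y'} (adj' : S' ⊣ reindex p d') (A : p.Fiber X') :
    S.obj ((reindex p f).obj A) ⟶ (reindex p g).obj (S'.obj A) :=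
  (adj.homEquiv _ _).symm
    ((reindex p f).map (adj'.unit.app A) ≫ reindexComm p sq (S'.obj A))

/-- An elementary fibration: a fibration with finite products such that reindexing along every
parametrised diagonal `Y × X ⟶ Y × X × X` has a left adjoint, and these left adjoints satisfy
Frobenius Reciprocity and the Beck-Chevalley Condition. -/
structure IsElementary (p : E ⥤ B) : Prop extends IsFibrationWithProducts p where
  exists_leftAdjoints :
    ∃ (S : ∀ Y X : B, p.Fiber (Y ⨯ X) ⥤ p.Fiber ((Y ⨯ X) ⨯ X))
      (adj : ∀ Y X : B, S Y X ⊣ reindex p (paramDiag Y X)),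
      (∀ (Y X : B) (A : p.Fiber (Y ⨯ X)) (C : p.Fiber ((Y ⨯ X) ⨯ X)),
        IsIso (frobeniusMap p (adj Y X) A C)) ∧
      (∀ {Y Z : B} (f : Y ⟶ Z) (X : B) (A : p.Fiber (Z ⨯ X)),
        IsIso (beckChevalleyMap p (paramDiag_square f X) (adj Y X) (adj Z X) A))

end Elementary

section AWFS

universe v

/-- A functorial factorisation `f = L f ≫ R f` through `M f`. -/
structure FunctorialFactorisation (C : Type u) [Category.{v} C] where
  M : Arrow C ⥤ C
  lam : Arrow.leftFunc ⟶ M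
  rho : M ⟶ Arrow.rightFunc
  fac : ∀ f : Arrow C, lam.app f ≫ rho.app f = f.hom

namespace FunctorialFactorisation

variable {C : Type u} [Category.{v} C] (Φ : FunctorialFactorisation C)

/-- The left functor `L` of the factorisation. -/
@[simps]
def L : Arrow C ⥤ Arrow C where
  obj f := Arrow.mk (Φ.lam.app f)
  map {f g} s := Arrow.homMk s.left (Φ.M.map s) (Φ.lam.naturality s)

/-- The right functor `R` of the factorisation. -/
@[simps]
def R : Arrow C ⥤ Arrow C where
  obj f := Arrow.mk (Φ.rho.app f)
  map {f g} s := Arrow.homMk (Φ.M.map s) s.right (Φ.rho.naturality s)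

/-- The counit `L f ⟶ f`, given by `(id, R f)`. -/
def counit (f : Arrow C) : Φ.L.obj f ⟶ f :=
  Arrow.homMk (𝟙 _) (Φ.rho.app f) ((Category.id_comp _).trans (Φ.fac f).symm)

/-- The unit `f ⟶ R f`, given by `(L f, id)`. -/
def unit (f : Arrow C) : f ⟶ Φ.R.obj f :=
  Arrow.homMk (Φ.lam.app f) (𝟙 _) ((Φ.fac f).trans (Category.comp_id _).symm)

end FunctorialFactorisation

/-- An algebraic weak factorisation system: a functorial factorisation with a comultiplication
`(id, Δ) : L ⟶ L L` making `L` (with its counit) a comonad, a multiplication `(μ, id) : R R ⟶ R`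
making `R` (with its unit) a monad, such that `(Δ, μ) : L R ⟶ R L` is a distributive law. -/
structure AWFS (C : Type u) [Category.{v} C] extends FunctorialFactorisation C where
  comul : ∀ f : Arrow C, M.obj f ⟶ M.obj (toFunctorialFactorisation.L.obj f)
  comul_natural : ∀ {f g : Arrow C} (s : f ⟶ g),
    M.map s ≫ comul g = comul f ≫ M.map (toFunctorialFactorisation.L.map s)
  lam_comul : ∀ f, lam.app f ≫ comul f = lam.app (toFunctorialFactorisation.L.obj f)
  comul_rho : ∀ f, comul f ≫ rho.app (toFunctorialFactorisation.L.obj f) = 𝟙 (M.obj f)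
  comul_counit : ∀ f, comul f ≫ M.map (toFunctorialFactorisation.counit f) = 𝟙 (M.obj f)
  coassoc : ∀ f, comul f ≫ comul (toFunctorialFactorisation.L.obj f) =
    comul f ≫ M.map (X := toFunctorialFactorisation.L.obj f)
      (Y := toFunctorialFactorisation.L.obj (toFunctorialFactorisation.L.obj f))
      (Arrow.homMk (𝟙 _) (comul f) ((Category.id_comp _).trans (lam_comul f).symm))
  mul : ∀ f : Arrow C, M.obj (toFunctorialFactorisation.R.obj f) ⟶ M.obj f
  mul_natural : ∀ {f g : Arrow C} (s : f ⟶ g),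
    M.map (toFunctorialFactorisation.R.map s) ≫ mul g = mul f ≫ M.map s
  mul_rho : ∀ f, mul f ≫ rho.app f = rho.app (toFunctorialFactorisation.R.obj f)
  lam_mul : ∀ f, lam.app (toFunctorialFactorisation.R.obj f) ≫ mul f = 𝟙 (M.obj f)
  unit_mul : ∀ f, M.map (toFunctorialFactorisation.unit f) ≫ mul f = 𝟙 (M.obj f)
  assoc : ∀ f, mul (toFunctorialFactorisation.R.obj f) ≫ mul f =
    M.map (X := toFunctorialFactorisation.R.obj (toFunctorialFactorisation.R.obj f))
      (Y := toFunctorialFactorisation.R.obj f)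
      (Arrow.homMk (mul f) (𝟙 _) ((mul_rho f).trans (Category.comp_id _).symm)) ≫ mul f
  distrib : ∀ f, mul f ≫ comul f =
    comul (toFunctorialFactorisation.R.obj f) ≫
      M.map (X := toFunctorialFactorisation.L.obj (toFunctorialFactorisation.R.obj f))
        (Y := toFunctorialFactorisation.R.obj (toFunctorialFactorisation.L.obj f))
        (Arrow.homMk (comul f) (mul f) ((comul_rho f).trans (lam_mul f).symm)) ≫
      mul (toFunctorialFactorisation.L.obj f)

namespace AWFS

variable {C : Type u} [Category.{v} C] (W : AWFS C)

/-- The comonad with underlying functor `L`. -/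
def comonadL : Comonad (Arrow C) where
  toFunctor := W.L
  ε := { app f := W.counit f
         naturality f g s := by
           ext
           · exact (Category.comp_id _).trans (Category.id_comp _).symm
           · exact W.rho.naturality s }
  δ := { app f := Arrow.homMk (𝟙 _) (W.comul f)
           ((Category.id_comp _).trans (W.lam_comul f).symm)
         naturality f g s := by
           ext
           · exact (Category.comp_id _).trans (Category.id_comp _).symm
           · exact W.comul_natural s }
  coassoc f := by
    ext
    · rfl
    · exact (W.coassoc f).symm
  left_counit f := by
    ext
    · exact Category.comp_id _
    · exact W.comul_rho f
  right_counit f := by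
    ext
    · exact Category.comp_id _
    · exact W.comul_counit f

/-- The monad with underlying functor `R`. -/
def monadR : Monad (Arrow C) where
  toFunctor := W.R
  η := { app f := W.unit f
         naturality f g s := by
           ext
           · exact W.lam.naturality s
           · exact (Category.comp_id _).trans (Category.id_comp _).symm }
  μ := { app f := Arrow.homMk (W.mul f) (𝟙 _)
           ((W.mul_rho f).trans (Category.comp_id _).symm)
         naturality f g s := by
           ext
           · exact W.mul_natural s
           · exact (Category.comp_id _).trans (Category.id_comp _).symm }
  assoc f := by
    ext
    · exact (W.assoc f).symm
    · rfl
  left_unit f := by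
    ext
    · exact W.lam_mul f
    · exact Category.comp_id _
  right_unit f := by
    ext
    · exact W.unit_mul f
    · exact Category.comp_id _

/-- The category `R-Alg` of algebras for the monad `R`. -/
abbrev RAlg := W.monadR.Algebra

/-- The forgetful functor `R-Alg ⥤ C`, sending an algebra on an arrow to the codomain of that
arrow. -/
def algFunctor : W.RAlg ⥤ C := W.monadR.forget ⋙ Arrow.rightFunc

end AWFS

end AWFS

section PathObject

variable {X A B A' B' : Type u} [Category.{u} X] [Groupoid.{u} A] [Groupoid.{u} B]
  [Groupoid.{u} A'] [Groupoid.{u} B']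

/-- The objects `(A, x : B ≅ F A)` of `M F`, for a functor `F` between groupoids. As every arrow of a
groupoid is invertible, `x` is just an arrow. -/
structure PathObj (F : A ⥤ B) where
  base : B
  pt : A
  iso : base ⟶ F.obj pt

namespace PathObj

/-- The arrows `(b, a)` of `M F`: commutative squares. -/
@[ext]
structure Hom {F : A ⥤ B} (P Q : PathObj F) where
  base : P.base ⟶ Q.base
  pt : P.pt ⟶ Q.pt
  w : base ≫ Q.iso = P.iso ≫ F.map pt

instance (F : A ⥤ B) : Groupoid (PathObj F) where
  Hom P Q := Hom P Q
  id P := ⟨𝟙 _, 𝟙 _, by simp⟩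
  comp f g := ⟨f.base ≫ g.base, f.pt ≫ g.pt, by
    rw [Category.assoc, g.w, ← Category.assoc, f.w, Category.assoc, F.map_comp]⟩
  inv f := ⟨Groupoid.inv f.base, Groupoid.inv f.pt, by
    rw [Groupoid.inv_eq_inv, Groupoid.inv_eq_inv, IsIso.inv_comp_eq, F.map_inv,
      ← Category.assoc, f.w, Category.assoc, IsIso.hom_inv_id, Category.comp_id]⟩
  id_comp f := Hom.ext (Category.id_comp _) (Category.id_comp _)
  comp_id f := Hom.ext (Category.comp_id _) (Category.comp_id _)
  assoc f g h := Hom.ext (Category.assoc _ _ _) (Category.assoc _ _ _)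
  inv_comp f := Hom.ext (Groupoid.inv_comp _) (Groupoid.inv_comp _)
  comp_inv f := Hom.ext (Groupoid.comp_inv _) (Groupoid.comp_inv _)

variable {F : A ⥤ B}

@[ext]
theorem hom_ext {P Q : PathObj F} {f g : P ⟶ Q} (h : f.base = g.base) (h' : f.pt = g.pt) :
    f = g :=
  Hom.ext h h'

@[simp] theorem id_base (P : PathObj F) : Hom.base (𝟙 P) = 𝟙 P.base := rfl
@[simp] theorem id_pt (P : PathObj F) : Hom.pt (𝟙 P) = 𝟙 P.pt := rfl
@[simp] theorem comp_base {P Q S : PathObj F} (f : P ⟶ Q) (g : Q ⟶ S) :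
    (f ≫ g).base = f.base ≫ g.base := rfl
@[simp] theorem comp_pt {P Q S : PathObj F} (f : P ⟶ Q) (g : Q ⟶ S) :
    (f ≫ g).pt = f.pt ≫ g.pt := rfl

theorem eqToHom_base {P Q : PathObj F} (h : P = Q) :
    (eqToHom h).base = eqToHom (congrArg base h) := by
  subst h; rfl

theorem eqToHom_pt {P Q : PathObj F} (h : P = Q) :
    (eqToHom h).pt = eqToHom (congrArg pt h) := by
  subst h; rfl

/-- The functor `R F : M F ⥤ B`. -/
abbrev baseFunctor (F : A ⥤ B) : PathObj F ⥤ B where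
  obj P := P.base
  map f := f.base

/-- The functor `M F ⥤ A`, `(A, x) ↦ A`. -/
abbrev ptFunctor (F : A ⥤ B) : PathObj F ⥤ A where
  obj P := P.pt
  map f := f.pt

/-- A functor into `M F` is given by functors `b` into `B` and `a` into `A` and a natural
isomorphism `b ≅ F a`. -/
@[simps]
def lift (b : X ⥤ B) (a : X ⥤ A) (α : ∀ x, b.obj x ⟶ F.obj (a.obj x))
    (hα : ∀ {x y : X} (f : x ⟶ y), b.map f ≫ α y = α x ≫ F.map (a.map f)) : X ⥤ PathObj F where
  obj x := ⟨b.obj x, a.obj x, α x⟩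
  map f := ⟨b.map f, a.map f, hα f⟩
  map_id x := hom_ext (b.map_id x) (a.map_id x)
  map_comp f g := hom_ext (b.map_comp f g) (a.map_comp f g)

theorem lift_ext {b b' : X ⥤ B} {a a' : X ⥤ A} {α : ∀ x, b.obj x ⟶ F.obj (a.obj x)}
    {β : ∀ x, b'.obj x ⟶ F.obj (a'.obj x)}
    {hα : ∀ {x y : X} (f : x ⟶ y), b.map f ≫ α y = α x ≫ F.map (a.map f)}
    {hβ : ∀ {x y : X} (f : x ⟶ y), b'.map f ≫ β y = β x ≫ F.map (a'.map f)}
    (hb : b = b') (ha : a = a') (h : ∀ x, α x ≫ F.map (eqToHom (Functor.congr_obj ha x)) =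
      eqToHom (Functor.congr_obj hb x) ≫ β x) :
    lift b a α hα = lift b' a' β hβ := by
  subst hb
  subst ha
  have : α = β := funext fun x => by simpa using h x
  subst this
  rfl

/-- Two functors into `M F` with the same components agree if their isomorphisms agree. -/
theorem functor_ext {G H : X ⥤ PathObj F} (hb : G ⋙ baseFunctor F = H ⋙ baseFunctor F)
    (hp : G ⋙ ptFunctor F = H ⋙ ptFunctor F)
    (h : ∀ x, (G.obj x).iso ≫ F.map (eqToHom (Functor.congr_obj hp x)) =
      eqToHom (Functor.congr_obj hb x) ≫ (H.obj x).iso) : G = H :=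
  lift_ext (b := G ⋙ baseFunctor F) (b' := H ⋙ baseFunctor F) (a := G ⋙ ptFunctor F)
    (a' := H ⋙ ptFunctor F) (α := fun x => (G.obj x).iso) (β := fun x => (H.obj x).iso)
    (hα := fun f => (G.map f).w) (hβ := fun f => (H.map f).w) hb hp h

/-- The functor `L F : A ⥤ M F`, `A ↦ (A, id)`. -/
abbrev lam (F : A ⥤ B) : A ⥤ PathObj F :=
  lift F (𝟭 A) (fun a => 𝟙 (F.obj a))
    (fun f => (Category.comp_id (F.map f)).trans (Category.id_comp (F.map f)).symm)

theorem sq_obj {F : A ⥤ B} {G : A' ⥤ B'} {H : A ⥤ A'} {K : B ⥤ B'} (h : H ⋙ G = F ⋙ K) (a : A) :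
    K.obj (F.obj a) = G.obj (H.obj a) :=
  (Functor.congr_obj h a).symm

theorem map_naturality {F : A ⥤ B} {G : A' ⥤ B'} {H : A ⥤ A'} {K : B ⥤ B'} (h : H ⋙ G = F ⋙ K)
    {P Q : PathObj F} (f : P ⟶ Q) :
    K.map f.base ≫ K.map Q.iso ≫ eqToHom (sq_obj h Q.pt) =
      (K.map P.iso ≫ eqToHom (sq_obj h P.pt)) ≫ G.map (H.map f.pt) := by
  have e := Functor.congr_hom h f.pt
  simp only [Functor.comp_map] at e
  rw [e, ← Category.assoc, ← K.map_comp, f.w]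
  simp

/-- The action of `M` on a commutative square `(H, K)` from `F` to `G`:
`(A, x) ↦ (H A, K x)`. -/
abbrev map {F : A ⥤ B}
    {G : A' ⥤ B'} {H : A ⥤ A'} {K : B ⥤ B'} (h : H ⋙ G = F ⋙ K) : PathObj F ⥤ PathObj G :=
  lift (baseFunctor F ⋙ K) (ptFunctor F ⋙ H)
    (fun P => K.map P.iso ≫ eqToHom (sq_obj h P.pt)) (map_naturality h)

/-- The comultiplication `(A, x) ↦ (A, (x, id) : (A, x) ≅ (L F) A)`. -/
abbrev comul (F : A ⥤ B) : PathObj F ⥤ PathObj (lam F) :=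
  lift (F := lam F) (𝟭 (PathObj F)) (ptFunctor F)
    (fun P => ⟨P.iso, 𝟙 P.pt, congrArg (fun t => P.iso ≫ t) (F.map_id P.pt).symm⟩)
    (fun f => hom_ext f.w ((Category.comp_id f.pt).trans (Category.id_comp f.pt).symm))

theorem mul_naturality {F : A ⥤ B} {P Q : PathObj (baseFunctor F)} (f : P ⟶ Q) :
    f.base ≫ Q.iso ≫ Q.pt.iso = (P.iso ≫ P.pt.iso) ≫ F.map f.pt.pt := by
  have e : f.base ≫ Q.iso = P.iso ≫ f.pt.base := f.w
  have e' : f.pt.base ≫ Q.pt.iso = P.pt.iso ≫ F.map f.pt.pt := f.pt.w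
  rw [Category.assoc, ← e', ← Category.assoc, e, Category.assoc]

/-- The multiplication `((A, x : B ≅ F A), x' : B' ≅ B) ↦ (A, x x' : B' ≅ F A)`. -/
abbrev mul (F : A ⥤ B) : PathObj (baseFunctor F) ⥤ PathObj F :=
  lift (baseFunctor (baseFunctor F)) (ptFunctor (baseFunctor F) ⋙ ptFunctor F)
    (fun P => P.iso ≫ P.pt.iso) mul_naturality

end PathObj

section Laws

open PathObj

variable {A'' B'' : Type u} [Groupoid.{u} A''] [Groupoid.{u} B'']
  {F : A ⥤ B} {F' : A' ⥤ B'} {F'' : A'' ⥤ B''}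

theorem map_id' (h : 𝟭 A ⋙ F = F ⋙ 𝟭 B) : PathObj.map h = 𝟭 (PathObj F) := by
  refine functor_ext rfl rfl fun P => ?_
  change (P.iso ≫ 𝟙 (F.obj P.pt)) ≫ F.map (𝟙 P.pt) = 𝟙 P.base ≫ P.iso
  simp

theorem map_comp' {H : A ⥤ A'} {K : B ⥤ B'} {H' : A' ⥤ A''} {K' : B' ⥤ B''}
    (h : H ⋙ F' = F ⋙ K) (h' : H' ⋙ F'' = F' ⋙ K') (h'' : (H ⋙ H') ⋙ F'' = F ⋙ (K ⋙ K')) :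
    PathObj.map h'' = PathObj.map h ⋙ PathObj.map h' := by
  refine functor_ext rfl rfl fun P => ?_
  change (K'.map (K.map P.iso) ≫ eqToHom (sq_obj h'' P.pt)) ≫ F''.map (𝟙 (H'.obj (H.obj P.pt))) =
    𝟙 (K'.obj (K.obj P.base)) ≫ K'.map (K.map P.iso ≫ eqToHom (sq_obj h P.pt)) ≫
      eqToHom (sq_obj h' (H.obj P.pt))
  simp [eqToHom_map]

theorem lam_nat {H : A ⥤ A'} {K : B ⥤ B'} (h : H ⋙ F' = F ⋙ K) :
    H ⋙ lam F' = lam F ⋙ PathObj.map h := by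
  refine functor_ext h rfl fun a => ?_
  change 𝟙 (F'.obj (H.obj a)) ≫ F'.map (𝟙 (H.obj a)) = eqToHom (sq_obj h a).symm ≫
    K.map (𝟙 (F.obj a)) ≫ eqToHom (sq_obj h a)
  simp

theorem comul_nat {H : A ⥤ A'} {K : B ⥤ B'} (h : H ⋙ F' = F ⋙ K) :
    PathObj.map h ⋙ comul F' = comul F ⋙ PathObj.map (lam_nat h) := by
  refine functor_ext rfl rfl fun P => hom_ext ?_ ?_
  · change (K.map P.iso ≫ eqToHom (sq_obj h P.pt)) ≫ F'.map (𝟙 (H.obj P.pt)) =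
      𝟙 (K.obj P.base) ≫ K.map P.iso ≫ (eqToHom (sq_obj (lam_nat h) P.pt)).base
    rw [eqToHom_base]
    simp
    rfl
  · change 𝟙 (H.obj P.pt) ≫ 𝟙 (H.obj P.pt) =
      𝟙 (H.obj P.pt) ≫ H.map (𝟙 P.pt) ≫ (eqToHom (sq_obj (lam_nat h) P.pt)).pt
    rw [eqToHom_pt]
    simp
    exact (Category.id_comp _).symm

theorem lam_comul' : lam F ⋙ comul F = lam (lam F) := by
  refine functor_ext rfl rfl fun P => hom_ext ?_ ?_
  · change 𝟙 (F.obj P) ≫ F.map (𝟙 P) = 𝟙 (F.obj P) ≫ 𝟙 (F.obj P)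
    simp
  · rfl

theorem comul_counit' (h : 𝟭 A ⋙ F = lam F ⋙ baseFunctor F) :
    comul F ⋙ PathObj.map h = 𝟭 (PathObj F) := by
  refine functor_ext rfl rfl fun P => ?_
  change (P.iso ≫ 𝟙 (F.obj P.pt)) ≫ F.map (𝟙 P.pt) = 𝟙 P.base ≫ P.iso
  simp

theorem coassoc' (h : 𝟭 A ⋙ lam (lam F) = lam F ⋙ comul F) :
    comul F ⋙ comul (lam F) = comul F ⋙ PathObj.map h := by
  refine functor_ext rfl rfl fun P => hom_ext (hom_ext ?_ ?_) ?_
  · change P.iso ≫ F.map (𝟙 P.pt) =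
      𝟙 P.base ≫ P.iso ≫ 𝟙 (F.obj P.pt)
    simp
  · change 𝟙 P.pt ≫ 𝟙 P.pt = 𝟙 P.pt ≫ 𝟙 P.pt ≫ 𝟙 P.pt
    simp
  · change 𝟙 P.pt ≫ 𝟙 P.pt = 𝟙 P.pt ≫ 𝟙 P.pt ≫ 𝟙 P.pt
    simp

theorem mul_nat {H : A ⥤ A'} {K : B ⥤ B'} (h : H ⋙ F' = F ⋙ K)
    (h' : PathObj.map h ⋙ baseFunctor F' = baseFunctor F ⋙ K) :
    PathObj.map h' ⋙ mul F' = mul F ⋙ PathObj.map h := by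
  refine functor_ext rfl rfl fun P => ?_
  change ((K.map P.iso ≫ 𝟙 (K.obj P.pt.base)) ≫ K.map P.pt.iso ≫ eqToHom (sq_obj h P.pt.pt)) ≫
      F'.map (𝟙 (H.obj P.pt.pt)) =
    𝟙 (K.obj P.base) ≫ K.map (P.iso ≫ P.pt.iso) ≫ eqToHom (sq_obj h P.pt.pt)
  have e : K.map (P.iso ≫ P.pt.iso) = K.map P.iso ≫ K.map P.pt.iso := K.map_comp _ _
  rw [e]
  simp

theorem lam_mul' : lam (baseFunctor F) ⋙ mul F = 𝟭 (PathObj F) := by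
  refine functor_ext rfl rfl fun P => ?_
  change (𝟙 P.base ≫ P.iso) ≫ F.map (𝟙 P.pt) = 𝟙 P.base ≫ P.iso
  simp

theorem unit_mul' (h : lam F ⋙ baseFunctor F = F ⋙ 𝟭 B) :
    PathObj.map h ⋙ mul F = 𝟭 (PathObj F) := by
  refine functor_ext rfl rfl fun P => ?_
  change ((P.iso ≫ 𝟙 (F.obj P.pt)) ≫ 𝟙 (F.obj P.pt)) ≫ F.map (𝟙 P.pt) = 𝟙 P.base ≫ P.iso
  simp

theorem assoc' (h : mul F ⋙ baseFunctor F = baseFunctor (baseFunctor F) ⋙ 𝟭 B) :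
    mul (baseFunctor F) ⋙ mul F = PathObj.map h ⋙ mul F := by
  refine functor_ext rfl rfl fun P => ?_
  have key : ∀ {b₁ b₂ b₃ : B} (x : b₁ ⟶ b₂) (y : b₂ ⟶ b₃) (z : b₃ ⟶ F.obj P.pt.pt.pt),
      ((x ≫ y) ≫ z) ≫ F.map (𝟙 P.pt.pt.pt) = 𝟙 b₁ ≫ (x ≫ 𝟙 b₂) ≫ y ≫ z := by
    intros; simp
  exact key P.iso P.pt.iso P.pt.pt.iso

theorem distrib' (h : comul F ⋙ baseFunctor (lam F) = lam (baseFunctor F) ⋙ mul F) :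
    mul F ⋙ comul F = comul (baseFunctor F) ⋙ PathObj.map h ⋙ mul (lam F) := by
  refine functor_ext rfl rfl fun P => hom_ext ?_ ?_
  · have e : (eqToHom (sq_obj h P.pt)).base = 𝟙 P.pt.base := eqToHom_base _
    change (P.iso ≫ P.pt.iso) ≫ F.map (𝟙 P.pt.pt) =
      𝟙 P.base ≫ (P.iso ≫ (eqToHom (sq_obj h P.pt)).base) ≫ P.pt.iso
    rw [e]
    have key : ∀ {b₁ b₂ : B} (x : b₁ ⟶ b₂) (y : b₂ ⟶ F.obj P.pt.pt),
        (x ≫ y) ≫ F.map (𝟙 P.pt.pt) = 𝟙 b₁ ≫ (x ≫ 𝟙 b₂) ≫ y := by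
      intros; simp
    exact key P.iso P.pt.iso
  · have e : (eqToHom (sq_obj h P.pt)).pt = 𝟙 P.pt.pt := eqToHom_pt _
    change 𝟙 P.pt.pt ≫ 𝟙 P.pt.pt =
      𝟙 P.pt.pt ≫ (𝟙 P.pt.pt ≫ (eqToHom (sq_obj h P.pt)).pt) ≫ 𝟙 P.pt.pt
    rw [e]
    have key : ∀ a : A, 𝟙 a ≫ 𝟙 a = 𝟙 a ≫ (𝟙 a ≫ 𝟙 a) ≫ 𝟙 a := by
      intros; simp
    exact key P.pt.pt

end Laws

/-- The functorial factorisation `A ⥤ M F ⥤ B` on groupoids. -/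
def grpdFactorisation : FunctorialFactorisation Grpd.{u, u} where
  M :=
    { obj f := Grpd.of (PathObj (A := f.left) (B := f.right) f.hom)
      map {f g} s := PathObj.map (A := f.left) (B := f.right) (A' := g.left) (B' := g.right)
        (F := f.hom) (G := g.hom) (H := s.left) (K := s.right) s.w
      map_id f := map_id' (A := f.left) (B := f.right) (F := f.hom) rfl
      map_comp {f g k} s t := map_comp' (A := f.left) (B := f.right) (A' := g.left)
        (B' := g.right) (A'' := k.left) (B'' := k.right) (F := f.hom) (F' := g.hom) (F'' := k.hom)
        (H := s.left) (K := s.right) (H' := t.left) (K' := t.right) s.w t.w (s ≫ t).w }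
  lam :=
    { app f := PathObj.lam (A := f.left) (B := f.right) f.hom
      naturality f g s := lam_nat (A := f.left) (B := f.right) (A' := g.left) (B' := g.right)
        (F := f.hom) (F' := g.hom) (H := s.left) (K := s.right) s.w }
  rho :=
    { app f := PathObj.baseFunctor (A := f.left) (B := f.right) f.hom
      naturality _ _ _ := rfl }
  fac _ := rfl

/-- The algebraic weak factorisation system on the category of (small) groupoids. -/
def grpdAWFS : AWFS Grpd.{u, u} where
  toFunctorialFactorisation := grpdFactorisation
  comul f := PathObj.comul (A := f.left) (B := f.right) f.hom
  comul_natural {f g} s := comul_nat (A := f.left) (B := f.right) (A' := g.left) (B' := g.right)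
    (F := f.hom) (F' := g.hom) (H := s.left) (K := s.right) s.w
  lam_comul f := lam_comul' (A := f.left) (B := f.right) (F := f.hom)
  comul_rho _ := rfl
  comul_counit f := comul_counit' (A := f.left) (B := f.right) (F := f.hom) rfl
  coassoc f := coassoc' (A := f.left) (B := f.right) (F := f.hom)
    (lam_comul' (A := f.left) (B := f.right) (F := f.hom)).symm
  mul f := PathObj.mul (A := f.left) (B := f.right) f.hom
  mul_natural {f g} s := mul_nat (A := f.left) (B := f.right) (A' := g.left) (B' := g.right)
    (F := f.hom) (F' := g.hom) (H := s.left) (K := s.right) s.w rfl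
  mul_rho _ := rfl
  lam_mul f := lam_mul' (A := f.left) (B := f.right) (F := f.hom)
  unit_mul f := unit_mul' (A := f.left) (B := f.right) (F := f.hom) rfl
  assoc f := assoc' (A := f.left) (B := f.right) (F := f.hom) rfl
  distrib f := distrib' (A := f.left) (B := f.right) (F := f.hom)
    ((lam_mul' (A := f.left) (B := f.right) (F := f.hom)).symm)

end PathObject

section SplitIsofibration

/-- A split cleavage for a functor `F` between groupoids: a choice, for every object `a` and every
isomorphism `x : b ⟶ F a`, of an isomorphism `lift a x` into `a` over `x`, such that the chosen lifts
of identities are identities and the chosen lifts of composites are the composites of the chosen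
lifts. -/
structure SplitCleavage {A B : Type u} [Groupoid.{u} A] [Groupoid.{u} B] (F : A ⥤ B) where
  lift : ∀ (a : A) {b : B} (_ : b ⟶ F.obj a), Over a
  obj_lift : ∀ (a : A) {b : B} (x : b ⟶ F.obj a), F.obj (lift a x).left = b
  map_lift : ∀ (a : A) {b : B} (x : b ⟶ F.obj a),
    F.map (lift a x).hom = eqToHom (obj_lift a x) ≫ x
  lift_id : ∀ a : A, lift a (𝟙 (F.obj a)) = Over.mk (𝟙 a)
  lift_comp : ∀ (a : A) {b c : B} (y : c ⟶ b) (x : b ⟶ F.obj a),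
    lift a (y ≫ x) = (Over.map (lift a x).hom).obj
      (lift (lift a x).left (y ≫ eqToHom (obj_lift a x).symm))

/-- A split cloven isofibration of groupoids. -/
structure SplitIsofib where
  arrow : Arrow Grpd.{u, u}
  cleavage : SplitCleavage (A := arrow.left) (B := arrow.right) arrow.hom

namespace SplitIsofib

/-- A commutative square between split cloven isofibrations preserves the cleavages strictly. -/
def Preserves (P Q : SplitIsofib.{u}) (s : P.arrow ⟶ Q.arrow) : Prop :=
  ∀ (a : P.arrow.left) {b : P.arrow.right} (x : b ⟶ P.arrow.hom.obj a),
    (Over.post s.left).obj (P.cleavage.lift a x) =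
      Q.cleavage.lift (s.left.obj a) (s.right.map x ≫ eqToHom (PathObj.sq_obj s.w a))

theorem preserves_id (P : SplitIsofib.{u}) : Preserves P P (𝟙 P.arrow) := by
  intro a b x
  have e : x ≫ 𝟙 _ = x := Category.comp_id x
  change P.cleavage.lift a x = P.cleavage.lift a (x ≫ 𝟙 _)
  rw [e]

theorem preserves_comp {P Q S : SplitIsofib.{u}} {s : P.arrow ⟶ Q.arrow} {t : Q.arrow ⟶ S.arrow}
    (hs : Preserves P Q s) (ht : Preserves Q S t) : Preserves P S (s ≫ t) := by
  intro a b x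
  have h₁ := congrArg (Over.post t.left).obj (hs a x)
  have h₂ := ht (s.left.obj a) (s.right.map x ≫ eqToHom (PathObj.sq_obj s.w a))
  refine h₁.trans (h₂.trans ?_)
  have e : t.right.map (s.right.map x ≫ eqToHom (PathObj.sq_obj s.w a)) ≫
      eqToHom (PathObj.sq_obj t.w (s.left.obj a)) =
      (s ≫ t).right.map x ≫ eqToHom (PathObj.sq_obj (s ≫ t).w a) := by
    rw [Functor.map_comp, eqToHom_map]
    exact (Category.assoc _ _ _).trans (congrArg _ (eqToHom_trans _ _))
  exact congrArg (fun y => S.cleavage.lift (t.left.obj (s.left.obj a)) y) e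

/-- The category of split cloven isofibrations of groupoids, with arrows the commutative squares
preserving the cleavages strictly. -/
instance : Category SplitIsofib.{u} where
  Hom P Q := { s : P.arrow ⟶ Q.arrow // Preserves P Q s }
  id P := ⟨𝟙 P.arrow, preserves_id P⟩
  comp s t := ⟨s.1 ≫ t.1, preserves_comp s.2 t.2⟩
  id_comp s := Subtype.ext (Category.id_comp s.1)
  comp_id s := Subtype.ext (Category.comp_id s.1)
  assoc s t r := Subtype.ext (Category.assoc s.1 t.1 r.1)

/-- The functor forgetting the cleavage. -/
def forget : SplitIsofib.{u} ⥤ Arrow Grpd.{u, u} where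
  obj P := P.arrow
  map s := s.1

end SplitIsofib

end SplitIsofibration

end ElemFib

/-! The fibration and its fibrewise products exist for every algebraic weak factorisation system on
a category with pullbacks. If an arrow `q` comes with a jointly monic family of squares into
algebras, any arrow out of the middle object of `q` compatible with these squares satisfies the
algebra laws, since each law can be tested on the legs (`ofLegs`). No legs give terminal objects,
two legs over an identity give binary products, one leg over `f` gives reindexing.

For the left adjoints it is enough to have cocartesian arrows `η : A ⟶ Σ A` over the parametrised
diagonals. Precomposed with `η`, each of the Frobenius and Beck–Chevalley comparisons becomes an
explicit arrow, and the comparison is invertible as soon as that arrow is cocartesian. So a class of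
cocartesian arrows is needed that is closed under products with cartesian arrows and under change of
parameters (`isElementary_of_cocartesian`).

In groupoids an algebra structure is a strict transport of elements along arrows of the base
(`transp`). Take for `Σ A` the pairs of an element `a` of `A` over `(y, x)` and an arrow `k : x' ⟶
x`, lying over `(y, x, x')`, and for `η` the map `a ↦ (a, id)`. Then `(a, k)` is the transport of
`(a, id)` along `k`. An algebra map out of `Σ A` is therefore determined on the image of `η`, and
every map out of `A` extends by transport (`isHom_transp`). `DiagData` records this retraction with
its contraction; it implies cocartesianness and has the required closure properties. Closure under
products uses that arrows of the base are invertible.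

For the second claim, an action `s : M F ⥤ A` sends the canonical arrow `(a, x) ⟶ (a, id)` to an
arrow `s (a, x) ⟶ a` over `x`: the chosen lift. Unit and associativity become the two splitting
laws. Lifts are invertible, so naturality recovers `s` on arrows from the lifts, and a square is an
algebra map exactly when it preserves them. The comparison is thus fully faithful, surjective on
objects, and the identity on underlying squares. -/

namespace ElemFib

/-! ### Strong fibrewise products, and a criterion for elementary fibrations by cocartesian arrows
-/

section FibrationCriterion

universe v₁ v₂ u₁ u₂

variable {B : Type u₁} {E : Type u₂} [Category.{v₁} B] [Category.{v₂} E] (p : E ⥤ B)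

/-- A product cone in a fibre that is universal with respect to arrows over arbitrary arrows
of the base. -/
structure IsStrongProduct {b : B} {P A A' : p.Fiber b} (π : P ⟶ A) (π' : P ⟶ A') : Prop where
  exists_lift : ∀ {Y : B} {Z : E} (f : Y ⟶ b) (φ : Z ⟶ A.1) (φ' : Z ⟶ A'.1),
    p.IsHomLift f φ → p.IsHomLift f φ' →
      ∃ ψ : Z ⟶ P.1, p.IsHomLift f ψ ∧ ψ ≫ π.1 = φ ∧ ψ ≫ π'.1 = φ'
  ext : ∀ {Y : B} {Z : E} (f : Y ⟶ b) (ψ ψ' : Z ⟶ P.1), p.IsHomLift f ψ → p.IsHomLift f ψ' →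
    ψ ≫ π.1 = ψ' ≫ π.1 → ψ ≫ π'.1 = ψ' ≫ π'.1 → ψ = ψ'

/-- An object of a fibre that is terminal with respect to arrows over arbitrary arrows of the
base. -/
def IsStrongTerminal {b : B} (T : p.Fiber b) : Prop :=
  ∀ {Y : B} {Z : E} (f : Y ⟶ b), p.obj Z = Y → ∃! φ : Z ⟶ T.1, p.IsHomLift f φ

variable {p}

theorem isHomLift_comp_vert {X Y : B} {f : X ⟶ Y} {Z : E} {A A' : p.Fiber Y} {φ : Z ⟶ A.1}
    (h : p.IsHomLift f φ) (π : A ⟶ A') : p.IsHomLift f (φ ≫ π.1) := by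
  have := π.2
  exact IsHomLift.comp_lift_id_right p f φ π.1

theorem isHomLift_vert_comp {X Y : B} {f : X ⟶ Y} {Z : E} {A A' : p.Fiber X} (π : A ⟶ A')
    {φ : A'.1 ⟶ Z} (h : p.IsHomLift f φ) : p.IsHomLift f (π.1 ≫ φ) := by
  have := π.2
  exact IsHomLift.comp_lift_id_left p f φ π.1

theorem isHomLift_comp {X Y Z : B} {f : X ⟶ Y} {g : Y ⟶ Z} {a b c : E} {φ : a ⟶ b} {ψ : b ⟶ c}
    (h : p.IsHomLift f φ) (h' : p.IsHomLift g ψ) : p.IsHomLift (f ≫ g) (φ ≫ ψ) :=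
  inferInstance

theorem fiber_comp_val {X : B} {A A' A'' : p.Fiber X} (f : A ⟶ A') (g : A' ⟶ A'') :
    (f ≫ g).1 = f.1 ≫ g.1 := rfl

theorem fiber_id_val {X : B} (A : p.Fiber X) : Subtype.val (𝟙 A) = 𝟙 A.1 := rfl

namespace IsStrongProduct

variable {b : B} {P A A' : p.Fiber b} {π : P ⟶ A} {π' : P ⟶ A'}

/-- A strong product is a product in the fibre. -/
theorem nonempty_isLimit (h : IsStrongProduct p π π') :
    Nonempty (IsLimit (BinaryFan.mk π π')) := by
  have H : ∀ (T : p.Fiber b) (f : T ⟶ A) (g : T ⟶ A'), ∃ l : T ⟶ P, l ≫ π = f ∧ l ≫ π' = g := by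
    intro T f g
    obtain ⟨ψ, h₁, h₂, h₃⟩ := h.exists_lift (𝟙 b) f.1 g.1 f.2 g.2
    exact ⟨⟨ψ, h₁⟩, Subtype.ext h₂, Subtype.ext h₃⟩
  choose l h₁ h₂ using H
  exact ⟨BinaryFan.IsLimit.mk _ (fun {T} f g => l T f g) (fun f g => h₁ _ f g)
    (fun f g => h₂ _ f g) fun {T} f g m hm hm' => Subtype.ext <| h.ext (𝟙 b) m.1 _ m.2 (l T f g).2
      (congrArg Subtype.val (hm.trans (h₁ T f g).symm))
      (congrArg Subtype.val (hm'.trans (h₂ T f g).symm))⟩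

/-- If a strong product of two objects of a fibre exists, then every product cone is strong. -/
theorem of_isLimit (h : IsStrongProduct p π π') {Q : p.Fiber b} {ρ : Q ⟶ A} {ρ' : Q ⟶ A'}
    (hQ : IsLimit (BinaryFan.mk ρ ρ')) : IsStrongProduct p ρ ρ' := by
  obtain ⟨hP⟩ := h.nonempty_isLimit
  obtain ⟨i, hi, hi'⟩ : ∃ i : P ≅ Q, i.hom ≫ ρ = π ∧ i.hom ≫ ρ' = π' :=
    ⟨hP.conePointUniqueUpToIso hQ,
      hP.conePointUniqueUpToIso_hom_comp hQ ⟨WalkingPair.left⟩,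
      hP.conePointUniqueUpToIso_hom_comp hQ ⟨WalkingPair.right⟩⟩
  have e : i.inv ≫ π = ρ := by rw [← hi, Iso.inv_hom_id_assoc]
  have e' : i.inv ≫ π' = ρ' := by rw [← hi', Iso.inv_hom_id_assoc]
  refine ⟨fun f φ φ' hφ hφ' => ?_, fun f ψ ψ' hψ hψ' hh hh' => ?_⟩
  · obtain ⟨ψ, h₁, h₂, h₃⟩ := h.exists_lift f φ φ' hφ hφ'
    refine ⟨ψ ≫ i.hom.1, isHomLift_comp_vert h₁ _, ?_, ?_⟩
    · rw [Category.assoc, ← fiber_comp_val, hi, h₂]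
    · rw [Category.assoc, ← fiber_comp_val, hi', h₃]
  · have k : ψ ≫ i.inv.1 = ψ' ≫ i.inv.1 := by
      refine h.ext f _ _ (isHomLift_comp_vert hψ _) (isHomLift_comp_vert hψ' _) ?_ ?_
      · simpa only [Category.assoc, ← fiber_comp_val, e] using hh
      · simpa only [Category.assoc, ← fiber_comp_val, e'] using hh'
    have k' := congrArg (· ≫ i.hom.1) k
    simpa only [Category.assoc, ← fiber_comp_val, Iso.inv_hom_id, fiber_id_val,
      Category.comp_id] using k'

end IsStrongProduct

theorem IsStrongTerminal.nonempty_isTerminal {b : B} {T : p.Fiber b} (h : IsStrongTerminal p T) :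
    Nonempty (IsTerminal T) := by
  have H : ∀ A : p.Fiber b, ∃ φ : A ⟶ T, ∀ ψ : A ⟶ T, ψ = φ := by
    intro A
    obtain ⟨φ, h₁, h₂⟩ := h (𝟙 b) A.2
    exact ⟨⟨φ, h₁⟩, fun ψ => Subtype.ext (h₂ ψ.1 ψ.2)⟩
  choose l hl using H
  exact ⟨IsTerminal.ofUniqueHom l hl⟩

/-- Two cocartesian arrows over `d` out of the same object differ by a unique vertical isomorphism,
which here must be `F`. This is how both comparison arrows are inverted. -/
theorem isIso_of_isCocartesian_comp {X Y : B} (d : X ⟶ Y) {A : p.Fiber X} {S Q : p.Fiber Y}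
    {η : A.1 ⟶ S.1} (hη : p.IsCocartesian d η) (F : S ⟶ Q)
    (hκ : p.IsCocartesian d (η ≫ F.1)) : IsIso F := by
  have hF := F.2
  let G : Q ⟶ S := ⟨Functor.IsCocartesian.map p d (η ≫ F.1) η, inferInstance⟩
  have hG : (η ≫ F.1) ≫ G.1 = η := Functor.IsCocartesian.fac p d (η ≫ F.1) η
  refine ⟨G, Subtype.ext ?_, Subtype.ext ?_⟩
  · have := (F ≫ G).2
    have := (𝟙 S : S ⟶ S).2
    exact Functor.IsCocartesian.ext p d η _ _ (by
      rw [fiber_comp_val, ← Category.assoc, hG, fiber_id_val, Category.comp_id])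
  · have := (G ≫ F).2
    have := (𝟙 Q : Q ⟶ Q).2
    exact Functor.IsCocartesian.ext p d (η ≫ F.1) _ _ (by
      rw [fiber_comp_val, ← Category.assoc, hG, fiber_id_val, Category.comp_id])

section Reindexing

variable [p.IsFibered]

/-- The chosen cartesian arrow `f^* A ⟶ A`, with domain the value of the reindexing functor. -/
noncomputable def cartMap {X Y : B} (f : X ⟶ Y) (A : p.Fiber Y) :
    ((reindex p f).obj A).1 ⟶ A.1 :=
  cartLift p f A

instance isStronglyCartesian_cartMap {X Y : B} (f : X ⟶ Y) (A : p.Fiber Y) :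
    p.IsStronglyCartesian f (cartMap f A) :=
  inferInstanceAs (p.IsStronglyCartesian f (cartLift p f A))

theorem isHomLift_cartMap {X Y : B} (f : X ⟶ Y) (A : p.Fiber Y) :
    p.IsHomLift f (cartMap f A) := inferInstance

theorem exists_lift_comp_cartMap {X Y Y' : B} {Z : E} (f : X ⟶ Y) (g : Y' ⟶ X) (A : p.Fiber Y)
    {φ : Z ⟶ A.1} (hφ : p.IsHomLift (g ≫ f) φ) :
    ∃ ψ : Z ⟶ ((reindex p f).obj A).1, p.IsHomLift g ψ ∧ ψ ≫ cartMap f A = φ :=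
  ⟨Functor.IsStronglyCartesian.map p f (cartMap f A) rfl φ,
    Functor.IsStronglyCartesian.map_isHomLift p f (cartMap f A) rfl φ,
    Functor.IsStronglyCartesian.fac p f (cartMap f A) rfl φ⟩

theorem cartMap_ext {X Y Y' : B} {Z : E} (f : X ⟶ Y) (g : Y' ⟶ X) (A : p.Fiber Y)
    {ψ ψ' : Z ⟶ ((reindex p f).obj A).1} (h : p.IsHomLift g ψ) (h' : p.IsHomLift g ψ')
    (e : ψ ≫ cartMap f A = ψ' ≫ cartMap f A) : ψ = ψ' :=
  Functor.IsStronglyCartesian.ext p f (cartMap f A) g e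

theorem reindex_map_fac {X Y : B} (f : X ⟶ Y) {A A' : p.Fiber Y} (φ : A ⟶ A') :
    ((reindex p f).map φ).1 ≫ cartMap f A' = cartMap f A ≫ φ.1 :=
  vertLift_fac p f _ _

/-- Reindexing preserves strong products. -/
theorem IsStrongProduct.reindex {X Y : B} (f : X ⟶ Y) {P A A' : p.Fiber Y} {π : P ⟶ A}
    {π' : P ⟶ A'} (h : IsStrongProduct p π π') :
    IsStrongProduct p ((reindex p f).map π) ((reindex p f).map π') := by
  refine ⟨fun g φ φ' hφ hφ' => ?_, fun g ψ ψ' hψ hψ' hh hh' => ?_⟩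
  · obtain ⟨ψ₀, h₁, h₂, h₃⟩ := h.exists_lift (g ≫ f) (φ ≫ cartMap f A) (φ' ≫ cartMap f A')
      (isHomLift_comp hφ (isHomLift_cartMap f A)) (isHomLift_comp hφ' (isHomLift_cartMap f A'))
    obtain ⟨ψ, k₁, k₂⟩ := exists_lift_comp_cartMap f g P h₁
    refine ⟨ψ, k₁, cartMap_ext f g A (isHomLift_comp_vert k₁ _) hφ ?_,
      cartMap_ext f g A' (isHomLift_comp_vert k₁ _) hφ' ?_⟩
    · rw [Category.assoc, reindex_map_fac, ← Category.assoc, k₂, h₂]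
    · rw [Category.assoc, reindex_map_fac, ← Category.assoc, k₂, h₃]
  · refine cartMap_ext f g P hψ hψ' (h.ext (g ≫ f) _ _ (isHomLift_comp hψ (isHomLift_cartMap f P))
      (isHomLift_comp hψ' (isHomLift_cartMap f P)) ?_ ?_)
    · rw [Category.assoc, Category.assoc, ← reindex_map_fac, ← Category.assoc, ← Category.assoc, hh]
    · rw [Category.assoc, Category.assoc, ← reindex_map_fac, ← Category.assoc, ← Category.assoc,
        hh']

/-- Reindexing preserves strong terminal objects. -/
theorem IsStrongTerminal.reindex {X Y : B} (f : X ⟶ Y) {T : p.Fiber Y} (h : IsStrongTerminal p T) :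
    IsStrongTerminal p ((reindex p f).obj T) := by
  intro Y' Z g hZ
  obtain ⟨φ, h₁, h₂⟩ := h (g ≫ f) hZ
  obtain ⟨ψ, k₁, k₂⟩ := exists_lift_comp_cartMap f g T h₁
  refine ⟨ψ, k₁, fun ψ' k' => cartMap_ext f g T k' k₁ ?_⟩
  rw [k₂]
  exact h₂ _ (isHomLift_comp k' (isHomLift_cartMap f T))

variable (p) in
/-- A fibration whose fibres have strong finite products is a fibration with products. -/
theorem isFibrationWithProducts_of_strong [HasFiniteProducts B]
    (ht : ∀ b : B, ∃ T : p.Fiber b, IsStrongTerminal p T)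
    (hp : ∀ (b : B) (A A' : p.Fiber b), ∃ (P : p.Fiber b) (π : P ⟶ A) (π' : P ⟶ A'),
      IsStrongProduct p π π') : IsFibrationWithProducts p := by
  have hT : ∀ b, HasTerminal (p.Fiber b) := fun b => by
    obtain ⟨T, h⟩ := ht b
    exact h.nonempty_isTerminal.some.hasTerminal
  have hP : ∀ b, HasBinaryProducts (p.Fiber b) := fun b => by
    have : ∀ {A A' : p.Fiber b}, HasLimit (pair A A') := fun {A A'} => by
      obtain ⟨P, π, π', h⟩ := hp b A A'
      exact ⟨⟨⟨_, h.nonempty_isLimit.some⟩⟩⟩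
    exact hasBinaryProducts_of_hasLimit_pair _
  have hF : ∀ b, HasFiniteProducts (p.Fiber b) := fun b =>
    hasFiniteProducts_of_has_binary_and_terminal
  refine ⟨inferInstance, inferInstance, hF, fun {X Y} f => ?_⟩
  have : PreservesLimitsOfShape (Discrete PEmpty.{1}) (reindex p f) := by
    obtain ⟨T, h⟩ := ht Y
    have i : (reindex p f).obj (⊤_ p.Fiber Y) ≅ ⊤_ p.Fiber X :=
      (reindex p f).mapIso (terminalIsTerminal.uniqueUpToIso h.nonempty_isTerminal.some) ≪≫
        (IsStrongTerminal.nonempty_isTerminal (h.reindex f)).some.uniqueUpToIso terminalIsTerminal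
    have := preservesTerminal_of_iso (reindex p f) i
    exact preservesLimitsOfShape_pempty_of_preservesTerminal _
  have : PreservesLimitsOfShape (Discrete WalkingPair) (reindex p f) := by
    refine ⟨fun {K} => ?_⟩
    obtain ⟨P, π, π', h⟩ := hp Y (K.obj ⟨WalkingPair.left⟩) (K.obj ⟨WalkingPair.right⟩)
    have : PreservesLimit (pair (K.obj ⟨WalkingPair.left⟩) (K.obj ⟨WalkingPair.right⟩))
        (reindex p f) :=
      preservesLimit_of_preserves_limit_cone h.nonempty_isLimit.some
        ((isLimitMapConeBinaryFanEquiv (reindex p f) π π').symm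
          (h.reindex f).nonempty_isLimit.some)
    exact preservesLimit_of_iso_diagram _ (diagramIsoPair K).symm
  exact PreservesFiniteProducts.of_preserves_binary_and_terminal _

/-- Transposition along a cocartesian arrow `A ⟶ S` over `d`. -/
noncomputable def cocartesianTranspose {X Y : B} (d : X ⟶ Y) {A : p.Fiber X} {S : p.Fiber Y}
    (η : A.1 ⟶ S.1) [p.IsCocartesian d η] (C : p.Fiber Y) :
    (S ⟶ C) ≃ (A ⟶ (reindex p d).obj C) where
  toFun ψ := vertLift p d (η ≫ ψ.1) (isHomLift_comp_vert inferInstance ψ)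
  invFun χ :=
    have := isHomLift_vert_comp χ (isHomLift_cartMap d C)
    ⟨Functor.IsCocartesian.map p d η (χ.1 ≫ cartMap d C), inferInstance⟩
  left_inv ψ := by
    have h := isHomLift_comp_vert (inferInstance : p.IsHomLift d η) ψ
    have h' := ψ.2
    have h₂ := isHomLift_vert_comp (vertLift p d (η ≫ ψ.1) h) (isHomLift_cartMap d C)
    change p.IsHomLift d ((vertLift p d (η ≫ ψ.1) h).1 ≫ cartLift p d C) at h₂
    exact Subtype.ext (Functor.IsCocartesian.map_uniq p d η _ ψ.1 (vertLift_fac p d _ h).symm).symm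
  right_inv χ := by
    have := isHomLift_vert_comp χ (isHomLift_cartMap d C)
    apply vert_ext
    rw [vertLift_fac]
    exact Functor.IsCocartesian.fac p d η (χ.1 ≫ cartMap d C)

theorem cocartesianTranspose_fac {X Y : B} (d : X ⟶ Y) {A : p.Fiber X} {S : p.Fiber Y}
    (η : A.1 ⟶ S.1) [p.IsCocartesian d η] {C : p.Fiber Y} (ψ : S ⟶ C) :
    (cocartesianTranspose d η C ψ).1 ≫ cartMap d C = η ≫ ψ.1 :=
  vertLift_fac p d _ _

/-- The values of the left adjoint to reindexing given by a choice of cocartesian arrows. -/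
noncomputable def sigmaFunctor {X Y : B} (d : X ⟶ Y) (S : p.Fiber X → p.Fiber Y)
    (η : ∀ A, A.1 ⟶ (S A).1) (hη : ∀ A, p.IsCocartesian d (η A)) : p.Fiber X ⥤ p.Fiber Y :=
  Adjunction.leftAdjointOfEquiv (G := reindex p d) (F_obj := S)
    (fun A C => cocartesianTranspose d (η A) C) fun A C C' g h => by
      apply vert_ext
      refine (cocartesianTranspose_fac d (η A) (h ≫ g)).trans ?_
      change _ = (_ ≫ _) ≫ cartMap d C'
      rw [Category.assoc, reindex_map_fac, ← Category.assoc, cocartesianTranspose_fac,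
        Category.assoc]
      rfl

/-- The adjunction given by a choice of cocartesian arrows. -/
noncomputable def sigmaAdj {X Y : B} (d : X ⟶ Y) (S : p.Fiber X → p.Fiber Y)
    (η : ∀ A, A.1 ⟶ (S A).1) (hη : ∀ A, p.IsCocartesian d (η A)) :
    sigmaFunctor d S η hη ⊣ reindex p d :=
  Adjunction.adjunctionOfEquivLeft _ _

theorem sigmaAdj_homEquiv_fac {X Y : B} (d : X ⟶ Y) (S : p.Fiber X → p.Fiber Y)
    (η : ∀ A, A.1 ⟶ (S A).1) (hη : ∀ A, p.IsCocartesian d (η A)) (A : p.Fiber X) (C : p.Fiber Y)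
    (ψ : (sigmaFunctor d S η hη).obj A ⟶ C) :
    ((sigmaAdj d S η hη).homEquiv A C ψ).1 ≫ cartMap d C = η A ≫ ψ.1 := by
  have : (sigmaAdj d S η hη).homEquiv A C ψ = cocartesianTranspose d (η A) C ψ :=
    DFunLike.congr_fun (congrFun₂ (Adjunction.mkOfHomEquiv_homEquiv _) A C) ψ
  rw [this]
  exact cocartesianTranspose_fac d (η A) ψ

section Comparison

variable {X Y : B} {d : X ⟶ Y} {S : p.Fiber X ⥤ p.Fiber Y} (adj : S ⊣ reindex p d)
  {η : ∀ A, A.1 ⟶ (S.obj A).1}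

/-- The hypothesis `h`, used from here on, says that transposition is induced by precomposition with
`η`. At the identity it identifies `η` with the unit of the adjunction, seen in the total category.
-/
theorem unit_comp_cartMap
    (h : ∀ (A : p.Fiber X) (C : p.Fiber Y) (ψ : S.obj A ⟶ C),
      (adj.homEquiv A C ψ).1 ≫ cartMap d C = η A ≫ ψ.1)
    (A : p.Fiber X) : (adj.unit.app A).1 ≫ cartMap d (S.obj A) = η A := by
  have := h A (S.obj A) (𝟙 _)
  rwa [Adjunction.homEquiv_id, fiber_id_val, Category.comp_id] at this

theorem comp_map_of_homEquiv_fac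
    (h : ∀ (A : p.Fiber X) (C : p.Fiber Y) (ψ : S.obj A ⟶ C),
      (adj.homEquiv A C ψ).1 ≫ cartMap d C = η A ≫ ψ.1)
    {A A' : p.Fiber X} (φ : A ⟶ A') :
    η A ≫ (S.map φ).1 = φ.1 ≫ η A' := by
  rw [← h, ← unit_comp_cartMap adj h, Adjunction.homEquiv_unit, ← Category.assoc, ← fiber_comp_val]
  congr 2
  exact (adj.unit.naturality φ).symm

/-- Identifies the comparison after `η` as the arrow over `d` induced, through the cartesian arrow
over `g`, by the cartesian arrow over `f` followed by `η'`. No adjunction is left in this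
description. -/
theorem comp_beckChevalleyMap
    (h : ∀ (A : p.Fiber X) (C : p.Fiber Y) (ψ : S.obj A ⟶ C),
      (adj.homEquiv A C ψ).1 ≫ cartMap d C = η A ≫ ψ.1)
    {X' Y' : B} {d' : X' ⟶ Y'} {f : X ⟶ X'} {g : Y ⟶ Y'}
    (sq : f ≫ d' = d ≫ g) {S' : p.Fiber X' ⥤ p.Fiber Y'} (adj' : S' ⊣ reindex p d')
    {η' : ∀ A, A.1 ⟶ (S'.obj A).1}
    (h' : ∀ (A : p.Fiber X') (C : p.Fiber Y') (ψ : S'.obj A ⟶ C),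
      (adj'.homEquiv A C ψ).1 ≫ cartMap d' C = η' A ≫ ψ.1) (A : p.Fiber X') :
    (η _ ≫ (beckChevalleyMap p sq adj adj' A).1) ≫ cartMap g (S'.obj A) =
      cartMap f A ≫ η' A := by
  have e : (reindexComm p sq (S'.obj A)).1 ≫ cartMap d ((reindex p g).obj (S'.obj A)) =
      reindexCommAux p sq (S'.obj A) := vertLift_fac p d _ _
  have e₁ : reindexCommAux p sq (S'.obj A) ≫ cartMap g (S'.obj A) =
      cartMap f ((reindex p d').obj (S'.obj A)) ≫ cartMap d' (S'.obj A) := by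
    exact Functor.IsStronglyCartesian.fac p g (cartLift p g (S'.obj A)) sq
      (cartLift p f (reindexObj p d' (S'.obj A)) ≫ cartLift p d' (S'.obj A))
  have e₂ : (reindexComm p sq (S'.obj A)).1 ≫ cartMap d _ ≫ cartMap g (S'.obj A) =
      cartMap f _ ≫ cartMap d' (S'.obj A) :=
    (Category.assoc _ _ _).symm.trans ((congrArg (· ≫ cartMap g (S'.obj A)) e).trans e₁)
  have e₃ : ((reindex p f).map (adj'.unit.app A)).1 ≫ cartMap f ((reindex p d').obj (S'.obj A)) =
      cartMap f A ≫ (adj'.unit.app A).1 := reindex_map_fac f _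
  rw [← h, beckChevalleyMap, Equiv.apply_symm_apply, fiber_comp_val,
    Category.assoc, Category.assoc, e₂, ← Category.assoc, e₃, Category.assoc,
    unit_comp_cartMap adj' h']

end Comparison

/-- Identifies the comparison after `η` as the product of the cartesian arrow into `C` with `η A`.
Products of such non-vertical arrows are the reason for working with strong products. -/
theorem comp_frobeniusMap [IsFibrationWithProducts p] {X Y : B} {d : X ⟶ Y}
    {S : p.Fiber X ⥤ p.Fiber Y} (adj : S ⊣ reindex p d) {η : ∀ A, A.1 ⟶ (S.obj A).1}
    (h : ∀ (A : p.Fiber X) (C : p.Fiber Y) (ψ : S.obj A ⟶ C),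
      (adj.homEquiv A C ψ).1 ≫ cartMap d C = η A ≫ ψ.1) (A : p.Fiber X) (C : p.Fiber Y) :
    (η _ ≫ (frobeniusMap p adj A C).1) ≫ (prod.fst : C ⨯ S.obj A ⟶ C).1 =
        (prod.fst : (reindex p d).obj C ⨯ A ⟶ _).1 ≫ cartMap d C ∧
      (η _ ≫ (frobeniusMap p adj A C).1) ≫ (prod.snd : C ⨯ S.obj A ⟶ S.obj A).1 =
        (prod.snd : (reindex p d).obj C ⨯ A ⟶ _).1 ≫ η A := by
  constructor
  · rw [Category.assoc, ← fiber_comp_val, frobeniusMap, prod.lift_fst, ← h]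
    congr 2
    rw [← Adjunction.homEquiv_counit, Equiv.apply_symm_apply]
  · rw [Category.assoc, ← fiber_comp_val, frobeniusMap, prod.lift_snd,
      comp_map_of_homEquiv_fac adj h]

end Reindexing

/-- A fibration with strong finite products is elementary as soon as there is a class `D` of
cocartesian arrows over the parametrised diagonals that contains an arrow out of every object and
is stable under products with cartesian arrows and under reindexing along parametrised squares. -/
theorem isElementary_of_cocartesian [HasFiniteProducts B] (hp : IsFibrationWithProducts p)
    (hprod : ∀ (b : B) (A A' : p.Fiber b), ∃ (P : p.Fiber b) (π : P ⟶ A) (π' : P ⟶ A'),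
      IsStrongProduct p π π')
    (D : ∀ {Y X : B} {A : p.Fiber (Y ⨯ X)} {S : p.Fiber ((Y ⨯ X) ⨯ X)}, (A.1 ⟶ S.1) → Prop)
    (cocart : ∀ {Y X : B} {A : p.Fiber (Y ⨯ X)} {S : p.Fiber ((Y ⨯ X) ⨯ X)} (η : A.1 ⟶ S.1),
      D η → p.IsCocartesian (paramDiag Y X) η)
    (ex : ∀ (Y X : B) (A : p.Fiber (Y ⨯ X)), ∃ (S : p.Fiber ((Y ⨯ X) ⨯ X)) (η : A.1 ⟶ S.1), D η)
    (frob : ∀ {Y X : B} {A C' P : p.Fiber (Y ⨯ X)} {S C Q : p.Fiber ((Y ⨯ X) ⨯ X)}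
      {η : A.1 ⟶ S.1} (_ : D η) {γ : C'.1 ⟶ C.1} (_ : p.IsStronglyCartesian (paramDiag Y X) γ)
      {π : P ⟶ C'} {π' : P ⟶ A} (_ : IsStrongProduct p π π')
      {ρ : Q ⟶ C} {ρ' : Q ⟶ S} (_ : IsStrongProduct p ρ ρ')
      {κ : P.1 ⟶ Q.1} (_ : p.IsHomLift (paramDiag Y X) κ)
      (_ : κ ≫ ρ.1 = π.1 ≫ γ) (_ : κ ≫ ρ'.1 = π'.1 ≫ η), D κ)
    (bc : ∀ {Y Z : B} (f : Y ⟶ Z) (X : B) {A : p.Fiber (Z ⨯ X)} {S : p.Fiber ((Z ⨯ X) ⨯ X)}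
      {A' : p.Fiber (Y ⨯ X)} {S' : p.Fiber ((Y ⨯ X) ⨯ X)} {η : A.1 ⟶ S.1} (_ : D η)
      {α : A'.1 ⟶ A.1} (_ : p.IsStronglyCartesian (prod.map f (𝟙 X)) α)
      {σ : S'.1 ⟶ S.1} (_ : p.IsStronglyCartesian (prod.map (prod.map f (𝟙 X)) (𝟙 X)) σ)
      {η' : A'.1 ⟶ S'.1} (_ : p.IsHomLift (paramDiag Y X) η') (_ : η' ≫ σ = α ≫ η), D η') :
    IsElementary p := by
  choose S η hD using ex
  have hS := fun Y X A => cocart _ (hD Y X A)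
  have H := fun Y X => sigmaAdj_homEquiv_fac (paramDiag Y X) (S Y X) (η Y X) (hS Y X)
  refine ⟨hp, fun Y X => sigmaFunctor (paramDiag Y X) (S Y X) (η Y X) (hS Y X),
    fun Y X => sigmaAdj (paramDiag Y X) (S Y X) (η Y X) (hS Y X),
    fun Y X A C => ?_, fun {Y Z} f X A => ?_⟩
  -- The chosen products of the fibres are strong because some strong product of the same objects
  -- exists.
  · obtain ⟨P, π, π', hP⟩ := hprod _ ((reindex p (paramDiag Y X)).obj C) A
    obtain ⟨Q, ρ, ρ', hQ⟩ := hprod _ C (S Y X A)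
    obtain ⟨h₁, h₂⟩ := comp_frobeniusMap _ (H Y X) A C
    refine isIso_of_isCocartesian_comp _ (hS Y X _) _ (cocart _ (frob (hD Y X A)
      (isStronglyCartesian_cartMap _ C) (hP.of_isLimit (prodIsProd _ _))
      (hQ.of_isLimit (prodIsProd _ _))
      (isHomLift_comp_vert (hS Y X _).toIsHomLift _) h₁ h₂))
  · exact isIso_of_isCocartesian_comp _ (hS Y X _) _ (cocart _ (bc f X (hD Z X A)
      (isStronglyCartesian_cartMap _ A) (isStronglyCartesian_cartMap _ _)
      (isHomLift_comp_vert (hS Y X _).toIsHomLift _)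
      (comp_beckChevalleyMap _ (H Y X) _ _ (H Z X) A)))

end FibrationCriterion

/-! ### Algebras of an algebraic weak factorisation system: fibration and fibrewise products -/

namespace AWFS

universe v

variable {C : Type u} [Category.{v} C] (W : AWFS C)

section Unbundled

variable {X X' X'' J J' J'' : C}

/-- The middle object of the factorisation of an arrow. -/
def mid (q : X ⟶ J) : C := W.M.obj (Arrow.mk q)

/-- The left factor of an arrow. -/
def leftMap (q : X ⟶ J) : X ⟶ W.mid q := W.lam.app (Arrow.mk q)

/-- The right factor of an arrow. -/
def rightMap (q : X ⟶ J) : W.mid q ⟶ J := W.rho.app (Arrow.mk q)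

/-- The multiplication of the monad. -/
def mulMap (q : X ⟶ J) : W.mid (W.rightMap q) ⟶ W.mid q := W.mul (Arrow.mk q)

/-- The action of the factorisation on commutative squares. -/
def midMap {q : X ⟶ J} {q' : X' ⟶ J'} (l : X ⟶ X') (f : J ⟶ J') (w : l ≫ q' = q ≫ f) :
    W.mid q ⟶ W.mid q' :=
  W.M.map (X := Arrow.mk q) (Y := Arrow.mk q') (Arrow.homMk l f w)

theorem leftMap_rightMap (q : X ⟶ J) : W.leftMap q ≫ W.rightMap q = q := W.fac _

theorem mulMap_rightMap (q : X ⟶ J) :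
    W.mulMap q ≫ W.rightMap q = W.rightMap (W.rightMap q) := W.mul_rho _

variable {q : X ⟶ J} {q' : X' ⟶ J'} {q'' : X'' ⟶ J''} {l : X ⟶ X'} {f : J ⟶ J'}
  (w : l ≫ q' = q ≫ f)

theorem midMap_rightMap : W.midMap l f w ≫ W.rightMap q' = W.rightMap q ≫ f :=
  W.rho.naturality (X := Arrow.mk q) (Y := Arrow.mk q') (Arrow.homMk l f w)

theorem leftMap_midMap : W.leftMap q ≫ W.midMap l f w = l ≫ W.leftMap q' :=
  (W.lam.naturality (X := Arrow.mk q) (Y := Arrow.mk q') (Arrow.homMk l f w)).symm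

theorem midMap_midMap {l' : X' ⟶ X''} {f' : J' ⟶ J''} (w' : l' ≫ q'' = q' ≫ f')
    (w'' : (l ≫ l') ≫ q'' = q ≫ f ≫ f') :
    W.midMap l f w ≫ W.midMap l' f' w' = W.midMap (l ≫ l') (f ≫ f') w'' :=
  (W.M.map_comp (X := Arrow.mk q) (Y := Arrow.mk q') (Z := Arrow.mk q'') (Arrow.homMk l f w)
    (Arrow.homMk l' f' w')).symm

theorem mulMap_midMap : W.mulMap q ≫ W.midMap l f w =
    W.midMap (W.midMap l f w) f (W.midMap_rightMap w) ≫ W.mulMap q' :=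
  (W.mul_natural (f := Arrow.mk q) (g := Arrow.mk q') (Arrow.homMk l f w)).symm

end Unbundled

/-- An algebra for the monad of an algebraic weak factorisation system on an arrow with
codomain `J`. -/
structure AlgOn (J : C) where
  tot : C
  proj : tot ⟶ J
  str : W.mid proj ⟶ tot
  str_proj : str ≫ proj = W.rightMap proj
  lam_str : W.leftMap proj ≫ str = 𝟙 tot
  mul_str : W.mulMap proj ≫ str =
    W.midMap str (𝟙 J) (str_proj.trans (Category.comp_id _).symm) ≫ str

namespace AlgOn

variable {W} {I J K : C}

/-- A commutative square over `f` compatible with the algebra structures. -/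
structure IsHom (a : AlgOn W I) (c : AlgOn W J) (f : I ⟶ J) (l : a.tot ⟶ c.tot) : Prop where
  w : l ≫ c.proj = a.proj ≫ f
  map_str : W.midMap l f w ≫ c.str = a.str ≫ l

/-- The algebra for the monad attached to an algebra on an arrow. -/
def toAlgebra (a : AlgOn W J) : W.RAlg where
  A := Arrow.mk a.proj
  a := Arrow.homMk a.str (𝟙 J) (a.str_proj.trans (Category.comp_id _).symm)
  unit := by
    ext
    · exact a.lam_str
    · exact Category.comp_id _
  assoc := by
    ext
    · exact a.mul_str
    · rfl

/-- An algebra as an object of the fibre. -/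
def toFiber (a : AlgOn W J) : W.algFunctor.Fiber J := ⟨a.toAlgebra, rfl⟩

/-- The monad is the identity on codomains, so the unit law forces the codomain component of a
structure map to be an identity. Hence nothing is lost by passing to `AlgOn`. -/
theorem exists_eq_toFiber (A : W.algFunctor.Fiber J) : ∃ a : AlgOn W J, A = a.toFiber := by
  obtain ⟨⟨⟨X, Y, F⟩, s, hu, ha⟩, h⟩ := A
  have h' : Y = J := h
  subst h'
  have hr : s.right = 𝟙 _ :=
    (Category.id_comp _).symm.trans (congrArg CommaMorphism.right hu)
  have hs : s.left ≫ F = W.rho.app (Arrow.mk F) := by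
    have := s.w
    rw [hr] at this
    exact this.trans (Category.comp_id _)
  have e : s = Arrow.homMk s.left (𝟙 _) (hs.trans (Category.comp_id _).symm) := by
    ext
    · rfl
    · exact hr
  refine ⟨⟨X, F, s.left, hs, congrArg CommaMorphism.left hu, ?_⟩, ?_⟩
  · have := congrArg CommaMorphism.left ha
    refine this.trans ?_
    exact congrArg (fun t => W.M.map t ≫ s.left) e
  · refine Subtype.ext ?_
    change (Monad.Algebra.mk _ s hu ha : W.RAlg) = Monad.Algebra.mk _ _ _ _
    congr 1

/-- An algebra map, as an arrow in the category of algebras. -/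
def IsHom.toHom {a : AlgOn W I} {c : AlgOn W J} {f : I ⟶ J} {l : a.tot ⟶ c.tot}
    (h : IsHom a c f l) : a.toFiber.1 ⟶ c.toFiber.1 where
  f := Arrow.homMk l f h.w
  h := by
    ext
    · exact h.map_str
    · exact (Category.comp_id _).trans (Category.id_comp _).symm

theorem IsHom.isHomLift {a : AlgOn W I} {c : AlgOn W J} {f : I ⟶ J} {l : a.tot ⟶ c.tot}
    (h : IsHom a c f l) : W.algFunctor.IsHomLift f h.toHom :=
  IsHomLift.map W.algFunctor h.toHom

theorem right_eq_of_isHomLift {a : AlgOn W I} {c : AlgOn W J} {f : I ⟶ J}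
    {φ : a.toFiber.1 ⟶ c.toFiber.1} (h : W.algFunctor.IsHomLift f φ) : φ.f.right = f := by
  have : f = W.algFunctor.map φ :=
    @IsHomLift.eq_of_isHomLift _ _ _ _ W.algFunctor a.toFiber.1 c.toFiber.1 f φ h
  exact this.symm

theorem isHom_of_isHomLift {a : AlgOn W I} {c : AlgOn W J} {f : I ⟶ J}
    {φ : a.toFiber.1 ⟶ c.toFiber.1} (h : W.algFunctor.IsHomLift f φ) :
    IsHom a c f φ.f.left := by
  obtain rfl := right_eq_of_isHomLift h
  exact ⟨φ.f.w, congrArg CommaMorphism.left φ.h⟩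

/-- Algebra maps over the same arrow agree if their upper components agree. -/
theorem hom_ext_of_isHomLift {A : W.algFunctor.Fiber I} {D : W.algFunctor.Fiber J} {f : I ⟶ J}
    {φ ψ : A.1 ⟶ D.1} (hφ : W.algFunctor.IsHomLift f φ) (hψ : W.algFunctor.IsHomLift f ψ)
    (h : φ.f.left = ψ.f.left) : φ = ψ := by
  obtain ⟨a, rfl⟩ := exists_eq_toFiber A
  obtain ⟨c, rfl⟩ := exists_eq_toFiber D
  refine Monad.Algebra.Hom.ext ?_
  ext
  · exact h
  · exact (right_eq_of_isHomLift hφ).trans (right_eq_of_isHomLift hψ).symm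

/-- Transport of an algebra structure along a jointly monic family of squares into algebras. -/
def ofLegs {ι : Type*} {J : ι → C} (c : ∀ i, AlgOn W (J i)) {P : C} (q : P ⟶ I)
    (f : ∀ i, I ⟶ J i) (l : ∀ i, P ⟶ (c i).tot) (w : ∀ i, l i ≫ (c i).proj = q ≫ f i)
    (mono : ∀ {Z : C} (x y : Z ⟶ P), x ≫ q = y ≫ q → (∀ i, x ≫ l i = y ≫ l i) → x = y)
    (s : W.mid q ⟶ P) (hq : s ≫ q = W.rightMap q)
    (hs : ∀ i, s ≫ l i = W.midMap (l i) (f i) (w i) ≫ (c i).str) : AlgOn W I where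
  tot := P
  proj := q
  str := s
  str_proj := hq
  lam_str := by
    refine mono _ _ ?_ fun i => ?_
    · rw [Category.assoc, hq, leftMap_rightMap, Category.id_comp]
    · rw [Category.assoc, hs, ← Category.assoc, leftMap_midMap, Category.assoc, (c i).lam_str,
        Category.comp_id, Category.id_comp]
  mul_str := by
    refine mono _ _ ?_ fun i => ?_
    · rw [Category.assoc, Category.assoc]
      refine (congrArg (_ ≫ ·) hq).trans (.trans ?_ (congrArg (_ ≫ ·) hq.symm))
      rw [mulMap_rightMap, midMap_rightMap, Category.comp_id]
    -- After a leg, naturality of the multiplication and associativity of `c i` turn both sides into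
    -- the structure of `c i` applied after two composites of `midMap`, which agree by `hs i`.
    · rw [Category.assoc, Category.assoc]
      refine (congrArg (_ ≫ ·) (hs i)).trans (.trans ?_ (congrArg (_ ≫ ·) (hs i).symm))
      rw [← Category.assoc, mulMap_midMap, Category.assoc,
        (c i).mul_str, ← Category.assoc, ← Category.assoc,
        midMap_midMap (w'' := by rw [Category.assoc, (c i).str_proj, midMap_rightMap,
          Category.comp_id]),
        midMap_midMap (w'' := by rw [Category.assoc, w, ← Category.assoc, hq, Category.id_comp])]
      congr 2
      · exact (hs i).symm
      · rw [Category.comp_id, Category.id_comp]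

theorem isHom_ofLegs {ι : Type*} {J : ι → C} {c : ∀ i, AlgOn W (J i)} {P : C} {q : P ⟶ I}
    {f : ∀ i, I ⟶ J i} {l : ∀ i, P ⟶ (c i).tot} {w : ∀ i, l i ≫ (c i).proj = q ≫ f i}
    {mono : ∀ {Z : C} (x y : Z ⟶ P), x ≫ q = y ≫ q → (∀ i, x ≫ l i = y ≫ l i) → x = y}
    {s : W.mid q ⟶ P} {hq : s ≫ q = W.rightMap q}
    {hs : ∀ i, s ≫ l i = W.midMap (l i) (f i) (w i) ≫ (c i).str} (i : ι) :
    IsHom (ofLegs c q f l w mono s hq hs) (c i) (f i) (l i) :=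
  ⟨w i, (hs i).symm⟩

/-- Compatibility with the structures is an equation between arrows into `P`, so it can be tested on
the legs. With `isHom_ofLegs` this gives all the universal properties below. -/
theorem isHom_to_ofLegs {ι : Type*} {J : ι → C} {c : ∀ i, AlgOn W (J i)} {P : C} {q : P ⟶ I}
    {f : ∀ i, I ⟶ J i} {l : ∀ i, P ⟶ (c i).tot} {w : ∀ i, l i ≫ (c i).proj = q ≫ f i}
    {mono : ∀ {Z : C} (x y : Z ⟶ P), x ≫ q = y ≫ q → (∀ i, x ≫ l i = y ≫ l i) → x = y}
    {s : W.mid q ⟶ P} {hq : s ≫ q = W.rightMap q}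
    {hs : ∀ i, s ≫ l i = W.midMap (l i) (f i) (w i) ≫ (c i).str} {z : AlgOn W K} {k : K ⟶ I}
    {m : z.tot ⟶ P}
    (hk : m ≫ q = z.proj ≫ k) (h : ∀ i, IsHom z (c i) (k ≫ f i) (m ≫ l i)) :
    IsHom z (ofLegs c q f l w mono s hq hs) k m := by
  refine ⟨hk, mono _ _ ?_ fun i => ?_⟩
  · refine (Category.assoc _ _ _).trans ((congrArg (_ ≫ ·) hq).trans
      (.trans ?_ (Category.assoc _ _ _).symm))
    refine (W.midMap_rightMap hk).trans ?_
    rw [hk, ← Category.assoc, z.str_proj]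
  · refine (Category.assoc _ _ _).trans ((congrArg (_ ≫ ·) (hs i)).trans
      (.trans ?_ (Category.assoc _ _ _).symm))
    rw [← (h i).map_str]
    exact (Category.assoc _ _ _).symm.trans
      (congrArg (· ≫ (c i).str) (W.midMap_midMap hk (w i) (h i).w))

theorem ext_of_comp_id {Z J : C} (x y : Z ⟶ J) (h : x ≫ 𝟙 J = y ≫ 𝟙 J) : x = y := by
  rwa [Category.comp_id, Category.comp_id] at h

/-- The algebra on an identity arrow. -/
def ofId (J : C) : AlgOn W J :=
  ofLegs (ι := Empty) (J := fun i => i.elim) (fun i => i.elim) (𝟙 J) (fun i => i.elim)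
    (fun i => i.elim) (fun i => i.elim)
    (fun x y h _ => ext_of_comp_id x y h) (W.rightMap (𝟙 J))
    (Category.comp_id _) fun i => i.elim

end AlgOn

open AlgOn

/-- The identity of `J` is an algebra with an empty family of legs, and a square into it is
determined by its lower side. -/
theorem exists_isStrongTerminal (J : C) :
    ∃ T : W.algFunctor.Fiber J, IsStrongTerminal W.algFunctor T := by
  refine ⟨(ofId J).toFiber, fun {Y Z} f hZ => ?_⟩
  obtain ⟨z, hz⟩ := exists_eq_toFiber (⟨Z, hZ⟩ : W.algFunctor.Fiber Y)
  obtain rfl : Z = z.toFiber.1 := congrArg Subtype.val hz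
  have h : IsHom z (ofId (W := W) J) f (z.proj ≫ f) :=
    isHom_to_ofLegs (mono := fun x y h _ => ext_of_comp_id x y h) (Category.comp_id _) fun i => i.elim
  refine ⟨h.toHom, h.isHomLift, fun ψ hψ => hom_ext_of_isHomLift hψ h.isHomLift ?_⟩
  exact (Category.comp_id _).symm.trans (isHom_of_isHomLift hψ).w

variable [HasPullbacks C]

/-- The fibre product over `J`, with its two projections as legs. Its universal property concerns
arbitrary squares, so the base of the test object plays no role. -/
theorem exists_isStrongProduct (J : C) (A A' : W.algFunctor.Fiber J) :
    ∃ (P : W.algFunctor.Fiber J) (π : P ⟶ A) (π' : P ⟶ A'),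
      IsStrongProduct W.algFunctor π π' := by
  obtain ⟨a, rfl⟩ := exists_eq_toFiber A
  obtain ⟨a', rfl⟩ := exists_eq_toFiber A'
  let c : Bool → AlgOn W J := fun i => bif i then a else a'
  let q : pullback a.proj a'.proj ⟶ J := pullback.fst _ _ ≫ a.proj
  let l : ∀ i, pullback a.proj a'.proj ⟶ (c i).tot := fun i =>
    match i with
    | true => pullback.fst _ _
    | false => pullback.snd _ _
  have w : ∀ i, l i ≫ (c i).proj = q ≫ 𝟙 J := fun i =>
    match i with
    | true => (Category.comp_id _).symm
    | false => pullback.condition.symm.trans (Category.comp_id _).symm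
  let m : ∀ i, W.mid q ⟶ (c i).tot := fun i =>
    W.midMap (l i) (𝟙 J) (w i) ≫ (c i).str
  have hm : ∀ i, m i ≫ (c i).proj = W.rightMap q := fun i => by
    rw [Category.assoc, (c i).str_proj, midMap_rightMap, Category.comp_id]
  let s := pullback.lift (m true) (m false) ((hm true).trans (hm false).symm)
  have hs : ∀ i, s ≫ l i = m i := fun i =>
    match i with
    | true => pullback.lift_fst _ _ _
    | false => pullback.lift_snd _ _ _
  let P := ofLegs c q (fun _ => 𝟙 J) l w
    (fun x y _ h => pullback.hom_ext (h true) (h false)) s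
    ((Category.assoc _ _ _).symm.trans ((congrArg (· ≫ a.proj) (hs true)).trans (hm true))) hs
  have hl : ∀ i, IsHom P (c i) (𝟙 J) (l i) := fun i => isHom_ofLegs i
  refine ⟨P.toFiber, ⟨(hl true).toHom, (hl true).isHomLift⟩, ⟨(hl false).toHom,
    (hl false).isHomLift⟩, fun {Y Z} f φ φ' hφ hφ' => ?_, fun {Y Z} f ψ ψ' hψ hψ' h h' => ?_⟩
  · obtain ⟨z, hz⟩ := exists_eq_toFiber (⟨Z, IsHomLift.domain_eq _ f φ⟩ : W.algFunctor.Fiber Y)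
    obtain rfl : Z = z.toFiber.1 := congrArg Subtype.val hz
    have k := isHom_of_isHomLift hφ
    have k' := isHom_of_isHomLift hφ'
    let t : z.tot ⟶ pullback a.proj a'.proj := pullback.lift φ.f.left φ'.f.left (k.w.trans k'.w.symm)
    have ht : t ≫ l true = φ.f.left := pullback.lift_fst _ _ _
    have ht' : t ≫ l false = φ'.f.left := pullback.lift_snd _ _ _
    have hψ : IsHom z P f t := isHom_to_ofLegs
      ((Category.assoc _ _ _).symm.trans ((congrArg (· ≫ a.proj) ht).trans k.w)) fun i =>
        match i with
        | true => by rw [ht, Category.comp_id]; exact k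
        | false => by rw [ht', Category.comp_id]; exact k'
    refine ⟨hψ.toHom, hψ.isHomLift, ?_, ?_⟩
    · exact hom_ext_of_isHomLift (A := z.toFiber) (isHomLift_comp_vert hψ.isHomLift
        (⟨(hl true).toHom, (hl true).isHomLift⟩ : P.toFiber ⟶ a.toFiber)) hφ ht
    · exact hom_ext_of_isHomLift (A := z.toFiber) (isHomLift_comp_vert hψ.isHomLift
        (⟨(hl false).toHom, (hl false).isHomLift⟩ : P.toFiber ⟶ a'.toFiber)) hφ' ht'
  · obtain ⟨z, hz⟩ := exists_eq_toFiber (⟨Z, IsHomLift.domain_eq _ f ψ⟩ : W.algFunctor.Fiber Y)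
    obtain rfl : Z = z.toFiber.1 := congrArg Subtype.val hz
    refine hom_ext_of_isHomLift hψ hψ' (pullback.hom_ext ?_ ?_)
    · exact congrArg (fun t => t.f.left) h
    · exact congrArg (fun t => t.f.left) h'

/-- Algebra structures pull back: the projection of the pullback to the total object of `c` is a
single leg, jointly monic with the projection to `I`. -/
theorem exists_isStronglyCartesian {I J : C} (f : I ⟶ J) (A : W.algFunctor.Fiber J) :
    ∃ (A' : W.RAlg) (γ : A' ⟶ A.1), W.algFunctor.IsStronglyCartesian f γ := by
  obtain ⟨c, rfl⟩ := exists_eq_toFiber A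
  let q : pullback c.proj f ⟶ I := pullback.snd _ _
  have w : pullback.fst c.proj f ≫ c.proj = q ≫ f := pullback.condition
  let m := W.midMap _ f w ≫ c.str
  have hm : m ≫ c.proj = W.rightMap q ≫ f := by
    rw [Category.assoc, c.str_proj, midMap_rightMap]
  let P : AlgOn W I := ofLegs (ι := Unit) (fun _ => c) q (fun _ => f) (fun _ => pullback.fst _ _)
    (fun _ => w) (fun x y h h' => pullback.hom_ext (h' ()) h) (pullback.lift m _ hm)
    (pullback.lift_snd _ _ _) (fun _ => pullback.lift_fst _ _ _)
  have hl : IsHom P c f (pullback.fst _ _) := isHom_ofLegs (ι := Unit) ()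
  refine ⟨P.toFiber.1, hl.toHom, { toIsHomLift := hl.isHomLift, universal_property' := ?_ }⟩
  intro Z g φ hφ
  have k : ∀ {Y : C} (z : AlgOn W Y) (g : Y ⟶ I) (φ : z.toFiber.1 ⟶ c.toFiber.1)
      (_ : W.algFunctor.IsHomLift (g ≫ f) φ), ∃! χ : z.toFiber.1 ⟶ P.toFiber.1,
      W.algFunctor.IsHomLift g χ ∧ χ ≫ hl.toHom = φ := by
    intro Y z g φ hφ
    have h := isHom_of_isHomLift hφ
    have hw : φ.f.left ≫ c.proj = (z.proj ≫ g) ≫ f := h.w.trans (Category.assoc _ _ _).symm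
    let t : z.tot ⟶ pullback c.proj f := pullback.lift φ.f.left (z.proj ≫ g) hw
    have ht : t ≫ pullback.fst _ _ = φ.f.left := pullback.lift_fst _ _ _
    have hψ : IsHom z P g t := isHom_to_ofLegs (pullback.lift_snd _ _ _) fun _ => by
      rw [ht]
      exact h
    refine ⟨hψ.toHom, ⟨hψ.isHomLift, hom_ext_of_isHomLift (A := z.toFiber) (D := c.toFiber)
      (isHomLift_comp hψ.isHomLift hl.isHomLift) hφ ht⟩, fun χ hχ =>
      hom_ext_of_isHomLift hχ.1 hψ.isHomLift (pullback.hom_ext ?_ ?_)⟩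
    · exact (congrArg (fun t => t.f.left) hχ.2).trans ht.symm
    · exact (isHom_of_isHomLift hχ.1).w.trans hψ.w.symm
  -- The base of the test object is made a variable, so that the object can be replaced by some
  -- `z.toFiber`.
  have H : ∀ (Y : C) (A : W.algFunctor.Fiber Y) (g : Y ⟶ I) (φ : A.1 ⟶ c.toFiber.1)
      (_ : W.algFunctor.IsHomLift (g ≫ f) φ), ∃! χ : A.1 ⟶ P.toFiber.1,
      W.algFunctor.IsHomLift g χ ∧ χ ≫ hl.toHom = φ := by
    intro Y A
    obtain ⟨z, rfl⟩ := exists_eq_toFiber A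
    exact k z
  exact H _ ⟨Z, rfl⟩ g φ hφ

/-- The codomain functor on algebras is a fibration. -/
theorem isFibered_algFunctor : W.algFunctor.IsFibered :=
  Functor.IsFibered.of_exists_isStronglyCartesian fun a _ f =>
    W.exists_isStronglyCartesian f ⟨a, rfl⟩

end AWFS

/-! ### Arrow groupoids: natural transformations as generalised elements -/

section Paths

/-- The groupoid of arrows of a groupoid. -/
def Path (J : Grpd.{u, u}) : Grpd.{u, u} := Grpd.of (PathObj (𝟭 J))

namespace Path

variable {J K L T : Grpd.{u, u}}

/-- The domain of an arrow. -/
def src (J : Grpd.{u, u}) : Path J ⟶ J := PathObj.baseFunctor (𝟭 J)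

/-- The codomain of an arrow. -/
def tgt (J : Grpd.{u, u}) : Path J ⟶ J := PathObj.ptFunctor (𝟭 J)

/-- The identity arrows. -/
def refl (J : Grpd.{u, u}) : J ⟶ Path J := PathObj.lam (𝟭 J)

/-- Functors into `Path J` are natural transformations. -/
def mk (b p : T ⥤ J) (α : ∀ t, b.obj t ⟶ p.obj t)
    (hα : ∀ {t t' : T} (f : t ⟶ t'), b.map f ≫ α t' = α t ≫ p.map f) : T ⟶ Path J :=
  PathObj.lift (F := 𝟭 J) b p α hα

/-- The component of a functor into `Path J`. -/
def app (w : T ⟶ Path J) (t : T) : (w ≫ src J).obj t ⟶ (w ≫ tgt J).obj t :=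
  PathObj.iso (F := 𝟭 J) (w.obj t)

theorem app_naturality (w : T ⟶ Path J) {t t' : T} (f : t ⟶ t') :
    (w ≫ src J).map f ≫ app w t' = app w t ≫ (w ≫ tgt J).map f :=
  PathObj.Hom.w (F := 𝟭 J) (w.map f)

/-- A generalised element of `Path J` is a natural transformation between two functors into `J`.
Transports along equalities of functors are confined to proofs by this lemma; afterwards only
equations between composites in `Grpd` are needed. -/
theorem ext {w w' : T ⟶ Path J} (hs : w ≫ src J = w' ≫ src J) (ht : w ≫ tgt J = w' ≫ tgt J)
    (h : ∀ t, app w t ≫ eqToHom (Functor.congr_obj ht t) =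
      eqToHom (Functor.congr_obj hs t) ≫ app w' t) : w = w' :=
  PathObj.functor_ext (X := T) (F := 𝟭 J) hs ht h

/-- The action of a functor on arrows. -/
def map (f : J ⟶ K) : Path J ⟶ Path K :=
  mk (src J ≫ f) (tgt J ≫ f) (fun P => f.map (PathObj.iso P)) fun {P Q} g => by
    have := congrArg f.map (PathObj.Hom.w g)
    rw [f.map_comp, f.map_comp] at this
    exact this

theorem map_src (f : J ⟶ K) : map f ≫ src K = src J ≫ f := rfl
theorem map_tgt (f : J ⟶ K) : map f ≫ tgt K = tgt J ≫ f := rfl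
theorem refl_src (J : Grpd.{u, u}) : refl J ≫ src J = 𝟙 J := rfl
theorem refl_tgt (J : Grpd.{u, u}) : refl J ≫ tgt J = 𝟙 J := rfl
theorem map_comp (f : J ⟶ K) (g : K ⟶ L) : map (f ≫ g) = map f ≫ map g := rfl
theorem map_id (J : Grpd.{u, u}) : map (𝟙 J) = 𝟙 (Path J) := rfl

theorem refl_map (f : J ⟶ K) : refl J ≫ map f = f ≫ refl K := by
  refine ext rfl rfl fun t => ?_
  change f.map (𝟙 t) ≫ 𝟙 _ = 𝟙 _ ≫ 𝟙 (f.obj t)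
  simp

/-- The inverse of an arrow. -/
def inv (J : Grpd.{u, u}) : Path J ⟶ Path J :=
  mk (tgt J) (src J) (fun P => Groupoid.inv (PathObj.iso (F := 𝟭 J) P)) fun {P Q} g => by
    have key : ∀ {a b c d : J} {x : a ⟶ b} {y : c ⟶ d} {f : a ⟶ c} {g : b ⟶ d}
        (_ : f ≫ y = x ≫ g), g ≫ Groupoid.inv y = Groupoid.inv x ≫ f := by
      intro a b c d x y f g h
      rw [Groupoid.inv_eq_inv, Groupoid.inv_eq_inv, IsIso.eq_inv_comp, ← Category.assoc,
        IsIso.comp_inv_eq, h]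
    exact key (PathObj.Hom.w (F := 𝟭 J) g)

theorem inv_src (J : Grpd.{u, u}) : inv J ≫ src J = tgt J := rfl
theorem inv_tgt (J : Grpd.{u, u}) : inv J ≫ tgt J = src J := rfl

theorem refl_inv (J : Grpd.{u, u}) : refl J ≫ inv J = refl J := by
  refine ext rfl rfl fun t => ?_
  change Groupoid.inv (𝟙 t) ≫ 𝟙 t = 𝟙 t ≫ 𝟙 t
  simp

/-- Pointwise composition. -/
def comp (w w' : T ⟶ Path J) (h : w ≫ tgt J = w' ≫ src J) : T ⟶ Path J :=
  mk (w ≫ src J) (w' ≫ tgt J) (fun t => app w t ≫ eqToHom (Functor.congr_obj h t) ≫ app w' t)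
    fun {t t'} f => by
      have e := Functor.congr_hom h f
      rw [← Category.assoc, app_naturality, e]
      simp [app_naturality]

theorem comp_src (w w' : T ⟶ Path J) (h : w ≫ tgt J = w' ≫ src J) :
    comp w w' h ≫ src J = w ≫ src J := rfl

theorem comp_tgt (w w' : T ⟶ Path J) (h : w ≫ tgt J = w' ≫ src J) :
    comp w w' h ≫ tgt J = w' ≫ tgt J := rfl

theorem app_comp (w w' : T ⟶ Path J) (h : w ≫ tgt J = w' ≫ src J) (t : T) :
    app (comp w w' h) t = app w t ≫ eqToHom (Functor.congr_obj h t) ≫ app w' t := rfl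

theorem precomp_comp {T' : Grpd.{u, u}} (m : T' ⟶ T) (w w' : T ⟶ Path J)
    (h : w ≫ tgt J = w' ≫ src J) :
    m ≫ comp w w' h = comp (m ≫ w) (m ≫ w') (by rw [Category.assoc, Category.assoc, h]) := rfl

theorem comp_map (w w' : T ⟶ Path J) (h : w ≫ tgt J = w' ≫ src J) (f : J ⟶ K) :
    comp w w' h ≫ map f = comp (w ≫ map f) (w' ≫ map f) (by
      rw [Category.assoc, Category.assoc, map_tgt, map_src, ← Category.assoc, h,
        Category.assoc]) := by
  refine ext rfl rfl fun t => ?_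
  have key : ∀ {a b c d : J} (x : a ⟶ b) (h : b = c) (y : c ⟶ d) (h' : f.obj b = f.obj c),
      f.map (x ≫ eqToHom h ≫ y) ≫ 𝟙 _ = 𝟙 _ ≫ f.map x ≫ eqToHom h' ≫ f.map y := by
    intro a b c d x h y h'
    subst h
    simp
  exact key _ _ _ _

theorem comp_congr {w w' v v' : T ⟶ Path J} {h : w ≫ tgt J = w' ≫ src J} (e : w = v)
    (e' : w' = v') : comp w w' h = comp v v' (by rw [← e, ← e', h]) := by
  subst e e'
  rfl

theorem refl_comp (w : T ⟶ Path J) (v : T ⟶ Path J) (h) (hv : v = w ≫ src J ≫ refl J) :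
    comp v w h = w := by
  subst hv
  refine ext rfl rfl fun t => ?_
  rw [app_comp]
  change (𝟙 _ ≫ 𝟙 _ ≫ app w t) ≫ 𝟙 _ = 𝟙 _ ≫ app w t
  simp

theorem comp_refl (w : T ⟶ Path J) (v : T ⟶ Path J) (h) (hv : v = w ≫ tgt J ≫ refl J) :
    comp w v h = w := by
  subst hv
  refine ext rfl rfl fun t => ?_
  rw [app_comp]
  change (app w t ≫ 𝟙 _ ≫ 𝟙 _) ≫ 𝟙 _ = 𝟙 _ ≫ app w t
  simp

theorem comp_assoc (w w' w'' : T ⟶ Path J) (h : w ≫ tgt J = w' ≫ src J)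
    (h' : w' ≫ tgt J = w'' ≫ src J) :
    comp (comp w w' h) w'' (by rw [comp_tgt, h']) = comp w (comp w' w'' h') (by
      rw [comp_src, h]) := by
  refine ext rfl rfl fun t => ?_
  have key : ∀ {a b c d e f : J} (x : a ⟶ b) (h : b = c) (y : c ⟶ d) (h' : d = e) (z : e ⟶ f),
      ((x ≫ eqToHom h ≫ y) ≫ eqToHom h' ≫ z) ≫ 𝟙 _ =
        𝟙 _ ≫ x ≫ eqToHom h ≫ y ≫ eqToHom h' ≫ z := by
    intros
    simp
  exact key _ _ _ _ _

theorem comp_inv (w : T ⟶ Path J) :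
    comp w (w ≫ inv J) (by rw [Category.assoc, inv_src]) = w ≫ src J ≫ refl J := by
  refine ext rfl rfl fun t => ?_
  have key : ∀ {a b : J} (x : a ⟶ b), (x ≫ 𝟙 b ≫ Groupoid.inv x) ≫ 𝟙 a = 𝟙 a ≫ 𝟙 a := by
    intros
    simp
  exact key _

theorem comp_comp_inv (w w' : T ⟶ Path J) (h : w ≫ tgt J = w' ≫ src J) :
    comp w w' h ≫ inv J = comp (w' ≫ inv J) (w ≫ inv J) (by
      rw [Category.assoc, Category.assoc, inv_tgt, inv_src, h]) := by
  refine ext rfl rfl fun t => ?_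
  have key : ∀ {a b c d : J} (x : a ⟶ b) (h : b = c) (y : c ⟶ d),
      Groupoid.inv (x ≫ eqToHom h ≫ y) ≫ 𝟙 _ =
        𝟙 _ ≫ Groupoid.inv y ≫ eqToHom h.symm ≫ Groupoid.inv x := by
    intro a b c d x h y
    subst h
    simp
  exact key _ _ _

/-- A square of arrows commutes. -/
theorem square (w : T ⟶ Path (Path J)) :
    comp (w ≫ map (src J)) (w ≫ tgt (Path J)) (by
        rw [Category.assoc, Category.assoc, map_tgt]) =
      comp (w ≫ src (Path J)) (w ≫ map (tgt J)) (by
        rw [Category.assoc, Category.assoc, map_src]) := by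
  refine ext rfl rfl fun t => ?_
  have key : ∀ {a b c d : J} {x : a ⟶ b} {y : c ⟶ d} {f : a ⟶ c} {g : b ⟶ d}
      (_ : f ≫ y = x ≫ g), (f ≫ 𝟙 _ ≫ y) ≫ 𝟙 _ = 𝟙 _ ≫ x ≫ 𝟙 _ ≫ g := by
    intro a b c d x y f g h
    simp [h]
  exact key (PathObj.Hom.w (F := 𝟭 J) (app w t))

section Product

variable {I X : Grpd.{u, u}}

/-- The first projection of the explicit product. -/
def prodFst (I X : Grpd.{u, u}) : Grpd.of (I × X) ⟶ I := CategoryTheory.Prod.fst I X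

/-- The second projection of the explicit product. -/
def prodSnd (I X : Grpd.{u, u}) : Grpd.of (I × X) ⟶ X := CategoryTheory.Prod.snd I X

/-- The comparison from the explicit product of groupoids. -/
noncomputable def fromProd (I X : Grpd.{u, u}) : Grpd.of (I × X) ⟶ I ⨯ X :=
  prod.lift (prodFst I X) (prodSnd I X)

/-- The comparison to the explicit product of groupoids. -/
noncomputable def toProd (I X : Grpd.{u, u}) : I ⨯ X ⟶ Grpd.of (I × X) :=
  Functor.prod' (prod.fst : I ⨯ X ⟶ I) (prod.snd : I ⨯ X ⟶ X)

theorem fromProd_fst (I X : Grpd.{u, u}) : fromProd I X ≫ prod.fst = prodFst I X :=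
  prod.lift_fst _ _

theorem fromProd_snd (I X : Grpd.{u, u}) : fromProd I X ≫ prod.snd = prodSnd I X :=
  prod.lift_snd _ _

theorem toProd_fromProd (I X : Grpd.{u, u}) : toProd I X ≫ fromProd I X = 𝟙 _ := by
  apply prod.hom_ext
  · rw [Category.assoc, fromProd_fst]
    rfl
  · rw [Category.assoc, fromProd_snd]
    rfl

/-- The arrow in an explicit product with given components. -/
def pairProd (w : T ⟶ Path I) (w' : T ⟶ Path X) : T ⟶ Path (Grpd.of (I × X)) :=
  mk (J := Grpd.of (I × X)) (Functor.prod' (w ≫ src I) (w' ≫ src X))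
    (Functor.prod' (w ≫ tgt I) (w' ≫ tgt X)) (fun t => (app w t, app w' t))
    fun f => Prod.ext (app_naturality w f) (app_naturality w' f)

theorem pairProd_eta (w : T ⟶ Path (Grpd.of (I × X))) :
    pairProd (w ≫ map (prodFst I X))
      (w ≫ map (prodSnd I X)) = w := rfl

/-- The arrow in a product with given components. -/
noncomputable def pair (w : T ⟶ Path I) (w' : T ⟶ Path X) : T ⟶ Path (I ⨯ X) :=
  pairProd w w' ≫ map (fromProd I X)

theorem pair_fst (w : T ⟶ Path I) (w' : T ⟶ Path X) : pair w w' ≫ map prod.fst = w := by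
  rw [pair, Category.assoc, ← map_comp, fromProd_fst]
  rfl

theorem pair_snd (w : T ⟶ Path I) (w' : T ⟶ Path X) : pair w w' ≫ map prod.snd = w' := by
  rw [pair, Category.assoc, ← map_comp, fromProd_snd]
  rfl

/-- The categorical product is a retract of the explicit one by `toProd_fromProd`, and in the
explicit product an arrow is definitionally the pair of its components. -/
theorem prod_ext {w w' : T ⟶ Path (I ⨯ X)} (h : w ≫ map prod.fst = w' ≫ map prod.fst)
    (h' : w ≫ map prod.snd = w' ≫ map prod.snd) : w = w' := by
  have key : ∀ v : T ⟶ Path (I ⨯ X), v = pair (v ≫ map prod.fst) (v ≫ map prod.snd) := fun v => by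
    have : pairProd (v ≫ map prod.fst) (v ≫ map prod.snd) = v ≫ map (toProd I X) :=
      pairProd_eta (v ≫ map (toProd I X))
    rw [pair, this, Category.assoc, ← map_comp, toProd_fromProd]
    rfl
  rw [key w, key w', h, h']

theorem pair_src (w : T ⟶ Path I) (w' : T ⟶ Path X) :
    pair w w' ≫ src _ = prod.lift (w ≫ src I) (w' ≫ src X) := by
  apply prod.hom_ext
  · rw [prod.lift_fst, Category.assoc, ← map_src, ← Category.assoc, pair_fst]
  · rw [prod.lift_snd, Category.assoc, ← map_src, ← Category.assoc, pair_snd]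

theorem pair_tgt (w : T ⟶ Path I) (w' : T ⟶ Path X) :
    pair w w' ≫ tgt _ = prod.lift (w ≫ tgt I) (w' ≫ tgt X) := by
  apply prod.hom_ext
  · rw [prod.lift_fst, Category.assoc, ← map_tgt, ← Category.assoc, pair_fst]
  · rw [prod.lift_snd, Category.assoc, ← map_tgt, ← Category.assoc, pair_snd]

end Product

end Path

/-! ### The middle groupoid as a pullback of the arrow groupoid -/

section Mid

open ElemFib.Path

variable {A B A' B' T : Grpd.{u, u}}

/-- The arrow component of an object of the middle groupoid. -/
def isoPath (F : A ⟶ B) : grpdAWFS.mid F ⟶ Path B :=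
  Path.mk (PathObj.baseFunctor F) (PathObj.ptFunctor F ⋙ F) (fun P => PathObj.iso P)
    fun f => PathObj.Hom.w f

/-- The point component of an object of the middle groupoid. -/
def ptMap (F : A ⟶ B) : grpdAWFS.mid F ⟶ A := PathObj.ptFunctor F

theorem isoPath_src (F : A ⟶ B) : isoPath F ≫ src B = grpdAWFS.rightMap F := rfl
theorem isoPath_tgt (F : A ⟶ B) : isoPath F ≫ tgt B = ptMap F ≫ F := rfl

/-- Together with `pairMid`, this exhibits the middle groupoid as the pullback of `tgt B` along `F`.
The structure maps of the factorisation are then known from their two components. -/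
theorem mid_ext {F : A ⟶ B} {x y : T ⟶ grpdAWFS.mid F} (h : x ≫ isoPath F = y ≫ isoPath F)
    (h' : x ≫ ptMap F = y ≫ ptMap F) : x = y := by
  refine PathObj.functor_ext (X := T) (F := F) (congrArg (· ≫ src B) h) h' fun t => ?_
  have key : ∀ {P Q : PathObj (𝟭 B)} (_ : P = Q) {b : B} (h₁ : P.pt = b) (h₂ : P.base = Q.base)
      (h₃ : Q.pt = b), P.iso ≫ eqToHom h₁ = eqToHom h₂ ≫ Q.iso ≫ eqToHom h₃ := by
    intro P Q e b h₁ h₂ h₃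
    subst e h₁
    simp
  rw [eqToHom_map]
  refine (key (Functor.congr_obj h t) _ (Functor.congr_obj (congrArg (· ≫ src B) h) t) rfl).trans ?_
  exact congrArg (_ ≫ ·) (Category.comp_id _)

/-- The functor into the middle groupoid with given components. -/
def pairMid (F : A ⟶ B) (w : T ⟶ Path B) (k : T ⟶ A) (h : w ≫ tgt B = k ≫ F) :
    T ⟶ grpdAWFS.mid F :=
  PathObj.lift (F := F) (w ≫ src B) k (fun t => app w t ≫ eqToHom (Functor.congr_obj h t))
    fun {t t'} f => by
      have e := Functor.congr_hom h f
      have n := app_naturality w f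
      rw [← Category.assoc, n, e]
      simp
      rfl

theorem pairMid_isoPath (F : A ⟶ B) (w : T ⟶ Path B) (k : T ⟶ A) (h : w ≫ tgt B = k ≫ F) :
    pairMid F w k h ≫ isoPath F = w := by
  refine Path.ext rfl h.symm fun t => ?_
  have key : ∀ {a b c : B} (x : a ⟶ b) (h : b = c), (x ≫ eqToHom h) ≫ eqToHom h.symm = 𝟙 _ ≫ x := by
    intros
    simp
  exact key _ _

theorem pairMid_ptMap (F : A ⟶ B) (w : T ⟶ Path B) (k : T ⟶ A) (h : w ≫ tgt B = k ≫ F) :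
    pairMid F w k h ≫ ptMap F = k := rfl

theorem leftMap_isoPath (F : A ⟶ B) : grpdAWFS.leftMap F ≫ isoPath F = F ≫ refl B := rfl
theorem leftMap_ptMap (F : A ⟶ B) : grpdAWFS.leftMap F ≫ ptMap F = 𝟙 A := rfl

theorem midMap_isoPath {F : A ⟶ B} {F' : A' ⟶ B'} {l : A ⟶ A'} {f : B ⟶ B'}
    (w : l ≫ F' = F ≫ f) :
    grpdAWFS.midMap l f w ≫ isoPath F' = isoPath F ≫ Path.map f := by
  refine Path.ext rfl (congrArg (ptMap F ≫ ·) w) fun t => ?_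
  have key : ∀ {a b c : B'} (x : a ⟶ b) (h : b = c),
      (x ≫ eqToHom h) ≫ eqToHom h.symm = 𝟙 _ ≫ x := by
    intros
    simp
  exact key _ _

/-- Multiplication is composition of arrows; this is what makes transport in an algebra functorial.
-/
theorem mulMap_isoPath (F : A ⟶ B) : grpdAWFS.mulMap F ≫ isoPath F =
    comp (isoPath (grpdAWFS.rightMap F)) (ptMap (grpdAWFS.rightMap F) ≫ isoPath F) (by
      rw [isoPath_tgt, Category.assoc, isoPath_src]) := by
  refine Path.ext rfl rfl fun t => ?_
  have key : ∀ {a b c : B} (x : a ⟶ b) (y : b ⟶ c), (x ≫ y) ≫ 𝟙 _ = 𝟙 _ ≫ x ≫ 𝟙 _ ≫ y := by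
    intros
    simp
  exact key _ _

theorem mulMap_ptMap (F : A ⟶ B) :
    grpdAWFS.mulMap F ≫ ptMap F = ptMap (grpdAWFS.rightMap F) ≫ ptMap F := rfl

/-- The canonical arrow from an object of the middle groupoid to an identity. -/
def contraction (F : A ⟶ B) : grpdAWFS.mid F ⟶ Path (grpdAWFS.mid F) :=
  grpdAWFS.comul (Arrow.mk F) ≫ isoPath (grpdAWFS.leftMap F)

/-- The comultiplication provides the natural arrow `(a, x) ⟶ (a, id)` lying over `x`. An algebra
structure carries it to an arrow from the transported element to the original one, see `strPath`. -/
theorem contraction_src (F : A ⟶ B) : contraction F ≫ src _ = 𝟙 _ := rfl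
theorem contraction_tgt (F : A ⟶ B) : contraction F ≫ tgt _ = ptMap F ≫ grpdAWFS.leftMap F := rfl
theorem contraction_map (F : A ⟶ B) :
    contraction F ≫ Path.map (grpdAWFS.rightMap F) = isoPath F := rfl

end Mid

end Paths

open AWFS AWFS.AlgOn

/-! ### Algebra structures as transport along arrows of the base -/

section Transport

variable {I J K T T' : Grpd.{u, u}}

/-- Transport of generalised elements of an algebra along generalised arrows of the base. -/
def transp (c : AlgOn grpdAWFS J) (w : T ⟶ Path J) (k : T ⟶ c.tot)
    (h : w ≫ Path.tgt J = k ≫ c.proj) : T ⟶ c.tot :=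
  pairMid c.proj w k h ≫ c.str

variable {c : AlgOn grpdAWFS J}

theorem transp_def (w : T ⟶ Path J) (k : T ⟶ c.tot) (h : w ≫ Path.tgt J = k ≫ c.proj) :
    transp c w k h = pairMid c.proj w k h ≫ c.str := rfl

theorem transp_congr {w w' : T ⟶ Path J} {k k' : T ⟶ c.tot} {h : w ≫ Path.tgt J = k ≫ c.proj}
    (e : w = w') (e' : k = k') : transp c w k h = transp c w' k' (by rw [← e, ← e', h]) := by
  subst e e'
  rfl

theorem transp_proj (w : T ⟶ Path J) (k : T ⟶ c.tot) (h : w ≫ Path.tgt J = k ≫ c.proj) :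
    transp c w k h ≫ c.proj = w ≫ Path.src J := by
  rw [transp_def, Category.assoc, c.str_proj, ← isoPath_src, ← Category.assoc, pairMid_isoPath]

theorem transp_refl (w : T ⟶ Path J) (k : T ⟶ c.tot) (h : w ≫ Path.tgt J = k ≫ c.proj)
    (hw : w = k ≫ c.proj ≫ Path.refl J) : transp c w k h = k := by
  have : pairMid c.proj w k h = k ≫ grpdAWFS.leftMap c.proj := by
    refine mid_ext ?_ ?_
    · rw [pairMid_isoPath, Category.assoc, leftMap_isoPath, hw]
    · rw [pairMid_ptMap, Category.assoc, leftMap_ptMap, Category.comp_id]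
  rw [transp_def, this, Category.assoc, c.lam_str, Category.comp_id]

/-- Transport is natural in the stage `T`, so equations need only be checked on the universal
element, whose stage is the middle groupoid. -/
theorem comp_transp (m : T' ⟶ T) (w : T ⟶ Path J) (k : T ⟶ c.tot)
    (h : w ≫ Path.tgt J = k ≫ c.proj) : m ≫ transp c w k h =
      transp c (m ≫ w) (m ≫ k) (by rw [Category.assoc, Category.assoc, h]) := rfl

/-- The associativity law of the algebra, evaluated at the generalised element `((k, w), w')` of the
twofold middle groupoid. -/
theorem transp_transp (w' w : T ⟶ Path J) (k : T ⟶ c.tot) (h : w ≫ Path.tgt J = k ≫ c.proj)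
    (h' : w' ≫ Path.tgt J = transp c w k h ≫ c.proj) :
    transp c w' (transp c w k h) h' =
      transp c (Path.comp w' w (h'.trans (transp_proj w k h))) k (by
        rw [Path.comp_tgt, h]) := by
  have e : w' ≫ Path.tgt J = pairMid c.proj w k h ≫ grpdAWFS.rightMap c.proj :=
    h'.trans (transp_proj w k h)
  let x := pairMid (grpdAWFS.rightMap c.proj) w' (pairMid c.proj w k h) e
  have h₁ : x ≫ grpdAWFS.mulMap c.proj =
      pairMid c.proj (Path.comp w' w (h'.trans (transp_proj w k h))) k (by
        rw [Path.comp_tgt, h]) := by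
    refine mid_ext ?_ ?_
    · rw [pairMid_isoPath, Category.assoc, mulMap_isoPath, Path.precomp_comp]
      exact Path.comp_congr (pairMid_isoPath _ _ _ _) (pairMid_isoPath _ w k h)
    · rfl
  have h₂ : x ≫ grpdAWFS.midMap c.str (𝟙 J) (c.str_proj.trans (Category.comp_id _).symm) =
      pairMid c.proj w' (transp c w k h) h' := by
    refine mid_ext ?_ ?_
    · rw [pairMid_isoPath, Category.assoc, midMap_isoPath, Path.map_id, Category.comp_id]
      exact pairMid_isoPath _ _ _ _
    · rfl
  rw [transp_def, ← h₂, transp_def, ← h₁, Category.assoc, Category.assoc, c.mul_str]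

theorem isoPath_map_tgt {A A' : Grpd.{u, u}} {q : A ⟶ I} {q' : A' ⟶ J} {f : I ⟶ J} {l : A ⟶ A'}
    (w : l ≫ q' = q ≫ f) :
    (isoPath q ≫ Path.map f) ≫ Path.tgt J = (ptMap q ≫ l) ≫ q' := by
  rw [Category.assoc, Category.assoc, Path.map_tgt, w, ← Category.assoc, isoPath_tgt,
    Category.assoc]

theorem midMap_str {a : AlgOn grpdAWFS I} {f : I ⟶ J} {l : a.tot ⟶ c.tot}
    (w : l ≫ c.proj = a.proj ≫ f) : grpdAWFS.midMap l f w ≫ c.str =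
      transp c (isoPath a.proj ≫ Path.map f) (ptMap a.proj ≫ l)
        (isoPath_map_tgt w) := by
  rw [transp_def]
  refine congrArg (· ≫ c.str) (mid_ext ?_ ?_)
  · rw [midMap_isoPath, pairMid_isoPath]
  · rfl

/-- A square is an algebra map as soon as it preserves the universal transport. -/
theorem isHom_of_transp {a : AlgOn grpdAWFS I} {f : I ⟶ J} {l : a.tot ⟶ c.tot}
    (w : l ≫ c.proj = a.proj ≫ f)
    (h : a.str ≫ l = transp c (isoPath a.proj ≫ Path.map f) (ptMap a.proj ≫ l)
        (isoPath_map_tgt w)) : IsHom a c f l :=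
  ⟨w, (midMap_str w).trans h.symm⟩

theorem str_comp_of_isHom {a : AlgOn grpdAWFS I} {f : I ⟶ J} {l : a.tot ⟶ c.tot}
    (hl : IsHom a c f l) :
    a.str ≫ l = transp c (isoPath a.proj ≫ Path.map f) (ptMap a.proj ≫ l)
        (isoPath_map_tgt hl.w) :=
  hl.map_str.symm.trans (midMap_str hl.w)

/-- Algebra maps preserve transport. -/
theorem transp_comp_of_isHom {a : AlgOn grpdAWFS I} {f : I ⟶ J} {l : a.tot ⟶ c.tot}
    (hl : IsHom a c f l) (w : T ⟶ Path I) (k : T ⟶ a.tot) (h : w ≫ Path.tgt I = k ≫ a.proj) :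
    transp a w k h ≫ l = transp c (w ≫ Path.map f) (k ≫ l) (by
      rw [Category.assoc, Category.assoc, hl.w, Path.map_tgt, ← Category.assoc, h,
        Category.assoc]) := by
  rw [transp_def, Category.assoc, str_comp_of_isHom hl, comp_transp]
  refine transp_congr ?_ rfl
  rw [← Category.assoc, pairMid_isoPath]

/-- The canonical arrow from a transport to the element transported. -/
def strPath (a : AlgOn grpdAWFS I) : grpdAWFS.mid a.proj ⟶ Path a.tot :=
  contraction a.proj ≫ Path.map a.str

theorem strPath_src (a : AlgOn grpdAWFS I) : strPath a ≫ Path.src _ = a.str := by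
  rw [strPath, Category.assoc, Path.map_src, ← Category.assoc, contraction_src, Category.id_comp]

theorem strPath_tgt (a : AlgOn grpdAWFS I) : strPath a ≫ Path.tgt _ = ptMap a.proj := by
  rw [strPath, Category.assoc, Path.map_tgt, ← Category.assoc, contraction_tgt, Category.assoc,
    a.lam_str, Category.comp_id]

theorem strPath_map (a : AlgOn grpdAWFS I) :
    strPath a ≫ Path.map a.proj = isoPath a.proj := by
  rw [strPath, Category.assoc, ← Path.map_comp, a.str_proj, contraction_map]

/-- Transport of an algebra map along a natural transformation is an algebra map. -/
theorem isHom_transp {a : AlgOn grpdAWFS I} {f f' : I ⟶ J} {l : a.tot ⟶ c.tot}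
    (hl : IsHom a c f l) (w : a.tot ⟶ Path J) (ht : w ≫ Path.tgt J = l ≫ c.proj)
    (hs : w ≫ Path.src J = a.proj ≫ f') : IsHom a c f' (transp c w l ht) := by
  have hs' : transp c w l ht ≫ c.proj = a.proj ≫ f' := (transp_proj w l ht).trans hs
  refine isHom_of_transp hs' ?_
  have e : (strPath a ≫ Path.map w) ≫ Path.map (Path.src J) = isoPath a.proj ≫ Path.map f' := by
    rw [Category.assoc, ← Path.map_comp, hs, Path.map_comp, ← Category.assoc, strPath_map]
  have e' : (strPath a ≫ Path.map w) ≫ Path.map (Path.tgt J) = isoPath a.proj ≫ Path.map f := by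
    rw [Category.assoc, ← Path.map_comp, ht, hl.w, Path.map_comp, ← Category.assoc, strPath_map]
  have e₁ : (strPath a ≫ Path.map w) ≫ Path.src _ = a.str ≫ w := by
    rw [Category.assoc, Path.map_src, ← Category.assoc, strPath_src]
  have e₂ : (strPath a ≫ Path.map w) ≫ Path.tgt _ = ptMap a.proj ≫ w := by
    rw [Category.assoc, Path.map_tgt, ← Category.assoc, strPath_tgt]
  -- Naturality of `w` at the arrow `strPath a`, from the transported element to the original one.
  -- The two ways round the square are the two composites along which the same element `ptMap a.proj
  -- ≫ l` is transported.
  have sq := Path.square (strPath a ≫ Path.map w)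
  rw [Path.comp_congr e e₂, Path.comp_congr e₁ e'] at sq
  rw [comp_transp, transp_congr rfl (str_comp_of_isHom hl), transp_transp,
    transp_congr rfl (comp_transp (ptMap a.proj) w l ht), transp_transp]
  exact transp_congr sq.symm rfl

end Transport

section Lft

variable {I J K : Grpd.{u, u}}

/-- The upper component of an arrow between algebras. -/
def lft {a : AlgOn grpdAWFS I} {c : AlgOn grpdAWFS J} (φ : a.toFiber.1 ⟶ c.toFiber.1) :
    a.tot ⟶ c.tot := φ.f.left

theorem lft_comp {a : AlgOn grpdAWFS I} {b : AlgOn grpdAWFS J} {c : AlgOn grpdAWFS K}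
    (φ : a.toFiber.1 ⟶ b.toFiber.1) (ψ : b.toFiber.1 ⟶ c.toFiber.1) :
    lft (φ ≫ ψ) = lft φ ≫ lft ψ := rfl

theorem lft_toHom {a : AlgOn grpdAWFS I} {c : AlgOn grpdAWFS J} {f : I ⟶ J}
    {l : a.tot ⟶ c.tot} (h : IsHom a c f l) : lft h.toHom = l := rfl

theorem isHom_lft {a : AlgOn grpdAWFS I} {c : AlgOn grpdAWFS J} {f : I ⟶ J}
    {φ : a.toFiber.1 ⟶ c.toFiber.1} (h : grpdAWFS.algFunctor.IsHomLift f φ) :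
    IsHom a c f (lft φ) := isHom_of_isHomLift h

theorem eq_of_lft {a : AlgOn grpdAWFS I} {c : AlgOn grpdAWFS J} {f : I ⟶ J}
    {φ ψ : a.toFiber.1 ⟶ c.toFiber.1} (hφ : grpdAWFS.algFunctor.IsHomLift f φ)
    (hψ : grpdAWFS.algFunctor.IsHomLift f ψ) (h : lft φ = lft ψ) : φ = ψ :=
  hom_ext_of_isHomLift (A := a.toFiber) (D := c.toFiber) hφ hψ h

end Lft

/-! ### Cocartesian arrows from a retraction and a contraction -/

section Diagonal

variable {I J : Grpd.{u, u}}

/-- The data exhibiting an arrow of algebras as cocartesian over a coretraction `d` of `t`: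
a retraction over `t` and a contraction onto its image. -/
structure DiagData (d : I ⟶ J) (t : J ⟶ I) (a : AlgOn grpdAWFS I) (s : AlgOn grpdAWFS J)
    (η : a.toFiber.1 ⟶ s.toFiber.1) where
  isHomLift : grpdAWFS.algFunctor.IsHomLift d η
  r : s.toFiber.1 ⟶ a.toFiber.1
  r_isHomLift : grpdAWFS.algFunctor.IsHomLift t r
  η_r : η ≫ r = 𝟙 _
  θ : s.tot ⟶ Path J
  -- The contraction starts at the given point and ends in the image of `η`: transport goes from the
  -- target of an arrow to its source, so elements of the image are carried back along `θ`.
  θ_src : θ ≫ Path.src J = s.proj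
  θ_tgt : θ ≫ Path.tgt J = lft (r ≫ η) ≫ s.proj
  θ_map : θ ≫ Path.map t = s.proj ≫ t ≫ Path.refl I
  η_θ : lft η ≫ θ = a.proj ≫ d ≫ Path.refl J
  transp_eq : transp s θ (lft (r ≫ η)) θ_tgt = 𝟙 _

/-- Every element of `s` is the transport along `θ` of its image under `r ≫ η`. So an extension of
`φ` has to be the transport along `θ` of `r ≫ φ`. This is an algebra map by `isHom_transp`, and it
restricts to `φ` because `θ` is constant along `η`. -/
theorem DiagData.isCocartesian {d : I ⟶ J} {t : J ⟶ I} {a : AlgOn grpdAWFS I}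
    {s : AlgOn grpdAWFS J} {η : a.toFiber.1 ⟶ s.toFiber.1} (D : DiagData d t a s η) :
    grpdAWFS.algFunctor.IsCocartesian d η := by
  have := D.isHomLift
  refine { toIsHomLift := D.isHomLift, universal_property := fun {b'} φ hφ => ?_ }
  have key : ∀ (C : grpdAWFS.algFunctor.Fiber J) (φ : a.toFiber.1 ⟶ C.1)
      (_ : grpdAWFS.algFunctor.IsHomLift d φ), ∃! χ : s.toFiber.1 ⟶ C.1,
      grpdAWFS.algFunctor.IsHomLift (𝟙 J) χ ∧ η ≫ χ = φ := by
    intro C φ hφ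
    obtain ⟨c, rfl⟩ := exists_eq_toFiber C
    have hrφ := isHom_lft (isHomLift_comp D.r_isHomLift hφ)
    have hrη := isHom_lft (isHomLift_comp D.r_isHomLift D.isHomLift)
    have ht : D.θ ≫ Path.tgt J = lft (D.r ≫ φ) ≫ c.proj := by
      rw [D.θ_tgt, hrφ.w, hrη.w]
    have h := isHom_transp hrφ D.θ ht (f' := 𝟙 J) (D.θ_src.trans (Category.comp_id _).symm)
    refine ⟨h.toHom, ⟨h.isHomLift, ?_⟩, fun χ hχ => ?_⟩
    · refine eq_of_lft (f := d ≫ 𝟙 J) (isHomLift_comp D.isHomLift h.isHomLift)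
        (by rwa [Category.comp_id]) ?_
      rw [lft_comp, lft_toHom, comp_transp]
      have e : lft η ≫ lft (D.r ≫ φ) = lft φ := by
        rw [← lft_comp, ← Category.assoc, D.η_r, Category.id_comp]
      rw [transp_congr D.η_θ e]
      refine transp_refl _ _ _ ?_
      rw [← Category.assoc, ← Category.assoc, (isHom_lft hφ).w]
    · refine eq_of_lft hχ.1 h.isHomLift ?_
      -- Uniqueness: apply `χ`, which preserves transport, to the equation `D.transp_eq`.
      have e := transp_comp_of_isHom (isHom_lft hχ.1) D.θ (lft (D.r ≫ η)) D.θ_tgt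
      rw [D.transp_eq, Category.id_comp] at e
      rw [e, lft_toHom]
      refine transp_congr (Category.comp_id _) ?_
      rw [← lft_comp, Category.assoc, hχ.2]
  exact key ⟨b', IsHomLift.codomain_eq _ d φ⟩ φ hφ

end Diagonal

/-! ### Stability of contraction data -/

section DiagonalStability

variable {I J I' J' : Grpd.{u, u}}

theorem exists_factor {c c' : Grpd.{u, u}} {x : AlgOn grpdAWFS c} {y : AlgOn grpdAWFS c'}
    {f : c ⟶ c'} {γ : x.toFiber.1 ⟶ y.toFiber.1}
    (hγ : grpdAWFS.algFunctor.IsStronglyCartesian f γ) {K : Grpd.{u, u}} {z : AlgOn grpdAWFS K}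
    (g : K ⟶ c) {g' : K ⟶ c'} (e : g' = g ≫ f) {φ : z.toFiber.1 ⟶ y.toFiber.1}
    (hφ : grpdAWFS.algFunctor.IsHomLift g' φ) :
    ∃ χ : z.toFiber.1 ⟶ x.toFiber.1, grpdAWFS.algFunctor.IsHomLift g χ ∧ χ ≫ γ = φ :=
  ⟨Functor.IsStronglyCartesian.map _ f γ e φ,
    Functor.IsStronglyCartesian.map_isHomLift _ f γ e φ,
    Functor.IsStronglyCartesian.fac _ f γ e φ⟩

theorem factor_ext {c c' : Grpd.{u, u}} {x : AlgOn grpdAWFS c} {y : AlgOn grpdAWFS c'}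
    {f : c ⟶ c'} {γ : x.toFiber.1 ⟶ y.toFiber.1}
    (hγ : grpdAWFS.algFunctor.IsStronglyCartesian f γ) {K : Grpd.{u, u}} {z : AlgOn grpdAWFS K}
    (g : K ⟶ c) {χ χ' : z.toFiber.1 ⟶ x.toFiber.1} (h : grpdAWFS.algFunctor.IsHomLift g χ)
    (h' : grpdAWFS.algFunctor.IsHomLift g χ') (e : χ ≫ γ = χ' ≫ γ) : χ = χ' := by
  have := hγ
  have := h
  have := h'
  exact Functor.IsStronglyCartesian.ext grpdAWFS.algFunctor f γ g e

theorem isHomLift_congr {a b : grpdAWFS.{u}.RAlg} {f f' : I ⟶ J} {φ : a ⟶ b}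
    (h : grpdAWFS.algFunctor.IsHomLift f φ) (e : f = f') :
    grpdAWFS.algFunctor.IsHomLift f' φ := e ▸ h

/-- The contraction data are stable under products with cartesian arrows. -/
theorem DiagData.prod {d : I ⟶ J} {t : J ⟶ I} (dt : d ≫ t = 𝟙 I) {a c' p : AlgOn grpdAWFS I}
    {s c q : AlgOn grpdAWFS J} {η : a.toFiber.1 ⟶ s.toFiber.1} (D : DiagData d t a s η)
    {γ : c'.toFiber.1 ⟶ c.toFiber.1} (hγ : grpdAWFS.algFunctor.IsStronglyCartesian d γ)
    {π : p.toFiber ⟶ c'.toFiber} {π' : p.toFiber ⟶ a.toFiber}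
    (hp : IsStrongProduct grpdAWFS.algFunctor π π')
    {ρ : q.toFiber ⟶ c.toFiber} {ρ' : q.toFiber ⟶ s.toFiber}
    (hq : IsStrongProduct grpdAWFS.algFunctor ρ ρ')
    {κ : p.toFiber.1 ⟶ q.toFiber.1} (hκ : grpdAWFS.algFunctor.IsHomLift d κ)
    (e₁ : κ ≫ ρ.1 = π.1 ≫ γ) (e₂ : κ ≫ ρ'.1 = π'.1 ≫ η) : Nonempty (DiagData d t p q κ) := by
  have hρ := isHom_lft ρ.2
  have hρ' := isHom_lft ρ'.2
  have hη := isHom_lft D.isHomLift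
  have hr := isHom_lft D.r_isHomLift
  have hqs : lft ρ'.1 ≫ s.proj = q.proj := hρ'.w.trans (Category.comp_id _)
  have hqc : lft ρ.1 ≫ c.proj = q.proj := hρ.w.trans (Category.comp_id _)
  let θ : q.tot ⟶ Path J := lft ρ'.1 ≫ D.θ
  have θ_src : θ ≫ Path.src J = q.proj := by rw [Category.assoc, D.θ_src, hqs]
  have θ_tgt : θ ≫ Path.tgt J = q.proj ≫ t ≫ d := by
    rw [Category.assoc, D.θ_tgt, lft_comp, Category.assoc, hη.w, ← Category.assoc (lft D.r), hr.w,
      ← Category.assoc, ← Category.assoc, hqs, Category.assoc]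
  -- The retraction needs a component into `c'` over `t`. Transporting `ρ` along the inverse of `θ`
  -- moves it over `t ≫ d`, and the result factors through the cartesian arrow `γ`. The inverse
  -- exists because the base is a groupoid.
  have hθ : (θ ≫ Path.inv J) ≫ Path.tgt J = lft ρ.1 ≫ c.proj := by
    rw [Category.assoc, Path.inv_tgt, θ_src, hqc]
  have hu : IsHom q c (t ≫ d) (transp c (θ ≫ Path.inv J) (lft ρ.1) hθ) :=
    isHom_transp hρ _ _ (by rw [Category.assoc, Path.inv_src, θ_tgt])
  obtain ⟨v, hv, hvγ⟩ := exists_factor hγ t rfl hu.isHomLift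
  have hr' : grpdAWFS.algFunctor.IsHomLift t (ρ'.1 ≫ D.r) := isHomLift_vert_comp ρ' D.r_isHomLift
  obtain ⟨r, hr₀, hr₁, hr₂⟩ := hp.exists_lift t v (ρ'.1 ≫ D.r) hv hr'
  have hκr : grpdAWFS.algFunctor.IsHomLift (𝟙 I) (κ ≫ r) :=
    isHomLift_congr (isHomLift_comp hκ hr₀) dt
  have hrκ : grpdAWFS.algFunctor.IsHomLift (t ≫ d) (r ≫ κ) := isHomLift_comp hr₀ hκ
  have ηθ : lft κ ≫ θ = p.proj ≫ d ≫ Path.refl J := by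
    have : lft κ ≫ lft ρ'.1 = lft π'.1 ≫ lft η := congrArg lft e₂
    rw [← Category.assoc, this, Category.assoc, D.η_θ, ← Category.assoc, (isHom_lft π'.2).w,
      Category.comp_id]
  have κr : κ ≫ r = 𝟙 _ := by
    refine hp.ext (𝟙 I) _ _ hκr (IsHomLift.id rfl) ?_ ?_
    · rw [Category.assoc, hr₁, Category.id_comp]
      refine factor_ext hγ (𝟙 I) (isHomLift_congr (isHomLift_comp hκ hv) dt) π.2 ?_
      rw [Category.assoc, hvγ]
      refine eq_of_lft (f := d) ?_ ?_ ?_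
      · refine isHomLift_congr (isHomLift_comp hκ hu.isHomLift) ?_
        rw [← Category.assoc, dt, Category.id_comp]
      · exact isHomLift_vert_comp π hγ.toIsHomLift
      · rw [lft_comp, lft_toHom, comp_transp]
        -- Along `κ` the contraction is constant, and so is its inverse; the transport defining `v`
        -- is then trivial.
        refine (transp_refl _ _ _ ?_).trans (congrArg lft e₁)
        have e : (lft κ ≫ lft ρ.1) ≫ c.proj = p.proj ≫ d := by
          rw [Category.assoc, hqc, (isHom_lft hκ).w]
        rw [← Category.assoc, ηθ, Category.assoc, Category.assoc, Path.refl_inv, ← Category.assoc,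
          ← Category.assoc (lft κ ≫ lft ρ.1), e]
    · rw [Category.assoc, hr₂, Category.id_comp, ← Category.assoc, e₂, Category.assoc, D.η_r,
        Category.comp_id]
  have θ_tgt' : θ ≫ Path.tgt J = lft (r ≫ κ) ≫ q.proj := by
    rw [θ_tgt, (isHom_lft hrκ).w]
  have hθ₁ : θ ≫ Path.map (𝟙 J) = θ := by rw [Path.map_id, Category.comp_id]
  have hE : IsHom q q (𝟙 J) (transp q θ (lft (r ≫ κ)) θ_tgt') :=
    isHom_transp (isHom_lft hrκ) θ _ (by rw [θ_src, Category.comp_id])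
  refine ⟨⟨hκ, r, hr₀, κr, θ, θ_src, θ_tgt', ?_, ηθ, ?_⟩⟩
  · rw [Category.assoc, D.θ_map, ← Category.assoc, hqs]
  · suffices hE.toHom = 𝟙 _ from congrArg lft this
    -- The transport is compared with the identity on both factors: on `c` the transports along `θ`
    -- and its inverse cancel, on `s` the equation is `D.transp_eq`.
    refine hq.ext (𝟙 J) _ _ hE.isHomLift (IsHomLift.id rfl) ?_ ?_
    · rw [Category.id_comp]
      refine eq_of_lft (f := 𝟙 J) (isHomLift_comp_vert hE.isHomLift ρ) ρ.2 ?_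
      rw [lft_comp, lft_toHom, transp_comp_of_isHom hρ]
      have e : lft (r ≫ κ) ≫ lft ρ.1 = transp c (θ ≫ Path.inv J) (lft ρ.1) hθ := by
        rw [← lft_comp, Category.assoc, e₁, ← Category.assoc, hr₁, hvγ]
        rfl
      rw [transp_congr rfl e, transp_transp]
      refine transp_refl _ _ _ ?_
      refine (Path.comp_congr hθ₁ rfl).trans ((Path.comp_inv θ).trans ?_)
      rw [← Category.assoc, θ_src, ← Category.assoc, hqc]
    · rw [Category.id_comp]
      refine eq_of_lft (f := 𝟙 J) (isHomLift_comp_vert hE.isHomLift ρ') ρ'.2 ?_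
      rw [lft_comp, lft_toHom, transp_comp_of_isHom hρ']
      have e : lft (r ≫ κ) ≫ lft ρ'.1 = lft ρ'.1 ≫ lft (D.r ≫ η) := by
        rw [← lft_comp, Category.assoc, e₂, ← Category.assoc, hr₂, Category.assoc]
        rfl
      rw [transp_congr hθ₁ e, ← comp_transp _ _ _ D.θ_tgt, D.transp_eq, Category.comp_id]

/-- The contraction data are stable under reindexing, as soon as the contraction can be
reindexed. -/
theorem DiagData.reindex {d : I ⟶ J} {t : J ⟶ I} {d' : I' ⟶ J'} {t' : J' ⟶ I'}
    (dt' : d' ≫ t' = 𝟙 I') {f : I' ⟶ I} {g : J' ⟶ J} (sq' : t' ≫ f = g ≫ t)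
    {a : AlgOn grpdAWFS I} {s : AlgOn grpdAWFS J} {a' : AlgOn grpdAWFS I'}
    {s' : AlgOn grpdAWFS J'} {η : a.toFiber.1 ⟶ s.toFiber.1} (D : DiagData d t a s η)
    {α : a'.toFiber.1 ⟶ a.toFiber.1} (hα : grpdAWFS.algFunctor.IsStronglyCartesian f α)
    {σ : s'.toFiber.1 ⟶ s.toFiber.1} (hσ : grpdAWFS.algFunctor.IsStronglyCartesian g σ)
    {η' : a'.toFiber.1 ⟶ s'.toFiber.1} (hη' : grpdAWFS.algFunctor.IsHomLift d' η')
    (e : η' ≫ σ = α ≫ η) (θ : s'.tot ⟶ Path J') (θ_src : θ ≫ Path.src J' = s'.proj)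
    (θ_tgt : θ ≫ Path.tgt J' = s'.proj ≫ t' ≫ d')
    (θ_map : θ ≫ Path.map t' = s'.proj ≫ t' ≫ Path.refl I')
    (η_θ : lft η' ≫ θ = a'.proj ≫ d' ≫ Path.refl J')
    (θ_g : θ ≫ Path.map g = lft σ ≫ D.θ) : Nonempty (DiagData d' t' a' s' η') := by
  -- The retraction is forced by cartesianness of `α`; the remaining equations are tested after the
  -- cartesian arrows `α` and `σ`.
  obtain ⟨r, hr, hrα⟩ := exists_factor hα t' sq'.symm
    (isHomLift_comp hσ.toIsHomLift D.r_isHomLift)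
  have hrη := isHomLift_comp hr hη'
  have θ_tgt' : θ ≫ Path.tgt J' = lft (r ≫ η') ≫ s'.proj := by
    rw [θ_tgt, (isHom_lft hrη).w]
  have hE : IsHom s' s' (𝟙 J') (transp s' θ (lft (r ≫ η')) θ_tgt') :=
    isHom_transp (isHom_lft hrη) θ _ (by rw [θ_src, Category.comp_id])
  refine ⟨⟨hη', r, hr, ?_, θ, θ_src, θ_tgt', θ_map, η_θ, ?_⟩⟩
  · refine factor_ext hα (𝟙 I') (isHomLift_congr (isHomLift_comp hη' hr) dt') (IsHomLift.id rfl) ?_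
    rw [Category.assoc, hrα, ← Category.assoc, e, Category.assoc, D.η_r, Category.comp_id,
      Category.id_comp]
  · suffices hE.toHom = 𝟙 _ from congrArg lft this
    refine factor_ext hσ (𝟙 J') hE.isHomLift (IsHomLift.id rfl) ?_
    rw [Category.id_comp]
    refine eq_of_lft (f := g) ?_ hσ.toIsHomLift ?_
    · exact isHomLift_congr (isHomLift_comp hE.isHomLift hσ.toIsHomLift) (Category.id_comp _)
    · rw [lft_comp, lft_toHom, transp_comp_of_isHom (isHom_lft hσ.toIsHomLift)]
      have e' : lft (r ≫ η') ≫ lft σ = lft σ ≫ lft (D.r ≫ η) := by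
        rw [← lft_comp, Category.assoc, e, ← Category.assoc, hrα, Category.assoc]
        rfl
      rw [transp_congr θ_g e', ← comp_transp _ _ _ D.θ_tgt, D.transp_eq, Category.comp_id]

end DiagonalStability

/-! ### The algebra of arrows over pairs of endpoints -/

section PathAlgebra

variable {T X : Grpd.{u, u}}

/-- Rebracketing of `a (b k c) d` as `(a b) k (c d)`, the shape produced by two successive
conjugations. -/
theorem comp_conj (a b k c d : T ⟶ Path X) (h₁ : a ≫ Path.tgt X = b ≫ Path.src X)
    (h₂ : b ≫ Path.tgt X = k ≫ Path.src X) (h₃ : k ≫ Path.tgt X = c ≫ Path.src X)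
    (h₄ : c ≫ Path.tgt X = d ≫ Path.src X) :
    Path.comp (Path.comp a (Path.comp (Path.comp b k h₂) c (by rw [Path.comp_tgt, h₃]))
      (by rw [Path.comp_src, Path.comp_src, h₁])) d (by rw [Path.comp_tgt, Path.comp_tgt, h₄]) =
    Path.comp (Path.comp (Path.comp a b h₁) k (by rw [Path.comp_tgt, h₂])) (Path.comp c d h₄)
      (by rw [Path.comp_tgt, Path.comp_src, h₃]) := by
  have e₁ := Path.comp_assoc a b k h₁ h₂
  have e₂ := Path.comp_assoc a (Path.comp b k h₂) c (by rw [Path.comp_src, h₁])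
    (by rw [Path.comp_tgt, h₃])
  have e₃ := Path.comp_assoc (Path.comp (Path.comp a b h₁) k (by rw [Path.comp_tgt, h₂])) c d
    (by rw [Path.comp_tgt, h₃]) h₄
  refine Eq.trans (Path.comp_congr ?_ rfl) e₃
  exact e₂.symm.trans (Path.comp_congr e₁.symm rfl)

/-- The endpoints of an arrow. -/
noncomputable def pathProj (X : Grpd.{u, u}) : Path X ⟶ X ⨯ X := prod.lift (Path.src X) (Path.tgt X)

theorem pathProj_fst (X : Grpd.{u, u}) : pathProj X ≫ prod.fst = Path.src X := prod.lift_fst _ _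
theorem pathProj_snd (X : Grpd.{u, u}) : pathProj X ≫ prod.snd = Path.tgt X := prod.lift_snd _ _

theorem map_fst_tgt {w : T ⟶ Path (X ⨯ X)} {k : T ⟶ Path X}
    (h : w ≫ Path.tgt (X ⨯ X) = k ≫ pathProj X) :
    (w ≫ Path.map prod.fst) ≫ Path.tgt X = k ≫ Path.src X := by
  rw [Category.assoc, Path.map_tgt, ← Category.assoc, h, Category.assoc, pathProj_fst]

theorem map_snd_tgt {w : T ⟶ Path (X ⨯ X)} {k : T ⟶ Path X}
    (h : w ≫ Path.tgt (X ⨯ X) = k ≫ pathProj X) :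
    k ≫ Path.tgt X = (w ≫ Path.map prod.snd ≫ Path.inv X) ≫ Path.src X := by
  rw [Category.assoc, Category.assoc, Path.inv_src, Path.map_tgt, ← Category.assoc, h,
    Category.assoc, pathProj_snd]

/-- Transport of an arrow along arrows between the endpoints. -/
noncomputable def pathTransp (w : T ⟶ Path (X ⨯ X)) (k : T ⟶ Path X)
    (h : w ≫ Path.tgt (X ⨯ X) = k ≫ pathProj X) : T ⟶ Path X :=
  Path.comp (Path.comp (w ≫ Path.map prod.fst) k (map_fst_tgt h))
    (w ≫ Path.map prod.snd ≫ Path.inv X) (by rw [Path.comp_tgt]; exact map_snd_tgt h)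

theorem pathTransp_proj (w : T ⟶ Path (X ⨯ X)) (k : T ⟶ Path X)
    (h : w ≫ Path.tgt (X ⨯ X) = k ≫ pathProj X) :
    pathTransp w k h ≫ pathProj X = w ≫ Path.src _ := by
  apply prod.hom_ext
  · rw [Category.assoc, pathProj_fst, pathTransp, Path.comp_src, Path.comp_src, Category.assoc,
      Path.map_src, Category.assoc]
  · rw [Category.assoc, pathProj_snd, pathTransp, Path.comp_tgt, Category.assoc, Category.assoc,
      Path.inv_tgt, Path.map_src, Category.assoc]

theorem pathTransp_refl (w : T ⟶ Path (X ⨯ X)) (k : T ⟶ Path X)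
    (h : w ≫ Path.tgt (X ⨯ X) = k ≫ pathProj X) (hw : w = k ≫ pathProj X ≫ Path.refl _) :
    pathTransp w k h = k := by
  rw [pathTransp, Path.comp_refl, Path.refl_comp]
  · rw [hw, Category.assoc, Category.assoc, Path.refl_map, ← Category.assoc (pathProj X),
      pathProj_fst]
  · have e : Path.comp (w ≫ Path.map prod.fst) k (map_fst_tgt h) ≫ Path.tgt X = k ≫ Path.tgt X :=
      Path.comp_tgt _ _ _
    rw [← Category.assoc (Path.comp _ _ _), e, hw, Category.assoc, Category.assoc,
      ← Category.assoc (Path.refl _), Path.refl_map, Category.assoc, Path.refl_inv,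
      ← Category.assoc (pathProj X), pathProj_snd, Category.assoc]

/-- In terms of components this is `u' (u k v⁻¹) v'⁻¹ = (u' u) k (v' v)⁻¹`, written in diagrammatic
order. -/
theorem pathTransp_pathTransp (w' w : T ⟶ Path (X ⨯ X)) (k : T ⟶ Path X)
    (h : w ≫ Path.tgt (X ⨯ X) = k ≫ pathProj X)
    (h' : w' ≫ Path.tgt (X ⨯ X) = pathTransp w k h ≫ pathProj X) :
    pathTransp w' (pathTransp w k h) h' =
      pathTransp (Path.comp w' w (h'.trans (pathTransp_proj w k h))) k (by
        rw [Path.comp_tgt, h]) := by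
  have e := Path.comp_map w' w (h'.trans (pathTransp_proj w k h)) (prod.fst : X ⨯ X ⟶ X)
  have e' : Path.comp w' w (h'.trans (pathTransp_proj w k h)) ≫ Path.map (prod.snd : X ⨯ X ⟶ X) ≫
      Path.inv X = Path.comp (w ≫ Path.map prod.snd ≫ Path.inv X)
        (w' ≫ Path.map prod.snd ≫ Path.inv X) (by
          have := h'.trans (pathTransp_proj w k h)
          simp only [Category.assoc, Path.inv_tgt, Path.inv_src, Path.map_tgt, Path.map_src]
          rw [← Category.assoc, ← Category.assoc, this]) := by
    rw [← Category.assoc, Path.comp_map, Path.comp_comp_inv]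
    rfl
  refine Eq.trans ?_ (Path.comp_congr (Path.comp_congr e rfl) e').symm
  exact comp_conj _ _ _ _ _ _ _ (map_snd_tgt h) _

theorem comp_pathTransp {T' : Grpd.{u, u}} (m : T' ⟶ T) (w : T ⟶ Path (X ⨯ X)) (k : T ⟶ Path X)
    (h : w ≫ Path.tgt (X ⨯ X) = k ≫ pathProj X) : m ≫ pathTransp w k h =
      pathTransp (m ≫ w) (m ≫ k) (by rw [Category.assoc, Category.assoc, h]) := rfl

theorem pathTransp_congr {w w' : T ⟶ Path (X ⨯ X)} {k k' : T ⟶ Path X}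
    {h : w ≫ Path.tgt (X ⨯ X) = k ≫ pathProj X} (e : w = w') (e' : k = k') :
    pathTransp w k h = pathTransp w' k' (by rw [← e, ← e', h]) := by
  subst e e'
  rfl

/-- The algebra structure on the endpoints of arrows. -/
noncomputable def pathAlg (X : Grpd.{u, u}) : AlgOn grpdAWFS (X ⨯ X) where
  tot := Path X
  proj := pathProj X
  str := pathTransp (isoPath (pathProj X)) (ptMap (pathProj X)) (isoPath_tgt _)
  str_proj := by rw [pathTransp_proj, isoPath_src]
  lam_str := pathTransp_refl (grpdAWFS.leftMap _ ≫ isoPath (pathProj X))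
    (grpdAWFS.leftMap _ ≫ ptMap (pathProj X)) (congrArg (grpdAWFS.leftMap _ ≫ ·) (isoPath_tgt _))
    rfl
  mul_str := by
    have h : isoPath (grpdAWFS.rightMap (pathProj X)) ≫ Path.tgt (X ⨯ X) =
        (ptMap (grpdAWFS.rightMap (pathProj X)) ≫ pathTransp (isoPath (pathProj X))
          (ptMap (pathProj X)) (isoPath_tgt _)) ≫ pathProj X := by
      rw [Category.assoc, pathTransp_proj, isoPath_tgt, isoPath_src]
    rw [comp_pathTransp, comp_pathTransp, pathTransp_congr (mulMap_isoPath _) (mulMap_ptMap _)]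
    refine (pathTransp_pathTransp (isoPath (grpdAWFS.rightMap (pathProj X)))
      (ptMap (grpdAWFS.rightMap (pathProj X)) ≫ isoPath (pathProj X))
      (ptMap (grpdAWFS.rightMap (pathProj X)) ≫ ptMap (pathProj X)) (by
        rw [Category.assoc, Category.assoc, isoPath_tgt]) h).symm.trans ?_
    refine (pathTransp_congr ?_ ?_).symm
    · rw [midMap_isoPath, Path.map_id, Category.comp_id]
    · rfl

theorem transp_pathAlg (w : T ⟶ Path (X ⨯ X)) (k : T ⟶ Path X)
    (h : w ≫ Path.tgt (X ⨯ X) = k ≫ pathProj X) :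
    transp (pathAlg X) w k h = pathTransp w k h := by
  exact (comp_pathTransp _ _ _ (isoPath_tgt _)).trans (pathTransp_congr (pairMid_isoPath _ _ _ _) rfl)

end PathAlgebra

/-! ### Contraction data over the parametrised diagonals -/

section Existence

variable {Y Z X : Grpd.{u, u}}

theorem paramDiag_fst (Y X : Grpd.{u, u}) : paramDiag Y X ≫ prod.fst = 𝟙 (Y ⨯ X) :=
  prod.lift_fst _ _

theorem paramDiag_snd (Y X : Grpd.{u, u}) : paramDiag Y X ≫ prod.snd = prod.snd :=
  prod.lift_snd _ _

/-- Contraction data over parametrised diagonals are stable under change of parameters. -/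
theorem DiagData.changeParam (f : Y ⟶ Z)
    {a : AlgOn grpdAWFS (Z ⨯ X)} {s : AlgOn grpdAWFS ((Z ⨯ X) ⨯ X)} {a' : AlgOn grpdAWFS (Y ⨯ X)}
    {s' : AlgOn grpdAWFS ((Y ⨯ X) ⨯ X)} {η : a.toFiber.1 ⟶ s.toFiber.1}
    (D : DiagData (paramDiag Z X) prod.fst a s η)
    {α : a'.toFiber.1 ⟶ a.toFiber.1}
    (hα : grpdAWFS.algFunctor.IsStronglyCartesian (prod.map f (𝟙 X)) α)
    {σ : s'.toFiber.1 ⟶ s.toFiber.1}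
    (hσ : grpdAWFS.algFunctor.IsStronglyCartesian (prod.map (prod.map f (𝟙 X)) (𝟙 X)) σ)
    {η' : a'.toFiber.1 ⟶ s'.toFiber.1}
    (hη' : grpdAWFS.algFunctor.IsHomLift (paramDiag Y X) η') (e : η' ≫ σ = α ≫ η) :
    Nonempty (DiagData (paramDiag Y X) prod.fst a' s' η') := by
  have wσ := (isHom_lft hσ.toIsHomLift).w
  have wα := (isHom_lft hα.toIsHomLift).w
  have wη' := (isHom_lft hη').w
  have e' : lft η' ≫ lft σ = lft α ≫ lft η := congrArg lft e
  have θ_tgt := D.θ_tgt.trans (isHom_lft (isHomLift_comp D.r_isHomLift D.isHomLift)).w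
  have hd := paramDiag_fst Y X
  have hd' := paramDiag_snd Y X
  have hdZ := paramDiag_snd Z X
  have hf : prod.map f (𝟙 X) ≫ prod.snd = prod.snd := by rw [prod.map_snd, Category.comp_id]
  have hg : prod.map (prod.map f (𝟙 X)) (𝟙 X) ≫ prod.snd = prod.snd := by
    rw [prod.map_snd, Category.comp_id]
  have hg' : prod.map (prod.map f (𝟙 X)) (𝟙 X) ≫ prod.fst = prod.fst ≫ prod.map f (𝟙 X) :=
    prod.map_fst _ _
  have θ_fst := Path.pair_fst (s'.proj ≫ prod.fst ≫ Path.refl _)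
    (lft σ ≫ D.θ ≫ Path.map (prod.snd : (Z ⨯ X) ⨯ X ⟶ X))
  have θ_snd := Path.pair_snd (s'.proj ≫ prod.fst ≫ Path.refl _)
    (lft σ ≫ D.θ ≫ Path.map (prod.snd : (Z ⨯ X) ⨯ X ⟶ X))
  -- Only the last coordinate of the contraction moves, and the change of parameters does not touch
  -- that coordinate. So the new contraction is constant on the first factor and keeps the last
  -- component of `D.θ`. For compatibility with `D.θ`, the first component of the latter must be
  -- constant too, which is `D.θ_map`.
  refine D.reindex hd hg'.symm hα hσ hη' e (Path.pair (s'.proj ≫ prod.fst ≫ Path.refl _)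
    (lft σ ≫ D.θ ≫ Path.map prod.snd)) ?_ ?_ θ_fst ?_ ?_
  · rw [Path.pair_src]
    apply prod.hom_ext
    · rw [prod.lift_fst, Category.assoc, Category.assoc, Path.refl_src, Category.comp_id]
    · rw [prod.lift_snd, Category.assoc, Category.assoc, Path.map_src, ← Category.assoc D.θ,
        D.θ_src, ← Category.assoc, wσ, Category.assoc, hg]
  · rw [Path.pair_tgt]
    apply prod.hom_ext
    · rw [prod.lift_fst, Category.assoc, Category.assoc, Path.refl_tgt, Category.comp_id,
        Category.assoc, Category.assoc, hd, Category.comp_id]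
    · rw [prod.lift_snd, Category.assoc, Category.assoc, Path.map_tgt, ← Category.assoc D.θ,
        θ_tgt, Category.assoc, ← Category.assoc, wσ, Category.assoc, Category.assoc, hdZ,
        ← Category.assoc _ prod.fst, hg', Category.assoc, hf, Category.assoc, Category.assoc, hd']
  · apply Path.prod_ext
    · rw [Category.assoc, θ_fst, ← Category.assoc, wη', Category.assoc, Category.assoc,
        Category.assoc, Path.refl_map]
    · rw [Category.assoc, θ_snd, ← Category.assoc, e', Category.assoc, ← Category.assoc (lft η),
        D.η_θ, Category.assoc, Category.assoc, Category.assoc, Category.assoc, Path.refl_map,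
        Path.refl_map, ← Category.assoc _ prod.snd, ← Category.assoc _ prod.snd, hdZ, hd',
        ← Category.assoc, wα, Category.assoc, ← Category.assoc _ prod.snd, hf]
  · apply Path.prod_ext
    · rw [Category.assoc, ← Path.map_comp, hg', Path.map_comp, ← Category.assoc, θ_fst,
        Category.assoc, Category.assoc, Path.refl_map, Category.assoc, D.θ_map, ← Category.assoc,
        ← Category.assoc, ← Category.assoc, ← Category.assoc, wσ, Category.assoc s'.proj (prod.map _ _),
        hg', Category.assoc s'.proj]
    · rw [Category.assoc, ← Path.map_comp, hg, θ_snd, Category.assoc]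

/-- The reflexivity arrows form an algebra map over the diagonal. -/
theorem isHom_refl {I : Grpd.{u, u}} (a : AlgOn grpdAWFS I) (q : I ⟶ X) (m : I ⟶ X ⨯ X)
    (h : m ≫ prod.fst = q) (h' : m ≫ prod.snd = q) :
    IsHom a (pathAlg X) m (a.proj ≫ q ≫ Path.refl X) := by
  have w : (a.proj ≫ q ≫ Path.refl X) ≫ pathProj X = a.proj ≫ m := by
    apply prod.hom_ext
    · rw [Category.assoc, Category.assoc, Category.assoc, Category.assoc, h, pathProj_fst,
        Path.refl_src, Category.comp_id]
    · rw [Category.assoc, Category.assoc, Category.assoc, Category.assoc, h', pathProj_snd,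
        Path.refl_tgt, Category.comp_id]
  refine isHom_of_transp w ?_
  refine Eq.trans ?_ (transp_pathAlg _ _ (isoPath_map_tgt w)).symm
  have e₁ : (isoPath a.proj ≫ Path.map m) ≫ Path.map prod.fst = isoPath a.proj ≫ Path.map q := by
    rw [Category.assoc, ← Path.map_comp, h]
  have e₂ : (isoPath a.proj ≫ Path.map m) ≫ Path.map prod.snd ≫ Path.inv X =
      (isoPath a.proj ≫ Path.map q) ≫ Path.inv X := by
    rw [Category.assoc, ← Category.assoc (Path.map m), ← Path.map_comp, h', Category.assoc]
  have e₃ : Path.comp ((isoPath a.proj ≫ Path.map m) ≫ Path.map prod.fst)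
      (ptMap a.proj ≫ a.proj ≫ q ≫ Path.refl X) (map_fst_tgt (isoPath_map_tgt w)) =
      isoPath a.proj ≫ Path.map q := by
    refine (Path.comp_congr e₁ rfl).trans (Path.comp_refl _ _ _ ?_)
    rw [Category.assoc, ← Category.assoc (Path.map q), Path.map_tgt, Category.assoc,
      ← Category.assoc (isoPath a.proj), isoPath_tgt, Category.assoc]
  -- Conjugating an identity by `u` on both sides gives `u u⁻¹`, again an identity.
  refine Eq.symm ((Path.comp_congr e₃ e₂).trans ((Path.comp_inv _).trans ?_))
  rw [Category.assoc, ← Category.assoc (Path.map q), Path.map_src, Category.assoc,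
    ← Category.assoc, isoPath_src, ← a.str_proj, Category.assoc]
  rfl

theorem hasPullbacks_grpd : HasPullbacks Grpd.{u, u} := by
  have : HasLimits Grpd.{u, u} := hasLimits_of_reflective Grpd.forgetToCat
  infer_instance

theorem exists_isStronglyCartesian_toFiber {I J : Grpd.{u, u}} (f : I ⟶ J)
    (c : AlgOn grpdAWFS J) : ∃ (a : AlgOn grpdAWFS I) (γ : a.toFiber.1 ⟶ c.toFiber.1),
      grpdAWFS.algFunctor.IsStronglyCartesian f γ := by
  have := hasPullbacks_grpd.{u}
  obtain ⟨A, γ, hγ⟩ := grpdAWFS.exists_isStronglyCartesian f c.toFiber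
  obtain ⟨a, ha⟩ := exists_eq_toFiber
    (⟨A, IsHomLift.domain_eq _ f γ⟩ : grpdAWFS.algFunctor.Fiber I)
  obtain rfl : A = a.toFiber.1 := congrArg Subtype.val ha
  exact ⟨a, γ, hγ⟩

/-- The left adjoint takes `a` to the product of its pullback along the first projection with the
pullback of the arrow algebra along the last two coordinates. The map `η` inserts identity arrows,
`r` forgets the arrow, and the arrow itself is the contraction. -/
theorem exists_diagData (a : AlgOn grpdAWFS (Y ⨯ X)) :
    ∃ (s : AlgOn grpdAWFS ((Y ⨯ X) ⨯ X)) (η : a.toFiber.1 ⟶ s.toFiber.1),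
      Nonempty (DiagData (paramDiag Y X) prod.fst a s η) := by
  have := hasPullbacks_grpd.{u}
  -- The last coordinate comes first, so that the arrow runs from the last coordinate to the middle
  -- one and `θ` ends on the diagonal.
  let m : (Y ⨯ X) ⨯ X ⟶ X ⨯ X := prod.lift prod.snd (prod.fst ≫ prod.snd)
  have hm : m ≫ prod.fst = prod.snd := prod.lift_fst _ _
  have hm' : m ≫ prod.snd = prod.fst ≫ prod.snd := prod.lift_snd _ _
  have hd := paramDiag_fst Y X
  have hd' := paramDiag_snd Y X
  have hdm : (paramDiag Y X ≫ m) ≫ prod.fst = prod.snd := by rw [Category.assoc, hm, hd']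
  have hdm' : (paramDiag Y X ≫ m) ≫ prod.snd = prod.snd := by
    rw [Category.assoc, hm', ← Category.assoc, hd, Category.id_comp]
  obtain ⟨a₁, τ, hτ⟩ := exists_isStronglyCartesian_toFiber (prod.fst : (Y ⨯ X) ⨯ X ⟶ _) a
  obtain ⟨b₁, μ, hμ⟩ := exists_isStronglyCartesian_toFiber m (pathAlg X)
  obtain ⟨S, π, π', hS⟩ := grpdAWFS.exists_isStrongProduct _ a₁.toFiber b₁.toFiber
  obtain ⟨s, rfl⟩ := exists_eq_toFiber S
  have hν := isHom_refl a prod.snd (paramDiag Y X ≫ m) hdm hdm'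
  obtain ⟨η₁, hη₁, e₁⟩ := exists_factor (z := a) hτ (paramDiag Y X) hd.symm (IsHomLift.id rfl)
  obtain ⟨η₂, hη₂, e₂⟩ := exists_factor (z := a) hμ (paramDiag Y X) rfl hν.isHomLift
  obtain ⟨η, hη, e₃, e₄⟩ := hS.exists_lift (paramDiag Y X) η₁ η₂ hη₁ hη₂
  let r : s.toFiber.1 ⟶ a.toFiber.1 := π.1 ≫ τ
  let ρ : s.toFiber.1 ⟶ (pathAlg X).toFiber.1 := π'.1 ≫ μ
  have hr : grpdAWFS.algFunctor.IsHomLift prod.fst r := isHomLift_vert_comp π hτ.toIsHomLift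
  have hρ : grpdAWFS.algFunctor.IsHomLift m ρ := isHomLift_vert_comp π' hμ.toIsHomLift
  have ηr : η ≫ r = 𝟙 _ := by
    rw [← e₁, ← e₃, Category.assoc]
  let l : s.tot ⟶ Path X := lft ρ
  have ηρ : lft η ≫ l = a.proj ≫ prod.snd ≫ Path.refl X := by
    have : η ≫ ρ = hν.toHom := by rw [← e₂, ← e₄, Category.assoc]
    exact congrArg lft this
  have wr := (isHom_lft hr).w
  have wη := (isHom_lft hη).w
  have wρ : l ≫ pathProj X = s.proj ≫ m := (isHom_lft hρ).w
  have wrη := (isHom_lft (isHomLift_comp hr hη)).w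
  have ρ_src : l ≫ Path.src X = s.proj ≫ prod.snd := by
    rw [← pathProj_fst, ← Category.assoc, wρ, Category.assoc, hm]
  have ρ_tgt : l ≫ Path.tgt X = s.proj ≫ prod.fst ≫ prod.snd := by
    rw [← pathProj_snd, ← Category.assoc, wρ, Category.assoc, hm']
  let θ : s.tot ⟶ Path ((Y ⨯ X) ⨯ X) := Path.pair (s.proj ≫ prod.fst ≫ Path.refl _) (l)
  have θ_fst : θ ≫ Path.map prod.fst = s.proj ≫ prod.fst ≫ Path.refl _ := Path.pair_fst _ _
  have θ_snd : θ ≫ Path.map prod.snd = l := Path.pair_snd _ _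
  have θ_src : θ ≫ Path.src _ = s.proj := by
    refine (Path.pair_src _ _).trans (prod.hom_ext ?_ ?_)
    · rw [prod.lift_fst, Category.assoc, Category.assoc, Path.refl_src, Category.comp_id]
    · rw [prod.lift_snd, ρ_src]
  have θ_tgt : θ ≫ Path.tgt _ = lft (r ≫ η) ≫ s.proj := by
    rw [wrη]
    refine (Path.pair_tgt _ _).trans (prod.hom_ext ?_ ?_)
    · rw [prod.lift_fst, Category.assoc, Category.assoc, Path.refl_tgt, Category.comp_id,
        Category.assoc, Category.assoc, hd, Category.comp_id]
    · rw [prod.lift_snd, ρ_tgt, Category.assoc, Category.assoc, hd']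
  have hE : IsHom s s (𝟙 _) (transp s θ (lft (r ≫ η)) θ_tgt) :=
    isHom_transp (isHom_lft (isHomLift_comp hr hη)) θ _ (by rw [θ_src, Category.comp_id])
  refine ⟨s, η, ⟨⟨hη, r, hr, ηr, θ, θ_src, θ_tgt, θ_fst, ?_, ?_⟩⟩⟩
  · apply Path.prod_ext
    · rw [Category.assoc, θ_fst, ← Category.assoc, wη, Category.assoc, Category.assoc,
        Category.assoc, Path.refl_map]
    · rw [Category.assoc, θ_snd, ηρ, Category.assoc, Category.assoc, Path.refl_map,
        ← Category.assoc (paramDiag Y X), hd']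
  -- Both components of the transport of `(a, id)` along the arrow `k` are computed: over the first
  -- projection the contraction is constant, so `a` is unchanged, and the arrow component becomes `k
  -- · id · id⁻¹ = k`.
  · have E₁ : hE.toHom ≫ r = r := by
      refine eq_of_lft (f := prod.fst) (isHomLift_congr (isHomLift_comp hE.isHomLift hr)
        (Category.id_comp _)) hr ?_
      rw [lft_comp, lft_toHom, transp_comp_of_isHom (isHom_lft hr)]
      have e : lft (r ≫ η) ≫ lft r = lft r := by
        rw [← lft_comp, Category.assoc, ηr, Category.comp_id]
      rw [transp_congr θ_fst e]
      refine transp_refl _ _ _ ?_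
      rw [← Category.assoc, ← Category.assoc (lft r), wr]
    have E₂ : hE.toHom ≫ ρ = ρ := by
      refine eq_of_lft (f := m) (isHomLift_congr (isHomLift_comp hE.isHomLift hρ)
        (Category.id_comp _)) hρ ?_
      have e : lft (r ≫ η) ≫ l = s.proj ≫ prod.fst ≫ prod.snd ≫ Path.refl X := by
        rw [lft_comp, Category.assoc, ηρ, ← Category.assoc, wr, Category.assoc]
      have h₀ : (θ ≫ Path.map m) ≫ Path.tgt (X ⨯ X) =
          (s.proj ≫ prod.fst ≫ prod.snd ≫ Path.refl X) ≫ pathProj X := by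
        rw [Category.assoc, Path.map_tgt, ← Category.assoc, θ_tgt, ← e,
          Category.assoc _ l, wρ, Category.assoc]
      rw [lft_comp, lft_toHom, transp_comp_of_isHom (isHom_lft hρ)]
      refine (transp_congr rfl e).trans ((transp_pathAlg _ _ h₀).trans ?_)
      have e₅ : (θ ≫ Path.map m) ≫ Path.map prod.fst = l := by
        rw [Category.assoc, ← Path.map_comp, hm, θ_snd]
      have e₆ : (θ ≫ Path.map m) ≫ Path.map prod.snd ≫ Path.inv X =
          s.proj ≫ prod.fst ≫ prod.snd ≫ Path.refl X := by
        rw [Category.assoc, ← Category.assoc (Path.map m), ← Path.map_comp, hm', Path.map_comp,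
          ← Category.assoc, ← Category.assoc, θ_fst, Category.assoc, Category.assoc, Category.assoc,
          ← Category.assoc (Path.refl _), Path.refl_map, Category.assoc, Path.refl_inv]
      have e₇ : Path.comp ((θ ≫ Path.map m) ≫ Path.map prod.fst)
          (s.proj ≫ prod.fst ≫ prod.snd ≫ Path.refl X) (map_fst_tgt h₀) = l := by
        refine (Path.comp_congr e₅ rfl).trans (Path.comp_refl _ _ _ ?_)
        rw [← Category.assoc l, ρ_tgt, Category.assoc, Category.assoc]
      refine (Path.comp_congr e₇ e₆).trans (Path.comp_refl _ _ _ ?_)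
      rw [← Category.assoc l, ρ_tgt, Category.assoc, Category.assoc]
    suffices hE.toHom = 𝟙 _ from congrArg lft this
    refine hS.ext (𝟙 _) _ _ hE.isHomLift (IsHomLift.id rfl) ?_ ?_
    · rw [Category.id_comp]
      refine factor_ext hτ (𝟙 _) (isHomLift_comp_vert hE.isHomLift π) π.2 ?_
      rw [Category.assoc]
      exact E₁
    · rw [Category.id_comp]
      refine factor_ext hμ (𝟙 _) (isHomLift_comp_vert hE.isHomLift π') π'.2 ?_
      rw [Category.assoc]
      exact E₂

end Existence

/-! ### The fibration of algebras is elementary -/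

section Elementary

/-- Arrows over parametrised diagonals that admit contraction data. -/
inductive IsDiag {Y X : Grpd.{u, u}} : ∀ {A : grpdAWFS.algFunctor.Fiber (Y ⨯ X)}
    {S : grpdAWFS.algFunctor.Fiber ((Y ⨯ X) ⨯ X)}, (A.1 ⟶ S.1) → Prop
  | mk {a : AlgOn grpdAWFS (Y ⨯ X)} {s : AlgOn grpdAWFS ((Y ⨯ X) ⨯ X)}
    {η : a.toFiber.1 ⟶ s.toFiber.1} (D : DiagData (paramDiag Y X) prod.fst a s η) :
    IsDiag (A := a.toFiber) (S := s.toFiber) η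

/-- Algebras over groupoids form an elementary fibration. -/
theorem isElementary_algFunctor : IsElementary grpdAWFS.{u}.algFunctor := by
  have := hasPullbacks_grpd.{u}
  have := grpdAWFS.{u}.isFibered_algFunctor
  refine isElementary_of_cocartesian (isFibrationWithProducts_of_strong _
    grpdAWFS.exists_isStrongTerminal grpdAWFS.exists_isStrongProduct)
    grpdAWFS.exists_isStrongProduct IsDiag ?_ ?_ ?_ ?_
  · intro Y X A S η h
    cases h with
    | mk D => exact D.isCocartesian
  · intro Y X A
    obtain ⟨a, rfl⟩ := exists_eq_toFiber A
    obtain ⟨s, η, ⟨D⟩⟩ := exists_diagData a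
    exact ⟨s.toFiber, η, .mk D⟩
  · intro Y X A C' P S C Q η h γ hγ π π' hP ρ ρ' hQ κ hκ e₁ e₂
    cases h with
    | mk D =>
      obtain ⟨c', rfl⟩ := exists_eq_toFiber C'
      obtain ⟨c, rfl⟩ := exists_eq_toFiber C
      obtain ⟨p, rfl⟩ := exists_eq_toFiber P
      obtain ⟨q, rfl⟩ := exists_eq_toFiber Q
      obtain ⟨D'⟩ := D.prod (paramDiag_fst Y X) hγ hP hQ hκ e₁ e₂
      exact .mk D'
  · intro Y Z f X A S A' S' η h α hα σ hσ η' hη' e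
    cases h with
    | mk D =>
      obtain ⟨a', rfl⟩ := exists_eq_toFiber A'
      obtain ⟨s', rfl⟩ := exists_eq_toFiber S'
      obtain ⟨D'⟩ := D.changeParam f hα hσ hη' e
      exact .mk D'

end Elementary

/-! ### Actions of the middle groupoid and split cleavages -/

section Cleavages

variable {A B A' B' : Type u} [Groupoid.{u} A] [Groupoid.{u} B] [Groupoid.{u} A'] [Groupoid.{u} B']
  {F : A ⥤ B} {F' : A' ⥤ B'}

namespace PathObj

/-- The canonical arrow `(a, x) ⟶ (a, 𝟙)`. -/
def toLam (P : PathObj F) : P ⟶ (lam F).obj P.pt :=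
  ⟨P.iso, 𝟙 P.pt, congrArg (fun t => P.iso ≫ t) (F.map_id P.pt).symm⟩

theorem toLam_pt (P : PathObj F) : (toLam P).pt = 𝟙 P.pt := rfl

theorem toLam_naturality {P Q : PathObj F} (f : P ⟶ Q) :
    f ≫ toLam Q = toLam P ≫ (lam F).map f.pt :=
  hom_ext f.w ((Category.comp_id f.pt).trans (Category.id_comp f.pt).symm)

theorem map_obj_lam {H : A ⥤ A'} {K : B ⥤ B'} (h : H ⋙ F' = F ⋙ K) (a : A) :
    (PathObj.map h).obj ((lam F).obj a) = (lam F').obj (H.obj a) :=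
  (Functor.congr_obj (lam_nat h) a).symm

theorem map_toLam {H : A ⥤ A'} {K : B ⥤ B'} (h : H ⋙ F' = F ⋙ K) (P : PathObj F) :
    (PathObj.map h).map (toLam P) ≫ eqToHom (map_obj_lam h P.pt) =
      toLam ((PathObj.map h).obj P) := by
  apply hom_ext
  · rw [comp_base, eqToHom_base]
    rfl
  · rw [comp_pt, eqToHom_pt]
    exact (Category.comp_id _).trans (H.map_id _)

theorem map_congr {H : A ⥤ A'} {K K' : B ⥤ B'} (e : K = K') (h : H ⋙ F' = F ⋙ K) :
    PathObj.map h = PathObj.map (h.trans (congrArg (F ⋙ ·) e)) := by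
  subst e
  rfl

end PathObj

open PathObj

section LiftHom

variable {s : PathObj F ⥤ A} {s' : PathObj F' ⥤ A'}

/-- The arrow `s (a, x) ⟶ a` of a unital action `s`. -/
def liftHom (hl : lam F ⋙ s = 𝟭 A) (P : PathObj F) : s.obj P ⟶ P.pt :=
  s.map (toLam P) ≫ eqToHom (Functor.congr_obj hl P.pt)

theorem liftHom_lam (hl : lam F ⋙ s = 𝟭 A) (a : A) :
    liftHom hl ((lam F).obj a) = eqToHom (Functor.congr_obj hl a) := by
  have : s.map (toLam ((lam F).obj a)) = 𝟙 _ := s.map_id _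
  exact (congrArg (· ≫ eqToHom _) this).trans (Category.id_comp _)

/-- Obtained by applying `s` to the naturality of `toLam`. As `liftHom` is invertible, this
determines `s` on arrows from its values on objects and the lifts. -/
theorem liftHom_naturality (hl : lam F ⋙ s = 𝟭 A) {P Q : PathObj F} (f : P ⟶ Q) :
    s.map f ≫ liftHom hl Q = liftHom hl P ≫ f.pt := by
  have e := Functor.congr_hom hl f.pt
  rw [Functor.comp_map] at e
  rw [liftHom, liftHom, ← Category.assoc, ← s.map_comp, toLam_naturality, s.map_comp, e]
  simp

theorem map_liftHom (hl : lam F ⋙ s = 𝟭 A) (hp : s ⋙ F = baseFunctor F) (P : PathObj F) :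
    F.map (liftHom hl P) = eqToHom (Functor.congr_obj hp P) ≫ P.iso := by
  have e := Functor.congr_hom hp (toLam P)
  rw [Functor.comp_map] at e
  rw [liftHom, F.map_comp, e, eqToHom_map, Category.assoc, Category.assoc, eqToHom_trans]
  exact congrArg (eqToHom _ ≫ ·) (Category.comp_id _)

/-- Lifts are images of the canonical arrows `toLam`, which `PathObj.map` preserves. The lemma
serves twice: for algebra maps, and for the action `s` itself, seen as a map from the free algebra
by associativity. -/
theorem map_liftHom_of_square (hl : lam F ⋙ s = 𝟭 A) (hl' : lam F' ⋙ s' = 𝟭 A') {H : A ⥤ A'}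
    {K : B ⥤ B'} (h : H ⋙ F' = F ⋙ K) (e : PathObj.map h ⋙ s' = s ⋙ H) (P : PathObj F) :
    H.map (liftHom hl P) =
      eqToHom (Functor.congr_obj e P).symm ≫ liftHom hl' ((PathObj.map h).obj P) := by
  have e' := Functor.congr_hom e.symm (toLam P)
  rw [Functor.comp_map, Functor.comp_map] at e'
  have e'' := congrArg s'.map (map_toLam h P)
  rw [s'.map_comp, eqToHom_map] at e''
  have e₃ : liftHom hl' ((PathObj.map h).obj P) = _ :=
    congrArg (· ≫ eqToHom (Functor.congr_obj hl' (H.obj P.pt))) e''.symm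
  rw [e₃, liftHom, H.map_comp, e', eqToHom_map]
  simp only [Category.assoc, eqToHom_trans]
  rfl

/-- Converse of the preceding lemma: agreement on objects and on lifts gives agreement on arrows, by
naturality and cancellation of the invertible lifts. -/
theorem square_of_natural {ℓ : ∀ P, s.obj P ⟶ P.pt} {ℓ' : ∀ P, s'.obj P ⟶ P.pt}
    (hℓ : ∀ {P Q : PathObj F} (f : P ⟶ Q), s.map f ≫ ℓ Q = ℓ P ≫ f.pt)
    (hℓ' : ∀ {P Q : PathObj F'} (f : P ⟶ Q), s'.map f ≫ ℓ' Q = ℓ' P ≫ f.pt) {H : A ⥤ A'}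
    {K : B ⥤ B'} (h : H ⋙ F' = F ⋙ K)
    (e₀ : ∀ P, H.obj (s.obj P) = s'.obj ((PathObj.map h).obj P))
    (e : ∀ P, H.map (ℓ P) = eqToHom (e₀ P) ≫ ℓ' ((PathObj.map h).obj P)) :
    PathObj.map h ⋙ s' = s ⋙ H := by
  refine CategoryTheory.Functor.ext (fun P => (e₀ P).symm) fun P Q f => ?_
  have e₁ := congrArg H.map (hℓ f)
  rw [H.map_comp, H.map_comp, e, e] at e₁
  have e₂ : s'.map ((PathObj.map h).map f) ≫ ℓ' ((PathObj.map h).obj Q) =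
    ℓ' ((PathObj.map h).obj P) ≫ H.map f.pt := hℓ' ((PathObj.map h).map f)
  have e₃ : H.map (s.map f) ≫ eqToHom (e₀ Q) =
      eqToHom (e₀ P) ≫ s'.map ((PathObj.map h).map f) := by
    rw [← cancel_mono (ℓ' ((PathObj.map h).obj Q)), Category.assoc, Category.assoc]
    exact e₁.trans ((Category.assoc _ _ _).trans (congrArg (eqToHom (e₀ P) ≫ ·) e₂.symm))
  change s'.map ((PathObj.map h).map f) = eqToHom _ ≫ H.map (s.map f) ≫ eqToHom _
  rw [e₃]
  simp

theorem liftHom_mul_pt (Q : PathObj (baseFunctor F)) :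
    (liftHom (lam_mul' (F := F)) Q).pt = 𝟙 Q.pt.pt := by
  rw [liftHom, comp_pt, eqToHom_pt]
  exact Category.comp_id _

theorem eq_conj_eqToHom {C : Type*} [Category C] {a b a' b' : C} (p : a = a') (q : b = b')
    {g : a ⟶ b} {f : a' ⟶ b'} (e : g ≫ eqToHom q = eqToHom p ≫ f) :
    g = eqToHom p ≫ f ≫ eqToHom q.symm := by
  subst p q
  simpa using e

theorem over_mk_congr {C : Type*} [Category C] {a b b' : C} (e : b = b') {f : b ⟶ a} {f' : b' ⟶ a}
    (h : f = eqToHom e ≫ f') : Over.mk f = Over.mk f' := by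
  subst e
  rw [h, eqToHom_refl, Category.id_comp]

theorem over_hom_eq {C : Type*} [Category C] {a : C} {x y : Over a} (e : x = y) :
    x.hom = eqToHom (congrArg (fun z : Over a => z.left) e) ≫ y.hom := by
  subst e
  exact (Category.id_comp _).symm

/-- The split cleavage of an algebra. -/
def SplitCleavage.ofAlg (s : PathObj F ⥤ A) (hp : s ⋙ F = baseFunctor F) (hl : lam F ⋙ s = 𝟭 A)
    (hm : mul F ⋙ s = PathObj.map (H := s) (K := 𝟭 B) hp ⋙ s) : SplitCleavage F where
  lift a _ x := Over.mk (liftHom hl ⟨_, a, x⟩)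
  obj_lift a _ x := Functor.congr_obj hp ⟨_, a, x⟩
  map_lift a _ x := map_liftHom hl hp ⟨_, a, x⟩
  lift_id a := over_mk_congr (Functor.congr_obj hl a)
    ((liftHom_lam hl a).trans (Category.comp_id _).symm)
  lift_comp a b c y x := by
    -- In the free algebra, the lift of `y` at `(a, x)` is an arrow `(a, y ≫ x) ⟶ (a, x)` with
    -- identity component at `a`. Its image under `s` is the chosen lift of `y`, by `e₁`. Naturality
    -- of the lifts along it, `e₂`, then factors the lift of `y ≫ x` through that of `x`.
    let Q : PathObj (baseFunctor F) := ⟨c, ⟨b, a, x⟩, y⟩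
    have e₁ := map_liftHom_of_square lam_mul' hl (H := s) (K := 𝟭 B) hp hm.symm Q
    have e₂ := liftHom_naturality hl (liftHom (lam_mul' (F := F)) Q)
    rw [liftHom_mul_pt] at e₂
    refine over_mk_congr (Functor.congr_obj hm Q) ?_
    refine ((Category.comp_id _).symm.trans e₂.symm).trans ?_
    exact (congrArg (· ≫ liftHom hl Q.pt) e₁).trans (Category.assoc _ _ _)

theorem SplitCleavage.ext_lift {c c' : SplitCleavage F}
    (h : ∀ (a : A) (b : B) (x : b ⟶ F.obj a), c.lift a x = c'.lift a x) : c = c' := by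
  obtain ⟨l, _, _, _, _⟩ := c
  obtain ⟨l', _, _, _, _⟩ := c'
  have : @l = @l' := by
    funext a b x
    exact h a b x
  subst this
  rfl

end LiftHom

section OfCleavage

variable (c : SplitCleavage F)

/-- The action attached to a split cleavage. -/
def SplitCleavage.act : PathObj F ⥤ A where
  obj P := (c.lift P.pt P.iso).left
  -- The only value for which the chosen lifts are natural.
  map {P Q} f := (c.lift P.pt P.iso).hom ≫ f.pt ≫ Groupoid.inv (c.lift Q.pt Q.iso).hom
  map_id P := by
    rw [id_pt, Category.id_comp, Groupoid.comp_inv]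
  map_comp f g := by
    rw [comp_pt]
    simp

/-- The arrow from the action to the object acted upon. -/
def SplitCleavage.actHom (P : PathObj F) : c.act.obj P ⟶ P.pt := (c.lift P.pt P.iso).hom

theorem SplitCleavage.act_map {P Q : PathObj F} (f : P ⟶ Q) : c.act.map f =
    c.actHom P ≫ f.pt ≫ Groupoid.inv (c.actHom Q) := rfl

theorem SplitCleavage.act_naturality {P Q : PathObj F} (f : P ⟶ Q) :
    c.act.map f ≫ c.actHom Q = c.actHom P ≫ f.pt := by
  rw [act_map, Category.assoc, Category.assoc, Groupoid.inv_comp, Category.comp_id]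

theorem SplitCleavage.act_obj_proj (P : PathObj F) : F.obj (c.act.obj P) = P.base :=
  c.obj_lift P.pt P.iso

theorem SplitCleavage.act_obj_lam (a : A) : c.act.obj ((lam F).obj a) = a :=
  congrArg (fun z : Over a => z.left) (c.lift_id a)

theorem SplitCleavage.act_obj_mul (Q : PathObj (baseFunctor F)) : c.act.obj ((mul F).obj Q) =
    c.act.obj ⟨Q.base, c.act.obj Q.pt, Q.iso ≫ eqToHom (c.act_obj_proj Q.pt).symm⟩ :=
  congrArg (fun z : Over Q.pt.pt => z.left) (c.lift_comp Q.pt.pt Q.iso Q.pt.iso)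

theorem SplitCleavage.map_actHom (P : PathObj F) :
    F.map (c.actHom P) = eqToHom (c.act_obj_proj P) ≫ P.iso := c.map_lift P.pt P.iso

theorem SplitCleavage.act_proj : c.act ⋙ F = baseFunctor F := by
  refine CategoryTheory.Functor.ext c.act_obj_proj fun P Q f => ?_
  have e := congrArg F.map (c.act_naturality f)
  rw [F.map_comp, F.map_comp, map_actHom, map_actHom, Category.assoc, ← f.w, ← Category.assoc,
    ← Category.assoc, cancel_mono] at e
  change F.map (c.act.map f) = eqToHom _ ≫ f.base ≫ eqToHom _
  rw [← Category.assoc, ← e]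
  simp

theorem SplitCleavage.actHom_lam (a : A) :
    c.actHom ((lam F).obj a) = eqToHom (c.act_obj_lam a) :=
  (over_hom_eq (c.lift_id a)).trans (Category.comp_id _)

theorem SplitCleavage.lam_act : lam F ⋙ c.act = 𝟭 A := by
  refine CategoryTheory.Functor.ext c.act_obj_lam fun a b f => ?_
  have e : c.act.map ((lam F).map f) ≫ c.actHom ((lam F).obj b) =
    c.actHom ((lam F).obj a) ≫ f := c.act_naturality ((lam F).map f)
  rw [actHom_lam, actHom_lam] at e
  exact eq_conj_eqToHom _ _ e

/-- Associativity says that the action is a map from the free algebra, so it is enough that it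
preserves lifts; this is the law for lifts of composites. -/
theorem SplitCleavage.mul_act :
    mul F ⋙ c.act = PathObj.map (H := c.act) (K := 𝟭 B) c.act_proj ⋙ c.act := by
  refine (square_of_natural (s := mul F) (s' := c.act) (liftHom_naturality lam_mul')
    c.act_naturality (H := c.act) (K := 𝟭 B) c.act_proj c.act_obj_mul fun Q => ?_).symm
  have e₁ := c.act_naturality (liftHom (lam_mul' (F := F)) Q)
  rw [liftHom_mul_pt] at e₁
  have e₂ := e₁.trans (Category.comp_id _)
  refine (cancel_mono (c.actHom Q.pt)).1 ?_
  exact e₂.trans ((over_hom_eq (c.lift_comp Q.pt.pt Q.iso Q.pt.iso)).trans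
    (Category.assoc _ _ _).symm)

/-- The recovered lift is the value of the action on `toLam`, that is, the chosen lift followed by
the inverse of the chosen lift of an identity, which is trivial. -/
theorem SplitCleavage.ofAlg_act : SplitCleavage.ofAlg c.act c.act_proj c.lam_act c.mul_act = c := by
  refine SplitCleavage.ext_lift fun a b x => ?_
  have e := c.act_naturality (toLam (⟨b, a, x⟩ : PathObj F))
  rw [toLam_pt, actHom_lam] at e
  exact congrArg Over.mk (e.trans (Category.comp_id _))

end OfCleavage

end Cleavages

/-! ### Equivalence of algebras with split cloven isofibrations -/

section Comparison

variable (X : grpdAWFS.{u}.RAlg)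

/-- The action of an algebra. -/
def algAct : PathObj (A := X.A.left) (B := X.A.right) X.A.hom ⥤ X.A.left := X.a.left

theorem algebra_right_eq_id : X.a.right = 𝟙 X.A.right :=
  (Category.id_comp _).symm.trans (congrArg CommaMorphism.right X.unit)

theorem algAct_proj : algAct X ⋙ X.A.hom =
    PathObj.baseFunctor (A := X.A.left) (B := X.A.right) X.A.hom := by
  have e : X.a.left ≫ X.A.hom = grpdAWFS.rho.app X.A ≫ X.a.right := X.a.w
  exact e.trans ((congrArg (grpdAWFS.rho.app X.A ≫ ·) (algebra_right_eq_id X)).trans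
    (Category.comp_id (grpdAWFS.rho.app X.A)))

theorem lam_algAct : PathObj.lam (A := X.A.left) (B := X.A.right) X.A.hom ⋙ algAct X =
    𝟭 X.A.left := congrArg CommaMorphism.left X.unit

/-- The associativity law mentions the codomain component of the structure map, which is equal to
the identity only by the unit law and has to be replaced by it. -/
theorem mul_algAct : PathObj.mul (A := X.A.left) (B := X.A.right) X.A.hom ⋙ algAct X =
    PathObj.map (H := algAct X) (K := 𝟭 X.A.right) (algAct_proj X) ⋙ algAct X :=
  (congrArg CommaMorphism.left X.assoc).trans
    (congrArg (· ⋙ algAct X) (PathObj.map_congr (A := grpdAWFS.M.obj X.A) (B := X.A.right)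
      (A' := X.A.left) (B' := X.A.right) (algebra_right_eq_id X) X.a.w))

/-- The split cloven isofibration of an algebra. -/
def toSplitIsofibObj : SplitIsofib.{u} where
  arrow := X.A
  cleavage := SplitCleavage.ofAlg (A := X.A.left) (B := X.A.right) (algAct X) (algAct_proj X)
    (lam_algAct X) (mul_algAct X)

theorem preserves_of_hom {X X' : grpdAWFS.{u}.RAlg} (φ : X ⟶ X') :
    SplitIsofib.Preserves (toSplitIsofibObj X) (toSplitIsofibObj X') φ.f := by
  intro a b x
  have e := map_liftHom_of_square (lam_algAct X) (lam_algAct X') (H := φ.f.left)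
    (K := φ.f.right) φ.f.w (congrArg Arrow.Hom.left φ.h) ⟨b, a, x⟩
  exact over_mk_congr _ e

/-- Preservation of the chosen lifts, as objects of slices, contains exactly the two inputs of
`square_of_natural`: agreement on domains and on lifts. -/
theorem hom_of_preserves {X X' : grpdAWFS.{u}.RAlg} (s : X.A ⟶ X'.A)
    (h : SplitIsofib.Preserves (toSplitIsofibObj X) (toSplitIsofibObj X') s) :
    grpdAWFS.monadR.map s ≫ X'.a = X.a ≫ s := by
  ext
  · exact square_of_natural (liftHom_naturality (lam_algAct X)) (liftHom_naturality (lam_algAct X'))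
      (H := s.left) (K := s.right) s.w
      (fun P => congrArg (fun z : Over _ => z.left) (h P.pt P.iso))
      fun P => over_hom_eq (h P.pt P.iso)
  · exact (congrArg (s.right ≫ ·) (algebra_right_eq_id X')).trans
      ((Category.comp_id s.right).trans ((Category.id_comp s.right).symm.trans
        (congrArg (· ≫ s.right) (algebra_right_eq_id X)).symm))

/-- The comparison from algebras to split cloven isofibrations. -/
def toSplitIsofib : grpdAWFS.{u}.RAlg ⥤ SplitIsofib.{u} where
  obj X := toSplitIsofibObj X
  map φ := ⟨φ.f, preserves_of_hom φ⟩
  map_id _ := rfl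
  map_comp _ _ := rfl

instance : toSplitIsofib.{u}.Faithful where
  map_injective h := Monad.Algebra.Hom.ext (congrArg Subtype.val h)

instance : toSplitIsofib.{u}.Full where
  map_surjective s := ⟨⟨s.1, hom_of_preserves s.1 s.2⟩, rfl⟩

/-- The algebra of a split cloven isofibration. -/
def ofSplitIsofib (P : SplitIsofib.{u}) : grpdAWFS.{u}.RAlg where
  A := P.arrow
  a := Arrow.homMk (f := grpdAWFS.monadR.obj P.arrow) P.cleavage.act (𝟙 _)
    (P.cleavage.act_proj.trans (Category.comp_id (grpdAWFS.rho.app P.arrow)).symm)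
  unit := by
    ext
    · exact P.cleavage.lam_act
    · exact Category.comp_id _
  assoc := by
    ext
    · exact P.cleavage.mul_act
    · rfl

/-- An equality of objects, over the same arrow. The comparison functor leaves underlying squares
unchanged, so it commutes strictly with the forgetful functors. -/
theorem toSplitIsofib_ofSplitIsofib (P : SplitIsofib.{u}) :
    toSplitIsofib.obj (ofSplitIsofib P) = P := by
  obtain ⟨F, c⟩ := P
  exact congrArg (SplitIsofib.mk F) c.ofAlg_act

instance : toSplitIsofib.{u}.EssSurj where
  mem_essImage P := ⟨ofSplitIsofib P, ⟨eqToIso (toSplitIsofib_ofSplitIsofib P)⟩⟩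

instance : toSplitIsofib.{u}.IsEquivalence where

end Comparison

end ElemFib

theorem corollary5p5 :
    ElemFib.IsElementary ElemFib.grpdAWFS.{u}.algFunctor ∧
      ∃ e : ElemFib.grpdAWFS.{u}.RAlg ≌ ElemFib.SplitIsofib.{u},
        e.functor ⋙ ElemFib.SplitIsofib.forget = ElemFib.grpdAWFS.{u}.monadR.forget := by
  exact ⟨ElemFib.isElementary_algFunctor, ElemFib.toSplitIsofib.asEquivalence, rfl⟩
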